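/- **Setting.** Let $d\ge 1$, $d_1=d(d+1)/2$, and let $s\ge 3$ be an integer. Let $\ell=\ell_n$ be positive integers with $\ell_n\to\infty$ and $\ell_n/n\to0$; put $b_n=n/\ell$ and $b_{0n}=\lceil n/\ell\rceil$. Let $w_{kn}$ ($1\le k\le\ell$) be real weights with $\sup\{|w_{kn}|:1\le k\le \ell,\ n\ge1\}<\infty$ and $\lim_{n\to\infty}w_{kn}=1$ for each $k\ge1$. Let $$X_i=\mu+\sum_{j\in\mathbb Z}A_j\varepsilon_{i-j},\qquad i\in\mathbb Z,$$ where $\{\varepsilon_i\}_{i\in\mathbb Z}$ are i.i.d. random vectors in $\mathbb R^d$ with $E\varepsilon_1=0$, $E\|\varepsilon_1\|^2<\infty$, whose law has a nonzero absolutely continuous component with respect to Lebesgue measure on $\mathbb R^d$, and where the $A_j$ are nonrandom $d\times d$ matrices with $\|A_j\|=O(\exp(-\kappa|j|))$ as $|j|\to\infty$ for some $\kappa\in(0,1)$ and $A_\infty=\sum_{j\in\mathbb Z}A_j$ nonsingular. Put $Z_i=X_i-\mu$. For $1\le p\le q\le d$ let $$Y^\#_{in}(p,q)=Z_{i,p}Z_{i,q}+\sum_{k=1}^{\ell}w_{ikn}\,[Z_{i,p}Z_{i+k,q}+Z_{i+k,p}Z_{i,q}],$$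 with $w_{ikn}=w_{kn}$ if $i+k\le n$ and $w_{ikn}=0$ if $i+k>n$. Let $Y_{in}=Y^\#_{in}-EY^\#_{in}\in\mathbb R^{d_1}$, and for $1\le j\le b_{0n}$ let $W_{jn}\in\mathbb R^{d+d_1}$ be the vector with components $\ell^{-1/2}\sum_i Z_i$ and $\ell^{-1}\sum_i Y_{in}$, both sums being over $(j-1)\ell+1\le i\le \min(j\ell,n)$. Let $\mathcal D_j=\sigma\langle\varepsilon_j\rangle$ and $\mathcal D_p^q=\sigma\langle\mathcal D_j:p\le j\le q\rangle$ for $-\infty\le p\le q\le\infty$. Write $\alpha(\mathcal G,\mathcal H)=\sup\{|P(A\cap B)-P(A)P(B)|:A\in\mathcal G,\,B\in\mathcal H\}$. Suprema of uncountable families of conditional expectations are essential suprema. The constants $\kappa$ below may differ from one item to the next. **Conclusion.** * **(A.3)** There is $\kappa\in(0,1)$ such that for all integers $m>\kappa^{-1}$ and $j\ge1$ there is a $\mathcal D_{j-m}^{j+m}$-measurable $Z^\dagger_{j,m}$ with $E\|Z_j-Z^\dagger_{j,m}\|\le\kappa^{-1}e^{-\kappa m}$. * **(A.4)** There is $\kappa\in(0,1)$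 such that $\alpha(\mathcal D_{-\infty}^n,\mathcal D_{n+m}^\infty)\le\kappa^{-1}e^{-\kappa m}$ for all $n,m=1,2,\dots$. * **(A.5)** There is $\kappa\in(0,1)$ such that for all positive integers $i<k<r<j$ and $m>\kappa^{-1}$, $$E\sup_{A\in\mathcal D_i^j}\bigl|P(A\mid\mathcal D_l:l\notin[k,r])-P(A\mid\mathcal D_l:l\in[i-m,k)\cup(r,j+m])\bigr|\le\kappa^{-1}e^{-\kappa m}.$$ * **(A.6)** For $\kappa\in(0,1)$ and a sequence $(d_n)$ let $\mathrm C(\kappa,(d_n))$ be the statement that for all integers $n\ge\kappa^{-1}$ and $\kappa^{-1}<m\le(\log n)^{1/\kappa}$, $$\max_{j_0\in J_n}E\Bigl[\sup_{t\in B_n}\Bigl|E\Bigl\{\exp\Bigl(\sqrt{-1}\,t'\sum_{j=j_0-m}^{j_0+m}W_{jn}\Bigr)\Bigm|\tilde{\mathcal D}_{j_0}\Bigr\}\Bigr|\Bigr]\le1-\kappa,$$ where $J_n=\{m+1,\dots,b_{0n}-m-1\}$, $B_n=\{t\in\mathbb R^{d+d_1}:\kappa d_n\le\|t\|\le b_n^{(s-2)/2+\kappa}\}$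 and $\tilde{\mathcal D}_{j_0}=\sigma\langle\mathcal D_j:j\notin[(j_0-\lfloor m/2\rfloor)\ell+1,(j_0+\lfloor m/2\rfloor+1)\ell]\rangle$ (a supremum or maximum over the empty set is $0$). * If there is $\kappa_1\in(0,1)$ with $\ell_n<\kappa_1^{-1}n^{1/2-\kappa_1}$ for all $n\ge\kappa_1^{-1}$, then there are $\kappa\in(0,1)$ and $(d_n)\subset[1,\infty)$ with $d_n=O(\ell)$, $d_n^2=O(b_n^{1-\kappa})$ and $\mathrm C(\kappa,(d_n))$. * Without that restriction on $\ell$, there is $\kappa_0\in(0,1)$ such that for every $\kappa\in(0,\kappa_0]$ there is $C\ge1$ for which $\mathrm C(\kappa,(d_n))$ holds with $d_n=C\ell_n$. -/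

import Mathlib

open MeasureTheory ProbabilityTheory Filter Topology
open scoped ENNReal

noncomputable section

namespace LinearProcessEE

/-- Index set of the pairs `(p, q)` with `1 ≤ p ≤ q ≤ d`; it has `d (d + 1) / 2` elements. -/
abbrev UpperIdx (d : ℕ) : Type := {pq : Fin d × Fin d // pq.1 ≤ pq.2}

/-- The Euclidean space of dimension `d + d (d + 1) / 2` in which the block variables live. -/
abbrev BlockSpace (d : ℕ) : Type := EuclideanSpace ℝ (Fin d ⊕ UpperIdx d)

section SigmaFields

variable {Ω : Type*}

/-- The sigma-field `σ⟨D j : j ∈ S⟩` generated by the sub-sigma-fields with index in `S`. -/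
abbrev sigmaOn (D : ℤ → MeasurableSpace Ω) (S : Set ℤ) : MeasurableSpace Ω := ⨆ j ∈ S, D j

/-- The strong mixing coefficient
`α(G, H) = sup {|P(A ∩ B) - P(A) P(B)| : A ∈ G, B ∈ H}`. -/
def alphaMixing [MeasurableSpace Ω] (P : Measure Ω) (G H : MeasurableSpace Ω) : ℝ :=
  sSup {x : ℝ | ∃ A B : Set Ω, MeasurableSet[G] A ∧ MeasurableSet[H] B ∧
    x = |P.real (A ∩ B) - P.real A * P.real B|}

/-- `E (sup_i f_i)` for a family of nonnegative random variables that are given up to null sets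
only (such as conditional expectations). The supremum of an uncountable family of that kind is the
essential supremum, that is, the a.s. smallest random variable that a.s. dominates each member of
the family; so its expectation is the least expectation of such a dominating random variable. -/
def expSup [MeasurableSpace Ω] (P : Measure Ω) {ι : Type*} (f : ι → Ω → ℝ) : ℝ≥0∞ :=
  ⨅ (G : Ω → ℝ≥0∞) (_ : Measurable G) (_ : ∀ i, ∀ᵐ ω ∂P, ENNReal.ofReal (f i ω) ≤ G ω),
    ∫⁻ ω, G ω ∂P

/-- The conditional probability `P(A | G)`. -/
def condProb [MeasurableSpace Ω] (P : Measure Ω) (A : Set Ω) (G : MeasurableSpace Ω) : Ω → ℝ :=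
  P[A.indicator (fun _ => (1 : ℝ)) | G]

end SigmaFields

section Blocks

variable {Ω : Type*} [MeasurableSpace Ω] {d : ℕ}

/-- `w_{ikn}`: equal to `w_{kn}` if `i + k ≤ n`, and `0` if `i + k > n`. -/
def truncWeight (w : ℕ → ℕ → ℝ) (n : ℕ) (i : ℤ) (k : ℕ) : ℝ :=
  if i + (k : ℤ) ≤ (n : ℤ) then w k n else 0

/-- The lag products, for `p ≤ q`,
`Z_{i,p} Z_{i,q} + ∑_{k=1}^ℓ w_{ikn} (Z_{i,p} Z_{i+k,q} + Z_{i+k,p} Z_{i,q})`. -/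
def lagProduct (Z : ℤ → Ω → EuclideanSpace ℝ (Fin d)) (w : ℕ → ℕ → ℝ) (ℓ : ℕ → ℕ)
    (n : ℕ) (i : ℤ) (pq : UpperIdx d) (ω : Ω) : ℝ :=
  Z i ω pq.1.1 * Z i ω pq.1.2 +
    ∑ k ∈ Finset.Icc 1 (ℓ n), truncWeight w n i k *
      (Z i ω pq.1.1 * Z (i + (k : ℤ)) ω pq.1.2 + Z (i + (k : ℤ)) ω pq.1.1 * Z i ω pq.1.2)

/-- The centered lag products `Y_{in}`. -/
def centeredLagProduct (P : Measure Ω) (Z : ℤ → Ω → EuclideanSpace ℝ (Fin d))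
    (w : ℕ → ℕ → ℝ) (ℓ : ℕ → ℕ) (n : ℕ) (i : ℤ) (pq : UpperIdx d) (ω : Ω) : ℝ :=
  lagProduct Z w ℓ n i pq ω - ∫ ω', lagProduct Z w ℓ n i pq ω' ∂P

/-- The time indices `(j - 1) ℓ + 1, …, min (j ℓ) n` of the `j`-th block. -/
def blockIdx (ℓ : ℕ → ℕ) (n : ℕ) (j : ℤ) : Finset ℤ :=
  Finset.Icc ((j - 1) * (ℓ n : ℤ) + 1) (min (j * (ℓ n : ℤ)) (n : ℤ))

/-- The block variable `W_{jn}`: its first `d` coordinates are `ℓ^{-1/2} ∑ Z_i` and its last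
`d (d + 1) / 2` coordinates are `ℓ^{-1} ∑ Y_{in}`, the sums being over the `j`-th block. -/
def blockVar (P : Measure Ω) (Z : ℤ → Ω → EuclideanSpace ℝ (Fin d))
    (w : ℕ → ℕ → ℝ) (ℓ : ℕ → ℕ) (n : ℕ) (j : ℤ) (ω : Ω) : BlockSpace d :=
  WithLp.toLp 2 (Sum.elim
    (fun p : Fin d => (Real.sqrt (ℓ n))⁻¹ * ∑ i ∈ blockIdx ℓ n j, Z i ω p)
    (fun pq : UpperIdx d =>
      (ℓ n : ℝ)⁻¹ * ∑ i ∈ blockIdx ℓ n j, centeredLagProduct P Z w ℓ n i pq ω))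

/-- `b_n = n / ℓ_n`. -/
def numBlocks (ℓ : ℕ → ℕ) (n : ℕ) : ℝ := (n : ℝ) / (ℓ n : ℝ)

/-- `b_{0n} = ⌈n / ℓ_n⌉`. -/
def numBlocksCeil (ℓ : ℕ → ℕ) (n : ℕ) : ℤ := ⌈numBlocks ℓ n⌉

/-- `J_n(m) = {m + 1, …, b_{0n} - m - 1}`. -/
def centralBlocks (ℓ : ℕ → ℕ) (n m : ℕ) : Set ℤ :=
  Set.Icc ((m : ℤ) + 1) (numBlocksCeil ℓ n - (m : ℤ) - 1)

/-- `B_n`, the set of the vectors `t` with `κ d_n ≤ ‖t‖ ≤ b_n^{(s-2)/2 + κ}`. -/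
def freqRange (d : ℕ) (ℓ : ℕ → ℕ) (s : ℕ) (κ : ℝ) (dn : ℕ → ℝ) (n : ℕ) : Set (BlockSpace d) :=
  {t | κ * dn n ≤ ‖t‖ ∧ ‖t‖ ≤ numBlocks ℓ n ^ (((s : ℝ) - 2) / 2 + κ)}

/-- The sigma-field generated by all `D j` with `j` outside
`[(j₀ - ⌊m/2⌋) ℓ + 1, (j₀ + ⌊m/2⌋ + 1) ℓ]`. -/
abbrev outerSigma (D : ℤ → MeasurableSpace Ω) (ℓ : ℕ → ℕ) (n m : ℕ) (j₀ : ℤ) : MeasurableSpace Ω :=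
  sigmaOn D (Set.Icc ((j₀ - ((m / 2 : ℕ) : ℤ)) * (ℓ n : ℤ) + 1)
    ((j₀ + ((m / 2 : ℕ) : ℤ) + 1) * (ℓ n : ℤ)))ᶜ

end Blocks

section Assumptions

variable {Ω : Type*} [MeasurableSpace Ω] {d : ℕ}

/-- Approximation of the process by `D_{j-m}^{j+m}`-measurable random vectors (A.3). -/
def ApproxCondition (P : Measure Ω) (D : ℤ → MeasurableSpace Ω)
    (Z : ℤ → Ω → EuclideanSpace ℝ (Fin d)) : Prop :=
  ∃ κ ∈ Set.Ioo (0 : ℝ) 1, ∀ m : ℕ, κ⁻¹ < (m : ℝ) → ∀ j : ℤ, 1 ≤ j →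
    ∃ Zd : Ω → EuclideanSpace ℝ (Fin d),
      Measurable[sigmaOn D (Set.Icc (j - (m : ℤ)) (j + (m : ℤ)))] Zd ∧
      ∫⁻ ω, ‖Z j ω - Zd ω‖ₑ ∂P ≤ ENNReal.ofReal (κ⁻¹ * Real.exp (-(κ * m)))

/-- Exponentially fast strong mixing of the sigma-fields `D j` (A.4). -/
def MixingCondition (P : Measure Ω) (D : ℤ → MeasurableSpace Ω) : Prop :=
  ∃ κ ∈ Set.Ioo (0 : ℝ) 1, ∀ n m : ℕ, 1 ≤ n → 1 ≤ m →
    alphaMixing P (sigmaOn D (Set.Iic (n : ℤ))) (sigmaOn D (Set.Ici ((n : ℤ) + (m : ℤ)))) ≤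
      κ⁻¹ * Real.exp (-(κ * m))

/-- The approximate Markov condition on the sigma-fields `D j` (A.5). -/
def MarkovCondition (P : Measure Ω) (D : ℤ → MeasurableSpace Ω) : Prop :=
  ∃ κ ∈ Set.Ioo (0 : ℝ) 1, ∀ (i k r j : ℤ) (m : ℕ), 1 ≤ i → i < k → k < r → r < j →
    κ⁻¹ < (m : ℝ) →
    expSup P (fun A : {A : Set Ω // MeasurableSet[sigmaOn D (Set.Icc i j)] A} => fun ω =>
        |condProb P A.1 (sigmaOn D (Set.Icc k r)ᶜ) ω -
          condProb P A.1 (sigmaOn D (Set.Ico (i - (m : ℤ)) k ∪ Set.Ioc r (j + (m : ℤ)))) ω|) ≤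
      ENNReal.ofReal (κ⁻¹ * Real.exp (-(κ * m)))

/-- The uniform conditional Cramér inequality with constant `κ` and sequence `dn`: for all
`n ≥ κ⁻¹` and `κ⁻¹ < m ≤ (log n)^{1/κ}`,
`max_{j₀ ∈ J_n(m)} E sup_{t ∈ B_n} |E(exp (i t' ∑_{j=j₀-m}^{j₀+m} W_{jn}) | D̃_{j₀})| ≤ 1 - κ`. -/
def CramerInequality (P : Measure Ω) (D : ℤ → MeasurableSpace Ω)
    (Z : ℤ → Ω → EuclideanSpace ℝ (Fin d)) (w : ℕ → ℕ → ℝ) (ℓ : ℕ → ℕ) (s : ℕ)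
    (κ : ℝ) (dn : ℕ → ℝ) : Prop :=
  ∀ n m : ℕ, κ⁻¹ ≤ (n : ℝ) → κ⁻¹ < (m : ℝ) → (m : ℝ) ≤ Real.log n ^ (1 / κ) →
    ∀ j₀ ∈ centralBlocks ℓ n m,
      expSup P (fun t : freqRange d ℓ s κ dn n => fun ω =>
        ‖(P[fun ω' => Complex.exp (Complex.I *
            ((inner ℝ (t : BlockSpace d)
              (∑ j ∈ Finset.Icc (j₀ - (m : ℤ)) (j₀ + (m : ℤ)), blockVar P Z w ℓ n j ω') : ℝ) : ℂ))
          | outerSigma D ℓ n m j₀]) ω‖) ≤ ENNReal.ofReal (1 - κ)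

/-- The uniform conditional Cramér condition (A.6): the inequality above holds for some `κ` and
some sequence `dn` in `[1, ∞)` with `dn = O(ℓ)` and `dn² = O(b_n^{1-κ})`. -/
def CramerCondition (P : Measure Ω) (D : ℤ → MeasurableSpace Ω)
    (Z : ℤ → Ω → EuclideanSpace ℝ (Fin d)) (w : ℕ → ℕ → ℝ) (ℓ : ℕ → ℕ) (s : ℕ) : Prop :=
  ∃ κ ∈ Set.Ioo (0 : ℝ) 1, ∃ dn : ℕ → ℝ, (∀ n, 1 ≤ dn n) ∧
    (dn =O[atTop] fun n => (ℓ n : ℝ)) ∧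
    ((fun n => dn n ^ 2) =O[atTop] fun n => numBlocks ℓ n ^ (1 - κ)) ∧
    CramerInequality P D Z w ℓ s κ dn

end Assumptions

end LinearProcessEE

end

open MeasureTheory ProbabilityTheory Filter Topology
open scoped ENNReal

set_option linter.unusedSectionVars false

noncomputable section

namespace LinearProcessEE

/-! ### Characteristic functions of laws with an absolutely continuous component. -/

section CharFun

variable {E : Type*} [NormedAddCommGroup E] [InnerProductSpace ℝ E] [MeasurableSpace E]
  [BorelSpace E]

/-! The first three conditions use only the product structure of the innovations. Cutting the filter
at lag `m` leaves an exponentially small tail (`approxCondition_of_exp_decay`). Disjoint sets of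
innovations are independent, so the mixing coefficient vanishes. In the Markov condition both
conditional probabilities integrate out the same window of innovations, hence they coincide.

The content is the Cramér inequality, proved for all `t` with `‖t‖ ≥ c₀ √ℓ`. Up to an additive
constant the phase is a linear form (coefficient `t₁ / √ℓ`) plus a quadratic form (coefficients `t₂
/ ℓ`) in `Z`. Write `τ = ∑ |t₂|`. All but a few innovations of one central block are frozen, and two
regimes are distinguished.

If `τ ≥ c₁ √ℓ`, about `ℓ` innovations are kept free, split into two interleaved families `x` and
`y`. The phase becomes `a x + b y` plus a bilinear form whose adjacent coefficients are of order at
least `ℓ^{-1/2}`, because the lag weights tend to `1` and `A_∞` is invertible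
(`exists_lagForm_impulse_ge`). Cauchy–Schwarz removes `a` and `b`. What remains is a mean of
products of `⌊ℓ/2⌋` factors `|φ(v)|`, with `φ` the characteristic function of an innovation. Since
`|φ(v)| ≤ 1 - c min(1, ‖v‖²)` and `‖v‖² ≳ 1/ℓ` with probability bounded below, the mean stays away
from `1` (`norm_integral_bilinear_phase_le`).

If `τ ≤ c₁ √ℓ`, then `‖t₁‖ ≳ √ℓ`, and a single free innovation suffices. Its linear coefficient has
norm at least `1`, provided the random contribution of the quadratic form to it is bounded. This
holds on an event of probability at least `1/2`, by second moments of the linear process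
(`half_le_measureReal_remainderSize_le`). The square of the innovation contributes only
`O(ℓ^{-1/2})` (`norm_condExp_exp_phase_le_of_linear_term`).

The event does not depend on `t`, so one random variable dominates all frequencies at once, and the
supremum may stand inside the expectation (`expSup_norm_condExp_exp_block_le`). Finally `d_n` of
order `√ℓ` satisfies the growth conditions for short blocks, and `C ℓ` exceeds it always. -/

lemma charFun_withDensity_tendsto_zero [FiniteDimensional ℝ E] (f : E → ℝ≥0∞)
    (hf : Measurable f) (hfin : ∫⁻ x, f x ≠ ∞) :
    Tendsto (charFun ((volume : Measure E).withDensity f)) (cocompact E) (𝓝 0) := by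
  have hlt : ∀ᵐ x, f x < ∞ := ae_lt_top hf hfin
  have key := tendsto_integral_exp_inner_smul_cocompact (V := E) (fun x => ((f x).toReal : ℂ))
  -- Riemann–Lebesgue is stated for the kernel `exp(-2πi⟨x, u⟩)`; rescaling `u` by `-1/(2π)` turns
  -- it into the characteristic function.
  have hne : (-(2 * Real.pi)⁻¹ : ℝ) ≠ 0 := by
    have := Real.pi_pos
    simp [this.ne']
  have hcomp : Tendsto (fun u : E => (-(2 * Real.pi)⁻¹ : ℝ) • u) (cocompact E) (cocompact E) :=
    (Homeomorph.smulOfNeZero _ hne).toCocompactMap.cocompact_tendsto'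
  refine (key.comp hcomp).congr fun u => ?_
  rw [charFun_eq_fourierIntegral', VectorFourier.fourierIntegral,
    integral_withDensity_eq_integral_toReal_smul hf hlt]
  refine integral_congr_ae (Eventually.of_forall fun x => ?_)
  simp only [innerₗ_apply_apply, Pi.one_apply, Circle.smul_def, smul_eq_mul, mul_one,
    Complex.real_smul]
  rw [mul_comm]

/-- By Riemann–Lebesgue the absolutely continuous part contributes at most half its mass far out,
while the singular part has mass strictly less than `1`. -/
lemma exists_norm_charFun_le_of_ac [FiniteDimensional ℝ E] (ν : Measure E)
    [IsProbabilityMeasure ν]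
    (hac : (volume : Measure E).withDensity (ν.rnDeriv volume) ≠ 0) :
    ∃ r c : ℝ, 1 ≤ r ∧ 0 < c ∧ c ≤ 1 ∧ ∀ u : E, r ≤ ‖u‖ → ‖charFun ν u‖ ≤ 1 - c := by
  set μa := (volume : Measure E).withDensity (ν.rnDeriv volume) with hμa
  set μs := ν.singularPart (volume : Measure E) with hμs
  have hdec : ν = μs + μa := ν.haveLebesgueDecomposition_add volume
  have : IsFiniteMeasure μa := by rw [hμa]; infer_instance
  have : IsFiniteMeasure μs := by rw [hμs]; infer_instance
  have hp : 0 < μa.real Set.univ := by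
    rw [measureReal_def, ENNReal.toReal_pos_iff]
    exact ⟨pos_iff_ne_zero.2 (by simpa using hac), measure_lt_top _ _⟩
  have hsum : μs.real Set.univ + μa.real Set.univ = 1 := by
    rw [← measureReal_add_apply, ← hdec]; simp
  have ht : Tendsto (charFun μa) (cocompact E) (𝓝 0) :=
    charFun_withDensity_tendsto_zero _ (Measure.measurable_rnDeriv _ _)
      (Measure.lintegral_rnDeriv_lt_top _ _).ne
  have hev : ∀ᶠ u in cocompact E, ‖charFun μa u‖ < μa.real Set.univ / 2 :=
    (tendsto_zero_iff_norm_tendsto_zero.1 ht).eventually (gt_mem_nhds (by linarith))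
  rw [← Metric.cobounded_eq_cocompact, ← comap_norm_atTop, eventually_comap] at hev
  obtain ⟨r, hr⟩ := eventually_atTop.1 hev
  have hs0 : 0 ≤ μs.real Set.univ := measureReal_nonneg
  refine ⟨max r 1, μa.real Set.univ / 2, le_max_right _ _, by linarith, by linarith,
    fun u hu => ?_⟩
  have h1 := hr ‖u‖ ((le_max_left _ _).trans hu) u rfl
  have h2 : charFun ν u = charFun μs u + charFun μa u := by
    conv_lhs => rw [hdec]
    simp only [charFun_apply]
    have hint : ∀ m : Measure E, IsFiniteMeasure m →
        Integrable (fun x : E => Complex.exp ((inner ℝ x u : ℝ) * Complex.I)) m := by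
      intro m hm
      refine Integrable.of_bound (C := 1) ?_ (Eventually.of_forall fun x => ?_)
      · exact (by fun_prop : Continuous fun x : E =>
          Complex.exp ((inner ℝ x u : ℝ) * Complex.I)).aestronglyMeasurable
      · rw [Complex.norm_exp_ofReal_mul_I]
    exact integral_add_measure (hint _ inferInstance) (hint _ inferInstance)
  rw [h2]
  calc _ ≤ ‖charFun μs u‖ + ‖charFun μa u‖ := norm_add_le _ _
    _ ≤ μs.real Set.univ + μa.real Set.univ / 2 := by
      gcongr
      exact norm_charFun_le _
    _ = 1 - μa.real Set.univ / 2 := by linarith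

variable [SecondCountableTopology E]

/-- Symmetrization: `|φ|²` is the characteristic function of the difference of two independent
copies. -/
lemma sq_norm_charFun_eq_integral_cos (ν : Measure E) [IsProbabilityMeasure ν] (u : E) :
    ‖charFun ν u‖ ^ 2 = ∫ z : E × E, Real.cos (inner ℝ (z.1 - z.2) u) ∂(ν.prod ν) := by
  have h1 : ((‖charFun ν u‖ ^ 2 : ℝ) : ℂ) = charFun ν u * charFun ν (-u) := by
    rw [charFun_neg, Complex.mul_conj, Complex.normSq_eq_norm_sq]
  have h2 : charFun ν u * charFun ν (-u) =
      ∫ z : E × E, Complex.exp ((inner ℝ (z.1 - z.2) u : ℝ) * Complex.I) ∂(ν.prod ν) := by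
    simp only [charFun_apply]
    rw [← integral_prod_mul]
    congr 1 with z
    rw [← Complex.exp_add]
    congr 1
    rw [inner_sub_left, inner_neg_right]
    push_cast
    ring
  have h3 := congrArg Complex.re (h1.trans h2)
  rw [Complex.ofReal_re] at h3
  rw [h3]
  have hint : Integrable (fun z : E × E =>
      Complex.exp ((inner ℝ (z.1 - z.2) u : ℝ) * Complex.I)) (ν.prod ν) := by
    refine Integrable.of_bound (C := 1) ?_ (Eventually.of_forall fun x => ?_)
    · exact (by fun_prop : Continuous fun z : E × E =>
        Complex.exp ((inner ℝ (z.1 - z.2) u : ℝ) * Complex.I)).aestronglyMeasurable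
    · rw [Complex.norm_exp_ofReal_mul_I]
  have h4 := (integral_re hint).symm
  simp only [RCLike.re_to_complex, Complex.exp_ofReal_mul_I_re] at h4
  exact h4

/-- Integrates `1 - cos 2θ = 2 (1 - cos θ)(1 + cos θ) ≤ 4 (1 - cos θ)`. Read backwards, a gap at
`2u` forces a quarter of that gap at `u`. -/
lemma one_sub_sq_norm_charFun_two_smul_le (ν : Measure E) [IsProbabilityMeasure ν] (u : E) :
    1 - ‖charFun ν ((2 : ℝ) • u)‖ ^ 2 ≤ 4 * (1 - ‖charFun ν u‖ ^ 2) := by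
  rw [sq_norm_charFun_eq_integral_cos, sq_norm_charFun_eq_integral_cos]
  have hint : ∀ v : E, Integrable (fun z : E × E =>
      Real.cos (inner ℝ (z.1 - z.2) v)) (ν.prod ν) := by
    intro v
    refine Integrable.of_bound (C := 1) ?_ (Eventually.of_forall fun x => ?_)
    · exact (by fun_prop : Continuous fun z : E × E =>
        Real.cos (inner ℝ (z.1 - z.2) v)).aestronglyMeasurable
    · exact Real.abs_cos_le_one _
  have h1 : ∀ v : E, 1 - ∫ z : E × E, Real.cos (inner ℝ (z.1 - z.2) v) ∂(ν.prod ν) =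
      ∫ z : E × E, (1 - Real.cos (inner ℝ (z.1 - z.2) v)) ∂(ν.prod ν) := by
    intro v
    rw [integral_sub (integrable_const _) (hint v)]
    simp
  rw [h1, h1, ← integral_const_mul]
  refine integral_mono ((integrable_const _).sub (hint _))
    (((integrable_const _).sub (hint _)).const_mul 4) fun z => ?_
  simp only [inner_smul_right, Real.cos_two_mul]
  nlinarith [Real.neg_one_le_cos (inner ℝ (z.1 - z.2) u), Real.cos_le_one (inner ℝ (z.1 - z.2) u),
    sq_nonneg (1 - Real.cos (inner ℝ (z.1 - z.2) u))]

lemma one_sub_sq_norm_charFun_two_pow_smul_le (ν : Measure E) [IsProbabilityMeasure ν] (n : ℕ)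
    (u : E) :
    1 - ‖charFun ν ((2 : ℝ) ^ n • u)‖ ^ 2 ≤ 4 ^ n * (1 - ‖charFun ν u‖ ^ 2) := by
  induction n with
  | zero => simp
  | succ n ih =>
    have h := one_sub_sq_norm_charFun_two_smul_le ν ((2 : ℝ) ^ n • u)
    rw [smul_smul, ← pow_succ'] at h
    calc _ ≤ _ := h
      _ ≤ 4 * (4 ^ n * (1 - ‖charFun ν u‖ ^ 2)) := by gcongr
      _ = _ := by ring

/-- A small frequency is doubled until it reaches the region where the gap is known. The gap loses a
factor `4` per doubling, which is the rate at which `‖u‖²` grows, so a quadratic lower bound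
survives near `0`. -/
lemma exists_norm_charFun_le_one_sub_min [FiniteDimensional ℝ E] (ν : Measure E)
    [IsProbabilityMeasure ν]
    (hac : (volume : Measure E).withDensity (ν.rnDeriv volume) ≠ 0) :
    ∃ c : ℝ, 0 < c ∧ c ≤ 1 ∧ ∀ u : E, ‖charFun ν u‖ ≤ 1 - c * min 1 (‖u‖ ^ 2) := by
  obtain ⟨r, c, hr, hc, hc1, H⟩ := exists_norm_charFun_le_of_ac ν hac
  have hr0 : 0 < r := by linarith
  have hr2 : 1 ≤ r ^ 2 := by nlinarith
  refine ⟨c / (8 * r ^ 2), by positivity, ?_, fun u => ?_⟩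
  · rw [div_le_one (by positivity)]
    linarith
  have hle : c / (8 * r ^ 2) ≤ c := div_le_self hc.le (by linarith)
  rcases le_or_gt r ‖u‖ with hu | hu
  · refine (H u hu).trans ?_
    have : c / (8 * r ^ 2) * min 1 (‖u‖ ^ 2) ≤ c * 1 := by
      gcongr
      exact min_le_left _ _
    linarith
  rcases eq_or_ne u 0 with rfl | hu0
  · simp
  have hpos : 0 < ‖u‖ := norm_pos_iff.2 hu0
  -- `n + 1` is the first number of doublings that brings the norm above `r`, so `‖2^(n+1) u‖` lies
  -- between `r` and `2r`.
  obtain ⟨n, hn1, hn2⟩ := exists_nat_pow_near (x := r / ‖u‖) (y := (2 : ℝ))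
    ((one_le_div hpos).2 hu.le) (by norm_num)
  rw [div_lt_iff₀ hpos] at hn2
  rw [le_div_iff₀ hpos] at hn1
  have h1 := one_sub_sq_norm_charFun_two_pow_smul_le ν (n + 1) u
  have h2 := H ((2 : ℝ) ^ (n + 1) • u) (by
    rw [norm_smul, Real.norm_of_nonneg (by positivity)]; exact hn2.le)
  have h3 : ‖charFun ν ((2 : ℝ) ^ (n + 1) • u)‖ ^ 2 ≤ (1 - c) ^ 2 := by gcongr
  have h4 : (4 : ℝ) ^ (n + 1) * ‖u‖ ^ 2 ≤ 4 * r ^ 2 := by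
    have : (2 ^ n * ‖u‖) ^ 2 ≤ r ^ 2 := by gcongr
    have h5 : (4 : ℝ) ^ (n + 1) * ‖u‖ ^ 2 = 4 * (2 ^ n * ‖u‖) ^ 2 := by
      rw [mul_pow, ← pow_mul, mul_comm n 2, pow_mul, pow_succ]
      norm_num
      ring
    linarith
  have hA : 0 ≤ 1 - ‖charFun ν u‖ ^ 2 := by
    have := norm_charFun_le_one (μ := ν) u
    nlinarith [norm_nonneg (charFun ν u)]
  have h5 : c ≤ 4 ^ (n + 1) * (1 - ‖charFun ν u‖ ^ 2) := by nlinarith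
  have h6 : c * ‖u‖ ^ 2 ≤ 4 * r ^ 2 * (1 - ‖charFun ν u‖ ^ 2) := by
    calc c * ‖u‖ ^ 2 ≤ (4 ^ (n + 1) * (1 - ‖charFun ν u‖ ^ 2)) * ‖u‖ ^ 2 := by gcongr
      _ = (4 ^ (n + 1) * ‖u‖ ^ 2) * (1 - ‖charFun ν u‖ ^ 2) := by ring
      _ ≤ _ := by gcongr
  have h7 : c / (8 * r ^ 2) * min 1 (‖u‖ ^ 2) ≤ c / (8 * r ^ 2) * ‖u‖ ^ 2 := by
    gcongr
    exact min_le_right _ _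
  have h8 : c / (8 * r ^ 2) * ‖u‖ ^ 2 ≤ (1 - ‖charFun ν u‖ ^ 2) / 2 := by
    rw [div_mul_eq_mul_div, div_le_iff₀ (by positivity)]
    linarith
  have h9 := norm_charFun_le_one (μ := ν) u
  nlinarith [norm_nonneg (charFun ν u)]

end CharFun


/-! ### Decoupling of bilinear phases. -/

section Decoupling

/-- Integrating over `x` first leaves `b` as a unimodular factor, which disappears in the modulus.
Cauchy–Schwarz in `y` and expansion of the square introduce a copy `x'`. Then `a x - a x'` does not
involve `y` and disappears in the same way. -/
lemma norm_sq_integral_prod_le_decoupled {α β : Type*} [MeasurableSpace α] [MeasurableSpace β]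
    (μ : Measure α) (ν : Measure β) [IsProbabilityMeasure μ] [IsProbabilityMeasure ν]
    {a : α → ℝ} {b : β → ℝ} {k : α → β → ℝ} (ha : Measurable a) (hb : Measurable b)
    (hk : Measurable (Function.uncurry k)) :
    ‖∫ z : α × β, Complex.exp (Complex.I * ((a z.1 + b z.2 + k z.1 z.2 : ℝ) : ℂ)) ∂(μ.prod ν)‖ ^ 2
      ≤ ∫ x : α × α, ‖∫ y, Complex.exp (Complex.I * ((k x.1 y - k x.2 y : ℝ) : ℂ)) ∂ν‖
          ∂(μ.prod μ) := by
  have hn : ∀ r : ℝ, ‖Complex.exp (Complex.I * (r : ℂ))‖ = 1 := fun r => by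
    rw [mul_comm, Complex.norm_exp_ofReal_mul_I]
  have hint : ∀ {γ : Type _} [MeasurableSpace γ] (m : Measure γ) [IsProbabilityMeasure m]
      (f : γ → ℝ), Measurable f → Integrable (fun z => Complex.exp (Complex.I * (f z : ℂ))) m := by
    intro γ _ m _ f hf
    refine Integrable.of_bound (C := 1) ?_ (Eventually.of_forall fun x => (hn _).le)
    exact (by fun_prop : Measurable fun z => Complex.exp (Complex.I * (f z : ℂ))).aestronglyMeasurable
  have hk1 : ∀ y, Measurable fun x => k x y := fun y => hk.of_uncurry_right
  have hk2 : Measurable fun p : (α × α) × β => k p.1.1 p.2 :=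
    hk.comp ((measurable_fst.comp measurable_fst).prodMk measurable_snd)
  have hk3 : Measurable fun p : (α × α) × β => k p.1.2 p.2 :=
    hk.comp ((measurable_snd.comp measurable_fst).prodMk measurable_snd)
  have hkz : Measurable fun z : α × β => k z.1 z.2 := hk
  set g : β → ℂ := fun y => ∫ x, Complex.exp (Complex.I * ((a x + k x y : ℝ) : ℂ)) ∂μ with hg
  have hgm : StronglyMeasurable g := by
    refine StronglyMeasurable.integral_prod_left' (f := fun z : α × β =>
      Complex.exp (Complex.I * ((a z.1 + k z.1 z.2 : ℝ) : ℂ))) ?_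
    exact (by fun_prop : Measurable _).stronglyMeasurable
  have hg1 : ∀ y, ‖g y‖ ≤ 1 := fun y => by
    refine (norm_integral_le_integral_norm _).trans ?_
    simp only [hn]
    simp
  have hgi : Integrable (fun y => ‖g y‖) ν :=
    (Integrable.of_bound (C := 1) hgm.aestronglyMeasurable (Eventually.of_forall hg1)).norm
  have hg2 : ∀ y, ((‖g y‖ ^ 2 : ℝ) : ℂ) = ∫ x : α × α, Complex.exp (Complex.I *
      ((a x.1 + k x.1 y - (a x.2 + k x.2 y) : ℝ) : ℂ)) ∂(μ.prod μ) := by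
    intro y
    rw [← Complex.normSq_eq_norm_sq, ← Complex.mul_conj, hg]
    simp only
    rw [← integral_conj, ← integral_prod_mul]
    congr 1 with x
    rw [← Complex.exp_conj, ← Complex.exp_add]
    congr 1
    simp only [map_mul, Complex.conj_I, Complex.conj_ofReal]
    push_cast
    ring
  have s1 : ‖∫ z : α × β, Complex.exp (Complex.I * ((a z.1 + b z.2 + k z.1 z.2 : ℝ) : ℂ))
      ∂(μ.prod ν)‖ ≤ ∫ y, ‖g y‖ ∂ν := by
    rw [integral_prod_symm _ (hint _ _ (by fun_prop))]
    refine norm_integral_le_of_norm_le hgi (Eventually.of_forall fun y => le_of_eq ?_)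
    have : ∀ x, Complex.exp (Complex.I * ((a x + b y + k x y : ℝ) : ℂ)) =
        Complex.exp (Complex.I * (b y : ℂ)) * Complex.exp (Complex.I * ((a x + k x y : ℝ) : ℂ)) := by
      intro x
      rw [← Complex.exp_add]
      congr 1
      push_cast
      ring
    simp only [this]
    rw [integral_const_mul, norm_mul, hn, one_mul]
  have s2 : (∫ y, ‖g y‖ ∂ν) ^ 2 ≤ ∫ y, ‖g y‖ ^ 2 ∂ν := by
    have hgi2 : Integrable (fun y => ‖g y‖ ^ 2) ν := by
      refine Integrable.of_bound (C := 1) (hgm.norm.pow 2).aestronglyMeasurable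
        (Eventually.of_forall fun y => ?_)
      rw [Real.norm_of_nonneg (by positivity)]
      exact pow_le_one₀ (norm_nonneg _) (hg1 y)
    set m := ∫ y, ‖g y‖ ∂ν
    have h0 : 0 ≤ ∫ y, (‖g y‖ - m) ^ 2 ∂ν := integral_nonneg fun y => sq_nonneg _
    have h1 : ∫ y, (‖g y‖ - m) ^ 2 ∂ν = ∫ y, ‖g y‖ ^ 2 ∂ν - m ^ 2 := by
      have : ∀ y, (‖g y‖ - m) ^ 2 = ‖g y‖ ^ 2 - 2 * m * ‖g y‖ + m ^ 2 := fun y => by ring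
      simp only [this]
      have e1 := integral_add (hgi2.sub (hgi.const_mul (2 * m))) (integrable_const (m ^ 2))
      have e2 := integral_sub hgi2 (hgi.const_mul (2 * m))
      simp only [Pi.sub_apply] at e1
      rw [e1, e2, integral_const_mul]
      simp
      ring
    linarith
  have hJ : ∫ y, ((‖g y‖ ^ 2 : ℝ) : ℂ) ∂ν = ∫ x : α × α, ∫ y, Complex.exp (Complex.I *
      ((a x.1 + k x.1 y - (a x.2 + k x.2 y) : ℝ) : ℂ)) ∂ν ∂(μ.prod μ) := by
    simp only [hg2]
    exact integral_integral_swap (f := fun (y : β) (x : α × α) => Complex.exp (Complex.I *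
      ((a x.1 + k x.1 y - (a x.2 + k x.2 y) : ℝ) : ℂ)))
      (hint (ν.prod (μ.prod μ)) (fun p => a p.2.1 + k p.2.1 p.1 - (a p.2.2 + k p.2.2 p.1)) (by
        have := hk2.comp (measurable_swap (α := β) (β := α × α))
        have h' := hk3.comp (measurable_swap (α := β) (β := α × α))
        simp only [Function.comp_def, Prod.fst_swap, Prod.snd_swap] at this h'
        fun_prop))
  have s3 : ∫ y, ‖g y‖ ^ 2 ∂ν ≤
      ∫ x : α × α, ‖∫ y, Complex.exp (Complex.I * ((k x.1 y - k x.2 y : ℝ) : ℂ)) ∂ν‖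
          ∂(μ.prod μ) := by
    have h1 : ∫ y, ‖g y‖ ^ 2 ∂ν = ‖∫ y, ((‖g y‖ ^ 2 : ℝ) : ℂ) ∂ν‖ := by
      rw [integral_complex_ofReal, Complex.norm_real, Real.norm_of_nonneg]
      exact integral_nonneg fun y => by positivity
    rw [h1, hJ]
    refine (norm_integral_le_integral_norm _).trans (le_of_eq ?_)
    congr 1 with x
    have : ∀ y, Complex.exp (Complex.I * ((a x.1 + k x.1 y - (a x.2 + k x.2 y) : ℝ) : ℂ)) =
        Complex.exp (Complex.I * ((a x.1 - a x.2 : ℝ) : ℂ)) *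
          Complex.exp (Complex.I * ((k x.1 y - k x.2 y : ℝ) : ℂ)) := by
      intro y
      rw [← Complex.exp_add]
      congr 1
      push_cast
      ring
    simp only [this]
    rw [integral_const_mul, norm_mul, hn, one_mul]
  calc _ ≤ (∫ y, ‖g y‖ ∂ν) ^ 2 := by gcongr
    _ ≤ _ := s2
    _ ≤ _ := s3

variable {E : Type*} [NormedAddCommGroup E] [InnerProductSpace ℝ E] [FiniteDimensional ℝ E]
  [MeasurableSpace E] [BorelSpace E]

lemma integral_pi_exp_sum_inner {ι : Type*} [Fintype ι] (ν : Measure E) [IsProbabilityMeasure ν]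
    (v : ι → E) :
    ∫ x : ι → E, Complex.exp (Complex.I * ((∑ i, inner ℝ (x i) (v i) : ℝ) : ℂ))
        ∂(Measure.pi fun _ => ν) = ∏ i, charFun ν (v i) := by
  have : ∀ x : ι → E, Complex.exp (Complex.I * ((∑ i, inner ℝ (x i) (v i) : ℝ) : ℂ)) =
      ∏ i, Complex.exp ((inner ℝ (x i) (v i) : ℝ) * Complex.I) := by
    intro x
    rw [← Complex.exp_sum]
    congr 1
    push_cast
    rw [Finset.mul_sum]
    exact Finset.sum_congr rfl fun i _ => mul_comm _ _
  simp only [this]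
  exact integral_fintype_prod_eq_prod (μ := fun _ : ι => ν)
    (fun i (x : E) => Complex.exp ((inner ℝ x (v i) : ℝ) * Complex.I))

/-- Anti-concentration, uniform in the shift `v`. If the sum were small with high probability, its
characteristic function at `u / h` would be close to `1` up to a phase. But the factor of index `i₀`
is evaluated at a point of norm at least `1`, so the modulus is at most `1 - c`. -/
lemma measureReal_norm_sum_add_ge {ι : Type*} [Fintype ι] {ν : Measure E} [IsProbabilityMeasure ν]
    {c : ℝ} (hc : 0 < c) (hν : ∀ u : E, ‖charFun ν u‖ ≤ 1 - c * min 1 (‖u‖ ^ 2))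
    (G : ι → E →L[ℝ] E) {h : ℝ} (hh : 0 < h) (i₀ : ι) {u : E} (hu : ‖u‖ = 1)
    (hG : h ≤ ‖(G i₀).adjoint u‖) (v : E) :
    c / 4 ≤ (Measure.pi fun _ : ι => ν).real {x | c * h / 4 ≤ ‖∑ i, G i (x i) + v‖} := by
  classical
  set μ := Measure.pi fun _ : ι => ν
  set T : (ι → E) → E := fun x => ∑ i, G i (x i) + v with hT
  have hTc : Continuous T := by
    simp only [hT]
    fun_prop
  set S := {x | c * h / 4 ≤ ‖T x‖} with hS
  have hSm : MeasurableSet S := (isClosed_le continuous_const hTc.norm).measurableSet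
  have h1 : ‖∫ x, Complex.exp (Complex.I * ((inner ℝ (T x) (h⁻¹ • u) : ℝ) : ℂ)) ∂μ‖ ≤ 1 - c := by
    have e : ∀ x, Complex.exp (Complex.I * ((inner ℝ (T x) (h⁻¹ • u) : ℝ) : ℂ)) =
        Complex.exp (Complex.I * ((inner ℝ v (h⁻¹ • u) : ℝ) : ℂ)) *
        Complex.exp (Complex.I * ((∑ i, inner ℝ (x i) (h⁻¹ • (G i).adjoint u) : ℝ) : ℂ)) := by
      intro x
      rw [← Complex.exp_add, ← mul_add, ← Complex.ofReal_add]
      congr 3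
      simp only [hT, inner_add_left, sum_inner, inner_smul_right,
        ContinuousLinearMap.adjoint_inner_right, ← Finset.mul_sum]
      ring
    simp only [e]
    rw [integral_const_mul, integral_pi_exp_sum_inner, norm_mul, mul_comm Complex.I,
      Complex.norm_exp_ofReal_mul_I, one_mul, norm_prod]
    rw [← Finset.mul_prod_erase _ _ (Finset.mem_univ i₀)]
    have h2 : ∏ x ∈ Finset.univ.erase i₀, ‖charFun ν (h⁻¹ • (G x).adjoint u)‖ ≤ 1 :=
      Finset.prod_le_one (fun _ _ => norm_nonneg _) fun _ _ => norm_charFun_le_one _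
    have h3 : 1 ≤ ‖h⁻¹ • (G i₀).adjoint u‖ ^ 2 := by
      rw [norm_smul, Real.norm_of_nonneg (by positivity)]
      refine one_le_pow₀ ?_
      rw [inv_mul_eq_div, one_le_div hh]
      exact hG
    have h4 := hν (h⁻¹ • (G i₀).adjoint u)
    rw [min_eq_left h3, mul_one] at h4
    calc _ ≤ ‖charFun ν (h⁻¹ • (G i₀).adjoint u)‖ * 1 := by gcongr
      _ ≤ _ := by linarith
  have hpt : ∀ x, ‖1 - Complex.exp (Complex.I * ((inner ℝ (T x) (h⁻¹ • u) : ℝ) : ℂ))‖ ≤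
      c / 4 + S.indicator (fun _ => (2 : ℝ)) x := by
    intro x
    by_cases hx : x ∈ S
    · rw [Set.indicator_of_mem hx]
      refine (norm_sub_le _ _).trans ?_
      rw [mul_comm Complex.I, Complex.norm_exp_ofReal_mul_I, norm_one]
      linarith
    · rw [Set.indicator_of_notMem hx, add_zero, norm_sub_rev]
      refine (Real.norm_exp_I_mul_ofReal_sub_one_le).trans ?_
      rw [inner_smul_right, norm_mul, Real.norm_of_nonneg (by positivity : (0:ℝ) ≤ h⁻¹),
        inv_mul_le_iff₀ hh]
      simp only [hS, Set.mem_ofPred_eq, not_le] at hx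
      have := norm_inner_le_norm (𝕜 := ℝ) (T x) u
      rw [hu, mul_one] at this
      nlinarith
  have hexpint : Integrable
      (fun x => Complex.exp (Complex.I * ((inner ℝ (T x) (h⁻¹ • u) : ℝ) : ℂ))) μ := by
    refine Integrable.of_bound (C := 1) (Continuous.aestronglyMeasurable (by fun_prop))
      (Eventually.of_forall fun x => ?_)
    rw [mul_comm Complex.I, Complex.norm_exp_ofReal_mul_I]
  have h5 : c ≤ c / 4 + 2 * μ.real S := by
    have h6 : ‖∫ x, (1 - Complex.exp (Complex.I * ((inner ℝ (T x) (h⁻¹ • u) : ℝ) : ℂ))) ∂μ‖ ≤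
        ∫ x, (c / 4 + S.indicator (fun _ => (2 : ℝ)) x) ∂μ :=
      norm_integral_le_of_norm_le
        ((integrable_const _).add ((integrable_const _).indicator hSm))
        (Eventually.of_forall hpt)
    rw [integral_sub (integrable_const _) hexpint,
      integral_add (integrable_const _) ((integrable_const _).indicator hSm),
      integral_indicator_const _ hSm] at h6
    simp only [integral_const, probReal_univ, one_smul, smul_eq_mul] at h6
    have h7 := norm_sub_norm_le (1 : ℂ)
      (∫ x, Complex.exp (Complex.I * ((inner ℝ (T x) (h⁻¹ • u) : ℝ) : ℂ)) ∂μ)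
    rw [norm_one] at h7
    linarith
  linarith

/-- After decoupling, the integral over `y` is a product over `j` of `|φ(G j x - G j x')|`. These
factors are dependent through `x` and `x'`, so the product is bounded by the mean of their `N`-th
powers, and each power is treated alone. With probability at least `c / 4` the argument has norm at
least `c h / 4`. There the `N`-th power is at most `exp(-c³/16)`, because `N h² ≥ 1`. -/
lemma norm_integral_bilinear_phase_le {ι : Type*} [Fintype ι] [Nonempty ι] {ν : Measure E}
    [IsProbabilityMeasure ν] {c : ℝ} (hc : 0 < c) (hc1 : c ≤ 1)
    (hν : ∀ u : E, ‖charFun ν u‖ ≤ 1 - c * min 1 (‖u‖ ^ 2))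
    (K : ι → ι → E →L[ℝ] E) {h : ℝ} (hh : 0 < h) (hcard : 1 ≤ Fintype.card ι * h ^ 2)
    (hK : ∀ j, ∃ i, ∃ u : E, ‖u‖ = 1 ∧ h ≤ ‖(K j i).adjoint u‖)
    {a b : (ι → E) → ℝ} (ha : Measurable a) (hb : Measurable b) :
    ‖∫ z : (ι → E) × (ι → E), Complex.exp (Complex.I *
        ((a z.1 + b z.2 + ∑ j, inner ℝ (z.2 j) (∑ i, K j i (z.1 i)) : ℝ) : ℂ))
        ∂((Measure.pi fun _ => ν).prod (Measure.pi fun _ => ν))‖ ≤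
      1 - (1 - Real.exp (-(c ^ 3 / 16))) * c / 8 := by
  set μ := Measure.pi fun _ : ι => ν
  set N := Fintype.card ι with hN
  have hN0 : 0 < N := Fintype.card_pos
  have hN0' : (0 : ℝ) < N := by exact_mod_cast hN0
  set G : ι → (ι → E) → E := fun j x => ∑ i, K j i (x i) with hGdef
  have hGc : ∀ j, Continuous (G j) := fun j => by
    simp only [hGdef]
    fun_prop
  have hkm : Measurable (Function.uncurry fun (x y : ι → E) => ∑ j, inner ℝ (y j) (G j x)) := by
    refine Continuous.measurable ?_
    simp only [Function.uncurry_def]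
    refine continuous_finsetSum _ fun j _ => ?_
    have := hGc j
    fun_prop
  have hdec := norm_sq_integral_prod_le_decoupled μ μ ha hb hkm
  set ρ := Real.exp (-(c ^ 3 / 16)) with hρ
  have hρ1 : ρ ≤ 1 := Real.exp_le_one_iff.2 (by have : 0 ≤ c ^ 3 / 16 := by positivity
                                                linarith)
  have hinner : ∀ x : (ι → E) × (ι → E),
      ‖∫ y, Complex.exp (Complex.I * ((∑ j, inner ℝ (y j) (G j x.1) -
        ∑ j, inner ℝ (y j) (G j x.2) : ℝ) : ℂ)) ∂μ‖ =
      ∏ j, ‖charFun ν (G j x.1 - G j x.2)‖ := by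
    intro x
    simp only [← Finset.sum_sub_distrib, ← inner_sub_right]
    rw [integral_pi_exp_sum_inner ν fun j => G j x.1 - G j x.2, norm_prod]
  set S : ι → (ι → E) → Set (ι → E) := fun j x' => {x | c * h / 4 ≤ ‖G j x + -G j x'‖} with hS
  have hfac : ∀ j (x x' : ι → E), ‖charFun ν (G j x - G j x')‖ ^ N ≤
      1 - (1 - ρ) * (S j x').indicator (fun _ => (1 : ℝ)) x := by
    intro j x x'
    by_cases hx : x ∈ S j x'
    · rw [Set.indicator_of_mem hx, mul_one, sub_sub_cancel]
      have h1 : c * h / 4 ≤ ‖G j x - G j x'‖ := by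
        simpa [hS, sub_eq_add_neg] using hx
      have h2 : min 1 ((c * h / 4) ^ 2) ≤ min 1 (‖G j x - G j x'‖ ^ 2) := by gcongr
      have h3 : ‖charFun ν (G j x - G j x')‖ ≤ Real.exp (-(c * min 1 ((c * h / 4) ^ 2))) := by
        refine (hν _).trans ?_
        have := Real.add_one_le_exp (-(c * min 1 ((c * h / 4) ^ 2)))
        nlinarith
      refine (pow_le_pow_left₀ (norm_nonneg _) h3 N).trans ?_
      rw [← Real.exp_nat_mul, hρ]
      refine Real.exp_le_exp.2 ?_
      -- This is where `1 ≤ N h²` enters; if the minimum is `1`, then `c ≤ 1 ≤ N` is enough.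
      have h4 : c ^ 2 / 16 ≤ N * min 1 ((c * h / 4) ^ 2) := by
        rcases min_cases (1 : ℝ) ((c * h / 4) ^ 2) with ⟨e, -⟩ | ⟨e, -⟩ <;> rw [e]
        · have : (1 : ℝ) ≤ N := by exact_mod_cast hN0
          nlinarith
        · nlinarith [sq_nonneg c]
      nlinarith
    · rw [Set.indicator_of_notMem hx, mul_zero, sub_zero]
      exact pow_le_one₀ (norm_nonneg _) (norm_charFun_le_one _)
  -- Weighted AM–GM applied to the `N`-th powers; it replaces independence of the factors.
  have hamgm : ∀ z : ι → ℝ, (∀ j, 0 ≤ z j) → ∏ j, z j ≤ ∑ j, (N : ℝ)⁻¹ * z j ^ N := by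
    intro z hz
    have := Real.geom_mean_le_arith_mean_weighted Finset.univ (fun _ : ι => (N : ℝ)⁻¹)
      (fun j => z j ^ N) (fun _ _ => by positivity)
      (by simp [← hN, hN0'.ne']) (fun j _ => pow_nonneg (hz j) _)
    refine le_trans (le_of_eq ?_) this
    refine Finset.prod_congr rfl fun j _ => ?_
    rw [← Real.rpow_natCast, ← Real.rpow_mul (hz j), mul_inv_cancel₀ hN0'.ne', Real.rpow_one]
  have hcm : ∀ j, Continuous fun x : (ι → E) × (ι → E) => charFun ν (G j x.1 - G j x.2) := by
    intro j
    have h1 : Continuous (charFun ν) := by fun_prop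
    have := hGc j
    exact h1.comp (by fun_prop)
  have hpint : ∀ j, Integrable (fun x : (ι → E) × (ι → E) =>
      ‖charFun ν (G j x.1 - G j x.2)‖ ^ N) (μ.prod μ) := by
    intro j
    refine Integrable.of_bound (C := 1) ((hcm j).norm.pow N).aestronglyMeasurable
      (Eventually.of_forall fun x => ?_)
    rw [Real.norm_of_nonneg (by positivity)]
    exact pow_le_one₀ (norm_nonneg _) (norm_charFun_le_one _)
  have hj : ∀ j, ∫ x : (ι → E) × (ι → E), ‖charFun ν (G j x.1 - G j x.2)‖ ^ N ∂(μ.prod μ) ≤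
      1 - (1 - ρ) * (c / 4) := by
    intro j
    rw [integral_prod_symm _ (hpint j)]
    have hb : ∀ x' : ι → E, ∫ x, ‖charFun ν (G j x - G j x')‖ ^ N ∂μ ≤ 1 - (1 - ρ) * (c / 4) := by
      intro x'
      have hSm : MeasurableSet (S j x') := by
        refine (isClosed_le continuous_const ?_).measurableSet
        have := hGc j
        fun_prop
      have hi : Integrable (fun x : ι → E => ‖charFun ν (G j x - G j x')‖ ^ N) μ := by
        refine Integrable.of_bound (C := 1) (Continuous.aestronglyMeasurable ?_)
          (Eventually.of_forall fun x => ?_)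
        · exact ((hcm j).comp (by fun_prop : Continuous fun x : ι → E => (x, x'))).norm.pow N
        · rw [Real.norm_of_nonneg (by positivity)]
          exact pow_le_one₀ (norm_nonneg _) (norm_charFun_le_one _)
      have hi2 : Integrable (fun x => (S j x').indicator (fun _ => (1 : ℝ)) x) μ :=
        (integrable_const _).indicator hSm
      refine (integral_mono hi ((integrable_const 1).sub (hi2.const_mul (1 - ρ)))
        fun x => hfac j x x').trans ?_
      simp only [Pi.sub_apply]
      rw [integral_sub (integrable_const _) (hi2.const_mul _), integral_const_mul,
        integral_indicator_const _ hSm]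
      simp only [integral_const, probReal_univ, smul_eq_mul, mul_one]
      obtain ⟨i, u, hu, hKu⟩ := hK j
      have := measureReal_norm_sum_add_ge hc hν (K j) hh i hu hKu (-G j x')
      have h9 : 0 ≤ 1 - ρ := by linarith
      have := mul_le_mul_of_nonneg_left this h9
      simp only [hS, hGdef] at *
      linarith
    calc _ ≤ ∫ _x' : ι → E, (1 - (1 - ρ) * (c / 4)) ∂μ :=
          integral_mono (hpint j).integral_prod_right (integrable_const _) hb
      _ = _ := by simp
  have hfinal : ∫ x : (ι → E) × (ι → E), ∏ j, ‖charFun ν (G j x.1 - G j x.2)‖ ∂(μ.prod μ) ≤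
      1 - (1 - ρ) * (c / 4) := by
    calc _ ≤ ∫ x : (ι → E) × (ι → E), ∑ j, (N : ℝ)⁻¹ * ‖charFun ν (G j x.1 - G j x.2)‖ ^ N
          ∂(μ.prod μ) := by
          refine integral_mono_of_nonneg (Eventually.of_forall fun x =>
            Finset.prod_nonneg fun _ _ => norm_nonneg _)
            (integrable_finsetSum _ fun j _ => (hpint j).const_mul _)
            (Eventually.of_forall fun x => hamgm _ fun j => norm_nonneg _)
      _ = ∑ j, (N : ℝ)⁻¹ * ∫ x : (ι → E) × (ι → E), ‖charFun ν (G j x.1 - G j x.2)‖ ^ N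
          ∂(μ.prod μ) := by
          rw [integral_finsetSum _ fun j _ => (hpint j).const_mul _]
          simp only [integral_const_mul]
      _ ≤ ∑ _j : ι, (N : ℝ)⁻¹ * (1 - (1 - ρ) * (c / 4)) := by
          gcongr with j
          exact hj j
      _ = _ := by
          rw [Finset.sum_const, Finset.card_univ, ← hN, nsmul_eq_mul, ← mul_assoc,
            mul_inv_cancel₀ hN0'.ne', one_mul]
  simp only [hinner] at hdec
  have hsq := hdec.trans hfinal
  have hq : 0 ≤ (1 - ρ) * c := mul_nonneg (by linarith) hc.le
  have hρ0 : 0 < ρ := Real.exp_pos _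
  have hq1 : (1 - ρ) * c ≤ 1 := by nlinarith
  -- Taking the square root of `1 - q/4` gives `1 - q/8`, because `(1 - q/8)² = 1 - q/4 + q²/64`.
  refine le_of_sq_le_sq ?_ (by linarith)
  refine hsq.trans ?_
  nlinarith [sq_nonneg ((1 - ρ) * c / 8)]

end Decoupling


/-! ### Conditional expectations under independence. -/

section CondExp

variable {Ω : Type*} [MeasurableSpace Ω] {P : Measure Ω} [IsProbabilityMeasure P]

/-- The freezing lemma: given `Y`, an independent `X` is integrated out with `Y` held fixed. The
identity is checked on the sets `Y ⁻¹' B` by Fubini. -/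
lemma condExp_comap_eq_integral_of_indepFun {α β V : Type*} [MeasurableSpace α]
    [MeasurableSpace β] [NormedAddCommGroup V] [NormedSpace ℝ V] [CompleteSpace V]
    {X : Ω → α} {Y : Ω → β} (hX : Measurable X) (hY : Measurable Y) (hXY : IndepFun X Y P)
    {f : α × β → V} (hf : StronglyMeasurable f) {C : ℝ} (hC : ∀ p, ‖f p‖ ≤ C) :
    P[fun ω => f (X ω, Y ω) | MeasurableSpace.comap Y inferInstance] =ᵐ[P]
      fun ω => ∫ x, f (x, Y ω) ∂(P.map X) := by
  have hlaw := (indepFun_iff_map_prod_eq_prod_map_map hX.aemeasurable hY.aemeasurable).1 hXY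
  have : IsProbabilityMeasure (P.map X) := Measure.isProbabilityMeasure_map hX.aemeasurable
  have : IsProbabilityMeasure (P.map Y) := Measure.isProbabilityMeasure_map hY.aemeasurable
  have hg : StronglyMeasurable fun y => ∫ x, f (x, y) ∂(P.map X) := hf.integral_prod_left'
  have hgC : ∀ y, ‖∫ x, f (x, y) ∂(P.map X)‖ ≤ C := fun y => by
    refine (norm_integral_le_of_norm_le_const (Eventually.of_forall fun x => hC (x, y))).trans ?_
    simp
  have hfi : Integrable (fun ω => f (X ω, Y ω)) P :=
    Integrable.of_bound (hf.comp_measurable (hX.prodMk hY)).aestronglyMeasurable C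
      (Eventually.of_forall fun _ => hC _)
  symm
  refine ae_eq_condExp_of_forall_setIntegral_eq hY.comap_le hfi (fun s _ _ => ?_) ?_ ?_
  · exact (Integrable.of_bound (hg.comp_measurable hY).aestronglyMeasurable C
      (Eventually.of_forall fun _ => hgC _)).integrableOn
  · rintro s ⟨B, hB, rfl⟩ -
    have hfB : Integrable (fun p : α × β => f p) ((P.map X).prod ((P.map Y).restrict B)) :=
      Integrable.of_bound hf.aestronglyMeasurable C (Eventually.of_forall hC)
    have e1 : ∫ ω in Y ⁻¹' B, f (X ω, Y ω) ∂P = ∫ p in Set.univ ×ˢ B, f p ∂((P.map X).prod (P.map Y)) := by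
      rw [← hlaw, setIntegral_map (MeasurableSet.univ.prod hB) hf.aestronglyMeasurable
        (hX.prodMk hY).aemeasurable]
      congr 2
      ext ω
      simp
    have e2 : ∫ ω in Y ⁻¹' B, ∫ x, f (x, Y ω) ∂(P.map X) ∂P =
        ∫ y in B, ∫ x, f (x, y) ∂(P.map X) ∂(P.map Y) := by
      rw [setIntegral_map hB hg.aestronglyMeasurable hY.aemeasurable]
    rw [e1, e2, ← Measure.prod_restrict, Measure.restrict_univ, integral_prod_symm _ hfB]
  · have hYc : Measurable[MeasurableSpace.comap Y inferInstance] Y := comap_measurable Y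
    exact (hg.comp_measurable hYc).aestronglyMeasurable

/-- Tower property: estimates are made with more innovations frozen than the Cramér inequality
prescribes, then averaged down to the prescribed sigma-field. -/
lemma norm_condExp_le_condExp_of_norm_condExp_le {V : Type*} [NormedAddCommGroup V]
    [NormedSpace ℝ V] [CompleteSpace V] {m₀ G H : MeasurableSpace Ω} {P : Measure[m₀] Ω}
    [IsProbabilityMeasure P] (hGH : G ≤ H) (hH : H ≤ m₀) {f : Ω → V} {g : Ω → ℝ} (hg : Integrable g P)
    (hfg : ∀ᵐ ω ∂P, ‖(P[f | H]) ω‖ ≤ g ω) :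
    ∀ᵐ ω ∂P, ‖(P[f | G]) ω‖ ≤ (P[g | G]) ω := by
  have h1 : P[P[f | H] | G] =ᵐ[P] P[f | G] := condExp_condExp_of_le hGH hH
  have h2 := norm_condExp_le (μ := P) (m := G) (P[f | H])
  have h3 : P[fun ω => ‖(P[f | H]) ω‖ | G] ≤ᵐ[P] P[g | G] :=
    condExp_mono integrable_condExp.norm hg hfg
  filter_upwards [h1, h2, h3] with ω e1 e2 e3
  rw [← e1]
  exact e2.trans e3

/-- A dominating variable common to all indices is all that the essential supremum asks for; the
exceptional null set may vary with the index. -/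
lemma expSup_le_integral {ι : Type*} {f : ι → Ω → ℝ} {g : Ω → ℝ} (hg : Measurable g)
    (hgi : Integrable g P) (hg0 : 0 ≤ᵐ[P] g) (hfg : ∀ i, ∀ᵐ ω ∂P, f i ω ≤ g ω) :
    expSup P f ≤ ENNReal.ofReal (∫ ω, g ω ∂P) := by
  refine (iInf₂_le_of_le (fun ω => ENNReal.ofReal (g ω)) hg.ennreal_ofReal
    (iInf_le _ fun i => ?_)).trans ?_
  · filter_upwards [hfg i] with ω h using ENNReal.ofReal_le_ofReal h
  · rw [ofReal_integral_eq_lintegral_ofReal hgi hg0]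

end CondExp

/-! ### Sigma-fields of innovations; the mixing and Markov conditions. -/

section SigmaOn

variable {Ω E : Type*} [MeasurableSpace Ω] [MeasurableSpace E]

lemma sigmaOn_mono {D : ℤ → MeasurableSpace Ω} {S T : Set ℤ} (h : S ⊆ T) :
    sigmaOn D S ≤ sigmaOn D T :=
  biSup_mono h

variable {ε : ℤ → Ω → E}

lemma sigmaOn_comap_le (hε : ∀ i, Measurable (ε i)) (S : Set ℤ) :
    sigmaOn (fun j => MeasurableSpace.comap (ε j) inferInstance) S ≤ ‹MeasurableSpace Ω› :=
  iSup₂_le fun j _ => (hε j).comap_le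

lemma measurable_sigmaOn {S : Set ℤ} {j : ℤ} (hj : j ∈ S) :
    Measurable[sigmaOn (fun j => MeasurableSpace.comap (ε j) inferInstance) S] (ε j) :=
  (comap_measurable (ε j)).mono (le_iSup₂_of_le j hj le_rfl) le_rfl

lemma indepFun_of_measurable_sigmaOn {P : Measure Ω} {α β : Type*} [MeasurableSpace α]
    [MeasurableSpace β] (hε : ∀ i, Measurable (ε i)) (hind : iIndepFun ε P) {S T : Set ℤ}
    (hST : Disjoint S T) {X : Ω → α} {Y : Ω → β}
    (hX : Measurable[sigmaOn (fun j => MeasurableSpace.comap (ε j) inferInstance) S] X)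
    (hY : Measurable[sigmaOn (fun j => MeasurableSpace.comap (ε j) inferInstance) T] Y) :
    IndepFun X Y P := by
  have h := indep_iSup_of_disjoint (fun i => (hε i).comap_le)
    ((iIndepFun_iff_iIndep _ _ _).1 hind) hST
  rw [IndepFun_iff_Indep]
  exact indep_of_indep_of_le_left (indep_of_indep_of_le_right h hY.comap_le) hX.comap_le

variable [Zero E]

/-- Presents the generated sigma-field as that of a single random sequence, set to zero off `S`,
which is the form that the freezing lemma needs. -/
lemma sigmaOn_comap_eq_comap_indicator (S : Set ℤ) :
    sigmaOn (fun j => MeasurableSpace.comap (ε j) inferInstance) S =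
      MeasurableSpace.comap (fun ω => S.indicator fun j => ε j ω) inferInstance := by
  classical
  refine le_antisymm (iSup₂_le fun j hj => ?_) ?_
  · have h : ε j = (fun y : ℤ → E => y j) ∘ fun ω => S.indicator fun j => ε j ω := by
      ext ω
      simp [Set.indicator_of_mem hj]
    beta_reduce
    conv_lhs => rw [h, ← MeasurableSpace.comap_comp]
    exact MeasurableSpace.comap_mono (measurable_pi_apply j).comap_le
  · refine Measurable.comap_le ?_
    refine @measurable_pi_lambda _ _ _ (_) _ _ fun j => ?_
    by_cases hj : j ∈ S
    · simp only [Set.indicator_of_mem hj]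
      exact measurable_sigmaOn hj
    · simp only [Set.indicator_of_notMem hj]
      exact @measurable_const _ _ _ (_) _

lemma measurable_indicator_sigmaOn (S : Set ℤ) :
    Measurable[sigmaOn (fun j => MeasurableSpace.comap (ε j) inferInstance) S]
      (fun ω => S.indicator fun j => ε j ω) := by
  rw [sigmaOn_comap_eq_comap_indicator]
  exact comap_measurable _

variable {P : Measure Ω} [IsProbabilityMeasure P]

lemma mixingCondition_of_iIndepFun (hε : ∀ i, Measurable (ε i)) (hind : iIndepFun ε P) :
    MixingCondition P (fun j => MeasurableSpace.comap (ε j) inferInstance) := by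
  refine ⟨1 / 2, by norm_num, fun n m _ hm => ?_⟩
  have hdisj : Disjoint (Set.Iic (n : ℤ)) (Set.Ici ((n : ℤ) + m)) := by
    rw [Set.disjoint_left]
    intro x hx hx'
    simp only [Set.mem_Iic, Set.mem_Ici] at hx hx'
    omega
  have h := indep_iSup_of_disjoint (fun i => (hε i).comap_le)
    ((iIndepFun_iff_iIndep _ _ _).1 hind) hdisj
  refine (Real.sSup_nonpos ?_).trans (by positivity)
  rintro x ⟨A, B, hA, hB, rfl⟩
  have := (Indep_iff _ _ _).1 h A B hA hB
  simp [measureReal_def, this]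

/-- The event depends on the innovations in the window `[k, r]` and on those in `S₀`, the rest of
`[i, j]`. Both conditioning sets contain `S₀` and miss the window, so both conditional probabilities
integrate out the window and give the same function of the innovations in `S₀`. The difference is
zero, and any `κ` would do. -/
lemma markovCondition_of_iIndepFun (hε : ∀ i, Measurable (ε i)) (hind : iIndepFun ε P) :
    MarkovCondition P (fun j => MeasurableSpace.comap (ε j) inferInstance) := by
  refine ⟨1 / 2, by norm_num, fun i k r j m hi hik hkr hrj hm => ?_⟩
  refine (expSup_le_integral (g := fun _ => 0) measurable_const (integrable_zero _ _ _)
    (Eventually.of_forall fun _ => le_rfl) ?_).trans (by simp)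
  rintro ⟨A, hA⟩
  set I : Set ℤ := Set.Icc k r
  set S₀ : Set ℤ := Set.Ico i k ∪ Set.Ioc r j
  set X : Ω → ℤ → E := fun ω => I.indicator fun l => ε l ω with hXdef
  have hY : ∀ S : Set ℤ, Measurable fun ω => S.indicator fun l => ε l ω := fun S =>
    (measurable_indicator_sigmaOn S).mono (sigmaOn_comap_le hε S) le_rfl
  have hAm : MeasurableSet[MeasurableSpace.comap
      (fun ω => (X ω, S₀.indicator fun l => ε l ω)) inferInstance] A := by
    refine (?_ : sigmaOn (fun j => MeasurableSpace.comap (ε j) inferInstance) (Set.Icc i j) ≤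
      MeasurableSpace.comap (fun ω => (X ω, S₀.indicator fun l => ε l ω)) inferInstance) _ hA
    refine iSup₂_le fun l hl => ?_
    by_cases hlI : l ∈ I
    · have h : ε l = (fun p : (ℤ → E) × (ℤ → E) => p.1 l) ∘
          fun ω => (X ω, S₀.indicator fun l => ε l ω) := by
        ext ω
        simp [hXdef, Set.indicator_of_mem hlI]
      beta_reduce
      conv_lhs => rw [h, ← MeasurableSpace.comap_comp]
      exact MeasurableSpace.comap_mono
        ((measurable_pi_apply l).comp measurable_fst).comap_le
    · have hlS : l ∈ S₀ := by
        simp only [I, S₀, Set.mem_Icc, Set.mem_union, Set.mem_Ico, Set.mem_Ioc] at *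
        omega
      have h : ε l = (fun p : (ℤ → E) × (ℤ → E) => p.2 l) ∘
          fun ω => (X ω, S₀.indicator fun l => ε l ω) := by
        ext ω
        simp [Set.indicator_of_mem hlS]
      beta_reduce
      conv_lhs => rw [h, ← MeasurableSpace.comap_comp]
      exact MeasurableSpace.comap_mono
        ((measurable_pi_apply l).comp measurable_snd).comap_le
  obtain ⟨C, hC, rfl⟩ := hAm
  have key : ∀ S : Set ℤ, S₀ ⊆ S → Disjoint I S →
      condProb P ((fun ω => (X ω, S₀.indicator fun l => ε l ω)) ⁻¹' C)
        (sigmaOn (fun j => MeasurableSpace.comap (ε j) inferInstance) S) =ᵐ[P]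
      fun ω => ∫ x, C.indicator (fun _ => (1 : ℝ)) (x, S₀.indicator fun l => ε l ω)
        ∂(P.map X) := by
    intro S hS hIS
    have hXY : IndepFun X (fun ω => S.indicator fun l => ε l ω) P :=
      indepFun_of_measurable_sigmaOn hε hind hIS (measurable_indicator_sigmaOn I)
        (measurable_indicator_sigmaOn S)
    have hrm : Measurable fun y : ℤ → E => S₀.indicator y := by
      classical
      refine measurable_pi_lambda _ fun l => ?_
      by_cases hl : l ∈ S₀
      · simp only [Set.indicator_of_mem hl]
        exact measurable_pi_apply l
      · simp only [Set.indicator_of_notMem hl]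
        exact measurable_const
    have hf : StronglyMeasurable fun p : (ℤ → E) × (ℤ → E) =>
        C.indicator (fun _ => (1 : ℝ)) (p.1, S₀.indicator p.2) := by
      refine ((measurable_const.indicator hC).comp ?_).stronglyMeasurable
      exact measurable_fst.prodMk (hrm.comp measurable_snd)
    have h := condExp_comap_eq_integral_of_indepFun (hY I) (hY S) hXY hf (C := 1) (fun p => by
      refine (norm_indicator_le_norm_self _ _).trans ?_
      simp)
    rw [← sigmaOn_comap_eq_comap_indicator] at h
    have e : ∀ ω, S₀.indicator (S.indicator fun l => ε l ω) = S₀.indicator fun l => ε l ω := by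
      intro ω
      rw [Set.indicator_indicator, Set.inter_eq_self_of_subset_left hS]
    simp only [e] at h
    exact h
  have h1 := key (Set.Icc k r)ᶜ (by
    intro l hl
    simp only [S₀, Set.mem_union, Set.mem_Ico, Set.mem_Ioc, Set.mem_compl_iff, Set.mem_Icc] at *
    omega) disjoint_compl_right
  have h2 := key (Set.Ico (i - (m : ℤ)) k ∪ Set.Ioc r (j + (m : ℤ))) (by
    intro l hl
    simp only [S₀, Set.mem_union, Set.mem_Ico, Set.mem_Ioc] at *
    omega) (by
    rw [Set.disjoint_left]
    intro l hl
    simp only [I, Set.mem_union, Set.mem_Ico, Set.mem_Ioc, Set.mem_Icc] at *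
    omega)
  filter_upwards [h1, h2] with ω e1 e2
  exact le_of_eq (abs_eq_zero.2 (sub_eq_zero.2 (e1.trans e2.symm)))

end SigmaOn


/-! ### The linear filter as a measurable map on sequences. -/

section LinearFilter

variable {E : Type*} [NormedAddCommGroup E] [InnerProductSpace ℝ E] [FiniteDimensional ℝ E]
  [MeasurableSpace E] [BorelSpace E]

/-- The linear filter `y ↦ ∑ j, B j (y (i - j))`, the sum being the limit of the symmetric partial
sums. -/
def linearFilter (B : ℤ → E →L[ℝ] E) (y : ℤ → E) (i : ℤ) : E :=
  limUnder atTop fun N : ℕ => ∑ j ∈ Finset.Icc (-(N : ℤ)) N, B j (y (i - j))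

variable (B : ℤ → E →L[ℝ] E)

lemma measurable_linearFilter (i : ℤ) : Measurable fun y => linearFilter B y i := by
  refine (StronglyMeasurable.limUnder fun N => ?_).measurable
  refine Measurable.stronglyMeasurable ?_
  exact Finset.measurable_fun_sum _ fun j _ =>
    (B j).continuous.measurable.comp (measurable_pi_apply _)

variable {B}

lemma linearFilter_eq_of_hasSum {y : ℤ → E} {i : ℤ} {z : E}
    (h : HasSum (fun j => B j (y (i - j))) z) : linearFilter B y i = z :=
  (Tendsto.comp h (Finset.tendsto_Icc_neg (R := ℤ))).limUnder_eq

/-- Separates the finitely many free innovations from the frozen ones. Removing finitely many terms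
preserves summability, so the remainder is the filter of the truncated sequence, hence a measurable
function of the frozen innovations. -/
lemma eq_sum_add_linearFilter_indicator_compl {y : ℤ → E} {i : ℤ} {z : E}
    (h : HasSum (fun j => B j (y (i - j))) z) (I : Finset ℤ) :
    z = ∑ l ∈ I, B (i - l) (y l) + linearFilter B ((I : Set ℤ)ᶜ.indicator y) i := by
  classical
  have h1 : HasSum (fun l => if l ∈ I then B (i - l) (y l) else 0) (∑ l ∈ I, B (i - l) (y l)) := by
    have : HasSum (fun l => if l ∈ I then B (i - l) (y l) else 0)
        (∑ l ∈ I, if l ∈ I then B (i - l) (y l) else 0) :=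
      hasSum_sum_of_ne_finset_zero fun l hl => if_neg hl
    rwa [Finset.sum_congr rfl fun l hl => if_pos hl] at this
  have h2 := h.sub ((Equiv.subLeft i).hasSum_iff.2 h1)
  have h3 : linearFilter B ((I : Set ℤ)ᶜ.indicator y) i = z - ∑ l ∈ I, B (i - l) (y l) := by
    refine linearFilter_eq_of_hasSum ?_
    convert h2 using 2 with j
    simp only [Function.comp_apply, Equiv.subLeft_apply, sub_sub_cancel]
    by_cases hj : i - j ∈ I
    · simp [hj]
    · simp [hj]
  rw [h3]
  abel

end LinearFilter

/-! ### First-moment bounds for the linear process; the approximation condition. -/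

section Moments

variable {Ω : Type*} [MeasurableSpace Ω] {P : Measure Ω} [IsProbabilityMeasure P]

lemma sq_integral_le_integral_sq {f : Ω → ℝ} (hf : MemLp f 2 P) :
    (∫ ω, f ω ∂P) ^ 2 ≤ ∫ ω, f ω ^ 2 ∂P := by
  have h1 : Integrable f P := hf.integrable one_le_two
  have h2 : Integrable (fun ω => f ω ^ 2) P := hf.integrable_sq
  set m := ∫ ω, f ω ∂P
  have h0 : 0 ≤ ∫ ω, (f ω - m) ^ 2 ∂P := integral_nonneg fun y => sq_nonneg _
  have h3 : ∫ ω, (f ω - m) ^ 2 ∂P = ∫ ω, f ω ^ 2 ∂P - m ^ 2 := by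
    have : ∀ y, (f y - m) ^ 2 = f y ^ 2 - 2 * m * f y + m ^ 2 := fun y => by ring
    simp only [this]
    have e1 := integral_add (h2.sub (h1.const_mul (2 * m))) (integrable_const (m ^ 2))
    have e2 := integral_sub h2 (h1.const_mul (2 * m))
    simp only [Pi.sub_apply] at e1
    rw [e1, e2, integral_const_mul]
    simp
    ring
  linarith

variable {E : Type*} [NormedAddCommGroup E] [InnerProductSpace ℝ E] [FiniteDimensional ℝ E]
  [MeasurableSpace E] [BorelSpace E]

lemma integral_norm_sq_sum_smul {ι : Type*} {η : ι → Ω → E}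
    (hind : Pairwise fun i j => IndepFun (η i) (η j) P) (hη : ∀ i, MemLp (η i) 2 P)
    (hmean : ∀ i, ∫ ω, η i ω ∂P = 0) {V : ℝ} (hV : ∀ i, ∫ ω, ‖η i ω‖ ^ 2 ∂P = V)
    (F : Finset ι) (c : ι → ℝ) :
    ∫ ω, ‖∑ s ∈ F, c s • η s ω‖ ^ 2 ∂P = V * ∑ s ∈ F, c s ^ 2 := by
  classical
  have hint : ∀ s s', Integrable (fun ω => inner ℝ (η s ω) (η s' ω)) P := fun s s' =>
    ((hη s).norm.integrable_mul (hη s').norm).mono'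
      ((hη s).1.inner (hη s').1) (Eventually.of_forall fun ω => norm_inner_le_norm _ _)
  have e1 : ∀ ω, ‖∑ s ∈ F, c s • η s ω‖ ^ 2 =
      ∑ s ∈ F, ∑ s' ∈ F, c s * c s' * inner ℝ (η s ω) (η s' ω) := by
    intro ω
    rw [← real_inner_self_eq_norm_sq, sum_inner]
    refine Finset.sum_congr rfl fun s _ => ?_
    rw [inner_sum]
    refine Finset.sum_congr rfl fun s' _ => ?_
    rw [real_inner_smul_left, real_inner_smul_right]
    ring
  have e2 : ∀ s s', ∫ ω, inner ℝ (η s ω) (η s' ω) ∂P = if s = s' then V else 0 := by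
    intro s s'
    split_ifs with h
    · subst h
      simp only [real_inner_self_eq_norm_sq]
      exact hV s
    · have : ∫ ω, inner ℝ (η s ω) (η s' ω) ∂P =
          inner ℝ (∫ ω, η s ω ∂P) (∫ ω, η s' ω ∂P) :=
        (hind h).integral_bilin ((hη s).integrable one_le_two)
          ((hη s').integrable one_le_two) (innerSL ℝ)
      rw [this, hmean, inner_zero_left]
  simp only [e1]
  rw [integral_finsetSum _ fun s _ => integrable_finsetSum _ fun s' _ => (hint s s').const_mul _]
  rw [Finset.mul_sum]
  refine Finset.sum_congr rfl fun s hs => ?_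
  rw [integral_finsetSum _ fun s' _ => (hint s s').const_mul _]
  simp only [integral_const_mul, e2]
  simp only [mul_ite, mul_zero, Finset.sum_ite_eq, hs, if_true]
  ring

variable {ε : ℤ → Ω → E} {B : ℤ → E →L[ℝ] E} {Z : ℤ → Ω → E}

/-- Interchanging sums, `∑ c s Z s = ∑ B j (∑ c s ε (s - j))`. For each `j` the inner sum is
orthogonal, with second moment `V ∑ c s ²`. This cancellation makes sums of length of order `ℓ` cost
only `√ℓ`. Fatou along the symmetric partial sums passes to the limit. -/
lemma lintegral_enorm_sum_smul_linearProcess_le (hε_meas : ∀ i, Measurable (ε i))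
    (hind : iIndepFun ε P) (hident : ∀ i, IdentDistrib (ε i) (ε 1) P P) (hsq : MemLp (ε 1) 2 P)
    (hmean : ∫ ω, ε 1 ω ∂P = 0) (hB : Summable fun j => ‖B j‖)
    (hZ : ∀ i, ∀ᵐ ω ∂P, HasSum (fun j => B j (ε (i - j) ω)) (Z i ω)) (F : Finset ℤ) (c : ℤ → ℝ) :
    ∫⁻ ω, ‖∑ s ∈ F, c s • Z s ω‖ₑ ∂P ≤
      ENNReal.ofReal ((∑' j, ‖B j‖) * √((∫ ω, ‖ε 1 ω‖ ^ 2 ∂P) * ∑ s ∈ F, c s ^ 2)) := by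
  set V := ∫ ω, ‖ε 1 ω‖ ^ 2 ∂P
  have hL2 : ∀ i, MemLp (ε i) 2 P := fun i => (hident i).memLp_iff.2 hsq
  have hm0 : ∀ i, ∫ ω, ε i ω ∂P = 0 := fun i => (hident i).integral_eq.trans hmean
  have hVi : ∀ i, ∫ ω, ‖ε i ω‖ ^ 2 ∂P = V := fun i =>
    ((hident i).comp (u := fun x : E => ‖x‖ ^ 2) (by fun_prop)).integral_eq
  set T : ℤ → Ω → E := fun j ω => ∑ s ∈ F, c s • ε (s - j) ω with hT
  have hT2 : ∀ j, MemLp (T j) 2 P := fun j =>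
    memLp_finsetSum _ fun s _ => (hL2 (s - j)).const_smul (c s)
  have hT1 : ∀ j, ∫ ω, ‖T j ω‖ ∂P ≤ √(V * ∑ s ∈ F, c s ^ 2) := by
    intro j
    refine Real.le_sqrt_of_sq_le ((sq_integral_le_integral_sq (hT2 j).norm).trans (le_of_eq ?_))
    exact integral_norm_sq_sum_smul (η := fun s => ε (s - j))
      (fun s s' h => hind.indepFun fun e => h (by linarith)) (fun s => hL2 _) (fun s => hm0 _)
      (fun s => hVi _) F c
  set W : ℕ → Ω → E := fun N ω => ∑ j ∈ Finset.Icc (-(N : ℤ)) N, B j (T j ω) with hW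
  have hWm : ∀ N, Measurable (W N) := by
    intro N
    refine Finset.measurable_fun_sum _ fun j _ => (B j).continuous.measurable.comp ?_
    exact Finset.measurable_fun_sum _ fun s _ => (hε_meas _).const_smul _
  have hWN : ∀ N, ∫⁻ ω, ‖W N ω‖ₑ ∂P ≤
      ENNReal.ofReal ((∑' j, ‖B j‖) * √(V * ∑ s ∈ F, c s ^ 2)) := by
    intro N
    have hi : ∀ j, Integrable (fun ω => ‖T j ω‖) P := fun j =>
      ((hT2 j).integrable one_le_two).norm
    have hb : ∀ ω, ‖W N ω‖ ≤ ∑ j ∈ Finset.Icc (-(N : ℤ)) N, ‖B j‖ * ‖T j ω‖ := fun ω =>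
      norm_sum_le_of_le _ fun j _ => (B j).le_opNorm _
    have hWi : Integrable (W N) P := by
      refine Integrable.mono' (integrable_finsetSum _ fun j _ => (hi j).const_mul _)
        (hWm N).aestronglyMeasurable (Eventually.of_forall hb)
    rw [← ofReal_integral_norm_eq_lintegral_enorm hWi]
    refine ENNReal.ofReal_le_ofReal ?_
    calc ∫ ω, ‖W N ω‖ ∂P ≤ ∫ ω, ∑ j ∈ Finset.Icc (-(N : ℤ)) N, ‖B j‖ * ‖T j ω‖ ∂P :=
          integral_mono hWi.norm (integrable_finsetSum _ fun j _ => (hi j).const_mul _) hb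
      _ = ∑ j ∈ Finset.Icc (-(N : ℤ)) N, ‖B j‖ * ∫ ω, ‖T j ω‖ ∂P := by
          rw [integral_finsetSum _ fun j _ => (hi j).const_mul _]
          simp only [integral_const_mul]
      _ ≤ ∑ j ∈ Finset.Icc (-(N : ℤ)) N, ‖B j‖ * √(V * ∑ s ∈ F, c s ^ 2) := by
          gcongr with j
          exact hT1 j
      _ = (∑ j ∈ Finset.Icc (-(N : ℤ)) N, ‖B j‖) * √(V * ∑ s ∈ F, c s ^ 2) := by
          rw [Finset.sum_mul]
      _ ≤ _ := by
          gcongr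
          exact hB.sum_le_tsum _ fun _ _ => norm_nonneg _
  have hlim : ∀ᵐ ω ∂P, Tendsto (fun N => ‖W N ω‖ₑ) atTop (𝓝 ‖∑ s ∈ F, c s • Z s ω‖ₑ) := by
    filter_upwards [ae_all_iff.2 hZ] with ω h
    have h1 := hasSum_sum (s := F) fun s _ => (h s).const_smul (c s)
    have h2 : (fun N => W N ω) = (fun G : Finset ℤ => ∑ j ∈ G, ∑ s ∈ F, c s • B j (ε (s - j) ω)) ∘
        fun N : ℕ => Finset.Icc (-(N : ℤ)) N := by
      ext1 N
      simp only [hW, hT, Function.comp_apply, map_sum, map_smul]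
    have h3 : Tendsto (fun N => W N ω) atTop (𝓝 (∑ s ∈ F, c s • Z s ω)) := by
      rw [h2]
      exact Tendsto.comp h1 (Finset.tendsto_Icc_neg (R := ℤ))
    exact h3.enorm
  calc ∫⁻ ω, ‖∑ s ∈ F, c s • Z s ω‖ₑ ∂P = ∫⁻ ω, liminf (fun N => ‖W N ω‖ₑ) atTop ∂P :=
        lintegral_congr_ae (hlim.mono fun ω h => h.liminf_eq.symm)
    _ ≤ liminf (fun N => ∫⁻ ω, ‖W N ω‖ₑ ∂P) atTop :=
        lintegral_liminf_le fun N => (hWm N).enorm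
    _ ≤ _ := by
        refine liminf_le_of_le (by isBoundedDefault) fun b hb => ?_
        obtain ⟨N, hN⟩ := hb.exists
        exact hN.trans (hWN N)

lemma summable_exp_neg_mul_abs_int {κ : ℝ} (hκ : 0 < κ) :
    Summable fun i : ℤ => Real.exp (-(κ * |(i : ℝ)|)) := by
  have h : Summable fun n : ℕ => Real.exp (-(κ * n)) := by
    refine (Real.summable_exp_nat_mul_iff.2 (neg_lt_zero.2 hκ)).congr fun n => ?_
    congr 1
    ring
  refine Summable.of_nat_of_neg ?_ ?_
  · simpa using h
  · simpa using h

/-- The approximation is the filter cut at lag `m`. Half of the decay rate yields the factor `exp(-κ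
m / 2)`; the other half keeps the tail summable. -/
lemma approxCondition_of_exp_decay {d : ℕ} {ε Z : ℤ → Ω → EuclideanSpace ℝ (Fin d)}
    {B : ℤ → EuclideanSpace ℝ (Fin d) →L[ℝ] EuclideanSpace ℝ (Fin d)} (hε_meas : ∀ i, Measurable (ε i))
    (hident : ∀ i, IdentDistrib (ε i) (ε 1) P P) (hint : Integrable (ε 1) P)
    {K κ : ℝ} (hκ : 0 < κ) (hB : ∀ j, ‖B j‖ ≤ K * Real.exp (-(κ * |(j : ℝ)|)))
    (hZ : ∀ i, ∀ᵐ ω ∂P, HasSum (fun j => B j (ε (i - j) ω)) (Z i ω)) :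
    ApproxCondition P (fun j => MeasurableSpace.comap (ε j) inferInstance) Z := by
  have hK : 0 ≤ K := by simpa using (norm_nonneg _).trans (hB 0)
  set S : ℝ := ∑' i : ℤ, Real.exp (-(κ / 2 * |(i : ℝ)|)) with hS
  have hsum := summable_exp_neg_mul_abs_int (half_pos hκ)
  have hS0 : 0 ≤ S := tsum_nonneg fun i => (Real.exp_pos _).le
  set M : ℝ := ∫ ω, ‖ε 1 ω‖ ∂P with hM
  have hM0 : 0 ≤ M := integral_nonneg fun _ => norm_nonneg _
  set R : ℝ := K * S * M with hR
  have hR0 : 0 ≤ R := by positivity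
  -- The second entry ensures both `κ' < 1` and `R ≤ κ'⁻¹`, so the constant `R` is absorbed.
  set κ' : ℝ := min (κ / 2) (1 / (2 + R)) with hκ'
  have hκ'0 : 0 < κ' := lt_min (half_pos hκ) (by positivity)
  have hκ'1 : κ' < 1 := by
    refine (min_le_right _ _).trans_lt ?_
    rw [div_lt_one (by positivity)]
    linarith
  have hRκ : R ≤ κ'⁻¹ := by
    have h1 : κ' ≤ 1 / (2 + R) := min_le_right _ _
    have h2 : (2 + R) ≤ κ'⁻¹ := by
      rw [le_inv_comm₀ (by positivity) hκ'0]
      simpa using h1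
    linarith
  refine ⟨κ', ⟨hκ'0, hκ'1⟩, fun m hm j _ => ?_⟩
  set F : Finset ℤ := Finset.Icc (-(m : ℤ)) m with hF
  refine ⟨fun ω => ∑ k ∈ F, B k (ε (j - k) ω), ?_, ?_⟩
  · refine Finset.measurable_fun_sum _ fun k hk => ?_
    refine (B k).continuous.measurable.comp (measurable_sigmaOn ?_)
    simp only [hF, Finset.mem_Icc, Set.mem_Icc] at *
    omega
  have hpt : ∀ᵐ ω ∂P, ‖Z j ω - ∑ k ∈ F, B k (ε (j - k) ω)‖ₑ ≤
      ∑' k : ℤ, ENNReal.ofReal (Real.exp (-(κ / 2 * m)) * (K * Real.exp (-(κ / 2 * |(k : ℝ)|)))) *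
        ‖ε (j - k) ω‖ₑ := by
    filter_upwards [hZ j] with ω h
    have h1 : HasSum (fun k => if k ∈ F then B k (ε (j - k) ω) else 0)
        (∑ k ∈ F, B k (ε (j - k) ω)) := by
      have : HasSum (fun k => if k ∈ F then B k (ε (j - k) ω) else 0)
          (∑ k ∈ F, if k ∈ F then B k (ε (j - k) ω) else 0) :=
        hasSum_sum_of_ne_finset_zero fun l hl => if_neg hl
      rwa [Finset.sum_congr rfl fun l hl => if_pos hl] at this
    rw [← (h.sub h1).tsum_eq]
    refine enorm_tsum_le_tsum_enorm.trans (ENNReal.tsum_le_tsum fun k => ?_)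
    by_cases hk : k ∈ F
    · simp [hk]
    rw [if_neg hk, sub_zero]
    refine ((B k).le_opENorm _).trans ?_
    gcongr
    rw [← ofReal_norm]
    refine ENNReal.ofReal_le_ofReal ((hB k).trans ?_)
    have hkm : (m : ℝ) ≤ |(k : ℝ)| := by
      have : (m : ℤ) ≤ |k| := by
        by_contra! hlt
        exact hk (by rw [hF, Finset.mem_Icc]; exact abs_le.1 hlt.le)
      exact_mod_cast this
    calc K * Real.exp (-(κ * |(k : ℝ)|)) ≤
        K * (Real.exp (-(κ / 2 * m)) * Real.exp (-(κ / 2 * |(k : ℝ)|))) := by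
          rw [← Real.exp_add]
          gcongr
          nlinarith
      _ = _ := by ring
  have hEε : ∀ i, ∫⁻ ω, ‖ε i ω‖ₑ ∂P = ENNReal.ofReal M := by
    intro i
    have h1 := ((hident i).comp (u := fun x : EuclideanSpace ℝ (Fin d) => ‖x‖ₑ) (by fun_prop)).lintegral_eq
    simp only [Function.comp_apply] at h1
    rw [h1, hM, ofReal_integral_norm_eq_lintegral_enorm hint]
  refine (lintegral_mono_ae hpt).trans ?_
  rw [lintegral_tsum fun k => ((hε_meas _).enorm.const_mul _).aemeasurable]
  simp only [lintegral_const_mul _ (hε_meas _).enorm, hEε]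
  rw [ENNReal.tsum_mul_right, ← ENNReal.ofReal_tsum_of_nonneg (fun k => by positivity)
    ((hsum.mul_left _).mul_left _), ← ENNReal.ofReal_mul (tsum_nonneg fun k => by positivity),
    tsum_mul_left, tsum_mul_left]
  refine ENNReal.ofReal_le_ofReal ?_
  have hexp : Real.exp (-(κ / 2 * m)) ≤ Real.exp (-(κ' * m)) := by
    have : κ' ≤ κ / 2 := min_le_left _ _
    gcongr
  calc Real.exp (-(κ / 2 * m)) * (K * S) * M = R * Real.exp (-(κ / 2 * m)) := by rw [hR]; ring
    _ ≤ _ := by gcongr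

end Moments


/-! ### The lag products as a bilinear form, and its weights. -/

section LagForm

/-- The weight of the product `z s * z' s'` coming from the lag products based at `min s s'`, when
`s < s'`. -/
def upperLagWeight (w : ℕ → ℕ → ℝ) (ℓ : ℕ → ℕ) (n : ℕ) (T : Finset ℤ) (s s' : ℤ) : ℝ :=
  if s ∈ T ∧ s < s' ∧ s' ≤ s + ℓ n then truncWeight w n s (s' - s).toNat else 0

/-- The weight of the product `z s * z' s'` in the sum over `T` of the lag products. -/
def lagWeight (w : ℕ → ℕ → ℝ) (ℓ : ℕ → ℕ) (n : ℕ) (T : Finset ℤ) (s s' : ℤ) : ℝ :=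
  (if s = s' ∧ s ∈ T then 1 else 0) + upperLagWeight w ℓ n T s s' + upperLagWeight w ℓ n T s' s

variable {w : ℕ → ℕ → ℝ} {ℓ : ℕ → ℕ} {n : ℕ}

lemma lagWeight_comm (T : Finset ℤ) (s s' : ℤ) :
    lagWeight w ℓ n T s s' = lagWeight w ℓ n T s' s := by
  have : (if s = s' ∧ s ∈ T then (1 : ℝ) else 0) = if s' = s ∧ s' ∈ T then 1 else 0 := by
    by_cases h : s = s'
    · simp [h]
    · simp [h, Ne.symm h]
  rw [lagWeight, lagWeight, this]
  ring

lemma abs_upperLagWeight_le {M : ℝ} (hM0 : 0 ≤ M) (hM : ∀ k : ℕ, 1 ≤ k → k ≤ ℓ n → |w k n| ≤ M)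
    (T : Finset ℤ) (s s' : ℤ) : |upperLagWeight w ℓ n T s s'| ≤ M := by
  unfold upperLagWeight truncWeight
  split_ifs with h1 h2
  · exact hM _ (by omega) (by omega)
  · simpa
  · simpa

lemma abs_lagWeight_le {M : ℝ} (hM0 : 0 ≤ M) (hM : ∀ k : ℕ, 1 ≤ k → k ≤ ℓ n → |w k n| ≤ M)
    (T : Finset ℤ) (s s' : ℤ) : |lagWeight w ℓ n T s s'| ≤ 1 + 2 * M := by
  have h1 := abs_upperLagWeight_le hM0 hM T s s'
  have h2 := abs_upperLagWeight_le hM0 hM T s' s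
  have h3 : |(if s = s' ∧ s ∈ T then (1 : ℝ) else 0)| ≤ 1 := by split_ifs <;> simp
  unfold lagWeight
  exact (abs_add_three _ _ _).trans (by linarith)

lemma sum_upperLagWeight_mul (T F : Finset ℤ) (hF : ∀ s ∈ T, ∀ k : ℕ, k ≤ ℓ n → s + (k : ℤ) ∈ F)
    (f g : ℤ → ℝ) :
    ∑ s ∈ F, ∑ s' ∈ F, upperLagWeight w ℓ n T s s' * (f s * g s') =
      ∑ s ∈ T, ∑ k ∈ Finset.Icc 1 (ℓ n), truncWeight w n s k * (f s * g (s + (k : ℤ))) := by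
  have hTF : T ⊆ F := fun s hs => by simpa using hF s hs 0 (Nat.zero_le _)
  rw [← Finset.sum_subset hTF (fun s _ hs => Finset.sum_eq_zero fun s' _ => by
    simp [upperLagWeight, hs])]
  refine Finset.sum_congr rfl fun s hs => ?_
  have hsub : Finset.Ioc s (s + ℓ n) ⊆ F := by
    intro s' hs'
    rw [Finset.mem_Ioc] at hs'
    have := hF s hs (s' - s).toNat (by omega)
    rwa [Int.toNat_of_nonneg (by omega), add_sub_cancel] at this
  rw [← Finset.sum_subset hsub (fun s' _ hs' => by
    rw [upperLagWeight, if_neg, zero_mul]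
    simp only [Finset.mem_Ioc] at hs'
    tauto)]
  symm
  refine Finset.sum_nbij' (fun k : ℕ => s + (k : ℤ)) (fun s' => (s' - s).toNat) ?_ ?_ ?_ ?_ ?_
  · intro k hk
    simp only [Finset.mem_Icc, Finset.mem_Ioc] at *
    omega
  · intro k hk
    simp only [Finset.mem_Icc, Finset.mem_Ioc] at *
    omega
  · intro k hk
    simp
  · intro k hk
    simp only [Finset.mem_Ioc] at hk
    omega
  · intro k hk
    simp only [Finset.mem_Icc] at hk
    rw [upperLagWeight, if_pos ⟨hs, by omega, by omega⟩]
    simp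

lemma sum_lagWeight_mul (T F : Finset ℤ) (hF : ∀ s ∈ T, ∀ k : ℕ, k ≤ ℓ n → s + (k : ℤ) ∈ F)
    (f g : ℤ → ℝ) :
    ∑ s ∈ F, ∑ s' ∈ F, lagWeight w ℓ n T s s' * (f s * g s') =
      ∑ s ∈ T, (f s * g s + ∑ k ∈ Finset.Icc 1 (ℓ n), truncWeight w n s k *
        (f s * g (s + (k : ℤ)) + f (s + (k : ℤ)) * g s)) := by
  have hTF : T ⊆ F := fun s hs => by simpa using hF s hs 0 (Nat.zero_le _)
  have h1 := sum_upperLagWeight_mul (w := w) T F hF f g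
  have h2 := sum_upperLagWeight_mul (w := w) T F hF g f
  rw [Finset.sum_comm] at h2
  have h3 : ∑ s ∈ F, ∑ s' ∈ F, (if s = s' ∧ s ∈ T then (1 : ℝ) else 0) * (f s * g s') =
      ∑ s ∈ T, f s * g s := by
    rw [← Finset.sum_subset hTF (fun s _ hs => Finset.sum_eq_zero fun s' _ => by simp [hs])]
    refine Finset.sum_congr rfl fun s hs => ?_
    simp [hs, hTF hs]
  have e1 : ∀ s s', lagWeight w ℓ n T s s' * (f s * g s') =
      (if s = s' ∧ s ∈ T then (1 : ℝ) else 0) * (f s * g s') +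
        upperLagWeight w ℓ n T s s' * (f s * g s') +
        upperLagWeight w ℓ n T s' s * (g s' * f s) := by
    intro s s'
    rw [lagWeight]
    ring
  simp only [e1, Finset.sum_add_distrib, h1, h2, h3, mul_add]
  rw [add_assoc]
  congr 2
  refine Finset.sum_congr rfl fun s _ => Finset.sum_congr rfl fun k _ => ?_
  ring

variable {d : ℕ}

/-- The bilinear form whose diagonal is the sum over `T` of the lag products, weighted by `t`;
`F` is a set of indices that contains all those of the process that occur. -/
def lagForm (w : ℕ → ℕ → ℝ) (ℓ : ℕ → ℕ) (n : ℕ) (T F : Finset ℤ) (t : UpperIdx d → ℝ) :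
    (ℤ → EuclideanSpace ℝ (Fin d)) →ₗ[ℝ] (ℤ → EuclideanSpace ℝ (Fin d)) →ₗ[ℝ] ℝ :=
  LinearMap.mk₂ ℝ (fun z z' => (ℓ n : ℝ)⁻¹ * ∑ pq, t pq * ∑ s ∈ F, ∑ s' ∈ F,
      lagWeight w ℓ n T s s' * (z s pq.1.1 * z' s' pq.1.2))
    (fun z₁ z₂ z' => by
      simp only [Pi.add_apply, PiLp.add_apply, add_mul, mul_add, Finset.sum_add_distrib])
    (fun c z z' => by
      simp only [Pi.smul_apply, PiLp.smul_apply, smul_eq_mul, Finset.mul_sum]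
      refine Finset.sum_congr rfl fun _ _ => Finset.sum_congr rfl fun _ _ =>
        Finset.sum_congr rfl fun _ _ => by ring)
    (fun z z₁ z₂ => by
      simp only [Pi.add_apply, PiLp.add_apply, mul_add, Finset.sum_add_distrib])
    (fun c z z' => by
      simp only [Pi.smul_apply, PiLp.smul_apply, smul_eq_mul, Finset.mul_sum]
      refine Finset.sum_congr rfl fun _ _ => Finset.sum_congr rfl fun _ _ =>
        Finset.sum_congr rfl fun _ _ => by ring)

lemma lagForm_apply (T F : Finset ℤ) (t : UpperIdx d → ℝ)
    (z z' : ℤ → EuclideanSpace ℝ (Fin d)) :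
    lagForm w ℓ n T F t z z' = (ℓ n : ℝ)⁻¹ * ∑ pq, t pq * ∑ s ∈ F, ∑ s' ∈ F,
      lagWeight w ℓ n T s s' * (z s pq.1.1 * z' s' pq.1.2) := rfl

lemma lagForm_self_eq_sum_lagProduct {Ω : Type*} {T F : Finset ℤ}
    (hF : ∀ s ∈ T, ∀ k : ℕ, k ≤ ℓ n → s + (k : ℤ) ∈ F) (t : UpperIdx d → ℝ)
    (Z : ℤ → Ω → EuclideanSpace ℝ (Fin d)) (ω : Ω) :
    lagForm w ℓ n T F t (fun s => Z s ω) (fun s => Z s ω) =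
      ∑ pq, t pq * ((ℓ n : ℝ)⁻¹ * ∑ s ∈ T, lagProduct Z w ℓ n s pq ω) := by
  rw [lagForm_apply, Finset.mul_sum]
  refine Finset.sum_congr rfl fun pq _ => ?_
  rw [sum_lagWeight_mul T F hF (fun s => Z s ω pq.1.1) (fun s => Z s ω pq.1.2)]
  simp only [lagProduct]
  ring

/-- The sum over `s'` stays inside the norm, so that cancellation in weighted sums of the process
can be exploited when `z'` is random. -/
lemma abs_lagForm_le (T F : Finset ℤ) (t : UpperIdx d → ℝ)
    (z z' : ℤ → EuclideanSpace ℝ (Fin d)) :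
    |lagForm w ℓ n T F t z z'| ≤ (ℓ n : ℝ)⁻¹ * (∑ pq, |t pq|) *
      ∑ s ∈ F, ‖z s‖ * ‖∑ s' ∈ F, lagWeight w ℓ n T s s' • z' s'‖ := by
  have hc : ∀ (v : EuclideanSpace ℝ (Fin d)) p, |v p| ≤ ‖v‖ := fun v p => by
    simpa using PiLp.norm_apply_le v p
  rw [lagForm_apply, abs_mul, abs_of_nonneg (by positivity : (0 : ℝ) ≤ (ℓ n : ℝ)⁻¹), mul_assoc,
    Finset.sum_mul]
  gcongr
  refine (Finset.abs_sum_le_sum_abs _ _).trans (Finset.sum_le_sum fun pq _ => ?_)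
  rw [abs_mul]
  gcongr
  refine (Finset.abs_sum_le_sum_abs _ _).trans (Finset.sum_le_sum fun s _ => ?_)
  have : ∑ s' ∈ F, lagWeight w ℓ n T s s' * (z s pq.1.1 * z' s' pq.1.2) =
      z s pq.1.1 * (∑ s' ∈ F, lagWeight w ℓ n T s s' • z' s') pq.1.2 := by
    simp only [WithLp.ofLp_sum, Finset.sum_apply, PiLp.smul_apply, smul_eq_mul, Finset.mul_sum]
    exact Finset.sum_congr rfl fun _ _ => by ring
  rw [this, abs_mul]
  gcongr
  · exact hc _ _
  · exact hc _ _

/-- Symmetry of the weights gives the same bound with the arguments exchanged. -/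
lemma abs_lagForm_swap_le (T F : Finset ℤ) (t : UpperIdx d → ℝ)
    (z z' : ℤ → EuclideanSpace ℝ (Fin d)) :
    |lagForm w ℓ n T F t z' z| ≤ (ℓ n : ℝ)⁻¹ * (∑ pq, |t pq|) *
      ∑ s ∈ F, ‖z s‖ * ‖∑ s' ∈ F, lagWeight w ℓ n T s s' • z' s'‖ := by
  have hc : ∀ (v : EuclideanSpace ℝ (Fin d)) p, |v p| ≤ ‖v‖ := fun v p => by
    simpa using PiLp.norm_apply_le v p
  rw [lagForm_apply, abs_mul, abs_of_nonneg (by positivity : (0 : ℝ) ≤ (ℓ n : ℝ)⁻¹), mul_assoc,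
    Finset.sum_mul]
  gcongr
  refine (Finset.abs_sum_le_sum_abs _ _).trans (Finset.sum_le_sum fun pq _ => ?_)
  rw [abs_mul]
  gcongr
  rw [Finset.sum_comm]
  refine (Finset.abs_sum_le_sum_abs _ _).trans (Finset.sum_le_sum fun s _ => ?_)
  have : ∑ s' ∈ F, lagWeight w ℓ n T s' s * (z' s' pq.1.1 * z s pq.1.2) =
      z s pq.1.2 * (∑ s' ∈ F, lagWeight w ℓ n T s s' • z' s') pq.1.1 := by
    simp only [WithLp.ofLp_sum, Finset.sum_apply, PiLp.smul_apply, smul_eq_mul, Finset.mul_sum]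
    exact Finset.sum_congr rfl fun s' _ => by rw [lagWeight_comm]; ring
  rw [this, abs_mul]
  gcongr
  · exact hc _ _
  · exact hc _ _

/-- A bound for `|lagWeight (i + u) (j + v) - 1|` if `i - j = e` and `i`, `j` are far from the
ends of the index set. -/
def lagDefect (w : ℕ → ℕ → ℝ) (ℓ : ℕ → ℕ) (M : ℝ) (e : ℤ) (n : ℕ) (uv : ℤ × ℤ) : ℝ :=
  if |uv.1| + |uv.2| + |e| ≤ ℓ n then
    (if e + uv.1 - uv.2 = 0 then 0 else |w (e + uv.1 - uv.2).natAbs n - 1|)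
  else 2 + 2 * M

/-- When `|u| + |v| + |i - j| ≤ ℓ`, both times lie in `[lo, hi]` and their gap is at most `ℓ`. The
weight is then `1` on the diagonal and `w_{gap, n}` off it, untruncated since `hi ≤ n`. Otherwise
the crude bound on the weights is used. -/
lemma abs_lagWeight_sub_one_le {M : ℝ} (hM0 : 0 ≤ M)
    (hM : ∀ k : ℕ, 1 ≤ k → k ≤ ℓ n → |w k n| ≤ M) {lo hi i j : ℤ} (hi1 : lo + ℓ n ≤ i)
    (hi2 : i + ℓ n ≤ hi) (hj1 : lo + ℓ n ≤ j) (hj2 : j + ℓ n ≤ hi) (hn : hi ≤ n) (u v : ℤ) :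
    |lagWeight w ℓ n (Finset.Icc lo hi) (i + u) (j + v) - 1| ≤
      lagDefect w ℓ M (i - j) n (u, v) := by
  unfold lagDefect
  split_ifs with h1 h2
  · have hij : i + u = j + v := by simp only at h2; omega
    have hT : j + v ∈ Finset.Icc lo hi := by
      simp only at h1
      rw [Finset.mem_Icc]
      constructor <;> [skip; skip] <;> grind
    rw [hij]
    simp [lagWeight, upperLagWeight, hT]
  · simp only at h1 h2
    have hsi : i + u ∈ Finset.Icc lo hi := by rw [Finset.mem_Icc]; constructor <;> grind
    have hsj : j + v ∈ Finset.Icc lo hi := by rw [Finset.mem_Icc]; constructor <;> grind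
    rw [Finset.mem_Icc] at hsi hsj
    rcases lt_or_gt_of_ne (show i + u ≠ j + v by omega) with hlt | hlt
    · have hle : j + v ≤ i + u + ℓ n := by grind
      have e1 : lagWeight w ℓ n (Finset.Icc lo hi) (i + u) (j + v) =
          w (i - j + u - v).natAbs n := by
        have hk : (j + v - (i + u)).toNat = (i - j + u - v).natAbs := by omega
        rw [lagWeight, if_neg (by omega), upperLagWeight, if_pos ⟨Finset.mem_Icc.2 hsi, hlt, hle⟩,
          upperLagWeight, if_neg (by omega), truncWeight, if_pos (by omega), hk]
        ring
      rw [e1]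
    · have hle : i + u ≤ j + v + ℓ n := by grind
      have e1 : lagWeight w ℓ n (Finset.Icc lo hi) (i + u) (j + v) =
          w (i - j + u - v).natAbs n := by
        have hk : (i + u - (j + v)).toNat = (i - j + u - v).natAbs := by omega
        rw [lagWeight, if_neg (by omega), upperLagWeight, if_neg (by omega),
          upperLagWeight, if_pos ⟨Finset.mem_Icc.2 hsj, hlt, hle⟩, truncWeight,
          if_pos (by omega), hk]
        ring
      rw [e1]
  · have := abs_lagWeight_le (w := w) hM0 hM (Finset.Icc lo hi) (i + u) (j + v)
    rw [abs_le] at *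
    constructor <;> linarith

lemma abs_lagDefect_le {M : ℝ} (hM0 : 0 ≤ M) (hM : ∀ k : ℕ, 1 ≤ k → k ≤ ℓ n → |w k n| ≤ M)
    (e : ℤ) (uv : ℤ × ℤ) : |lagDefect w ℓ M e n uv| ≤ 2 + 2 * M := by
  unfold lagDefect
  split_ifs with h1 h2
  · simp only [abs_zero]
    positivity
  · rw [abs_abs]
    have := hM (e + uv.1 - uv.2).natAbs (by omega) (by grind)
    rw [abs_le] at *
    constructor <;> linarith
  · rw [abs_of_nonneg (by positivity)]

lemma tendsto_lagDefect (hℓ : Tendsto ℓ atTop atTop)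
    (hw_lim : ∀ k : ℕ, 1 ≤ k → Tendsto (fun n => w k n) atTop (𝓝 1)) (M : ℝ) (e : ℤ)
    (uv : ℤ × ℤ) : Tendsto (fun n => lagDefect w ℓ M e n uv) atTop (𝓝 0) := by
  have h1 : ∀ᶠ n in atTop, |uv.1| + |uv.2| + |e| ≤ ℓ n := by
    filter_upwards [hℓ.eventually_ge_atTop (|uv.1| + |uv.2| + |e|).toNat] with n hn
    omega
  by_cases h2 : e + uv.1 - uv.2 = 0
  · refine tendsto_const_nhds.congr' ?_
    filter_upwards [h1] with n hn
    rw [lagDefect, if_pos hn, if_pos h2]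
  · have h3 : Tendsto (fun n => |w (e + uv.1 - uv.2).natAbs n - 1|) atTop (𝓝 0) := by
      have := ((hw_lim (e + uv.1 - uv.2).natAbs (by omega)).sub_const 1).abs
      simpa using this
    refine h3.congr' ?_
    filter_upwards [h1] with n hn
    rw [lagDefect, if_pos hn, if_neg h2]

/-- Dominated convergence: convergence of the weights is assumed only for each fixed lag, and their
boundedness provides the dominating function. -/
lemma tendsto_tsum_lagDefect {M : ℝ} (hM0 : 0 ≤ M)
    (hM : ∀ n k : ℕ, 1 ≤ n → 1 ≤ k → k ≤ ℓ n → |w k n| ≤ M) (hℓ : Tendsto ℓ atTop atTop)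
    (hw_lim : ∀ k : ℕ, 1 ≤ k → Tendsto (fun n => w k n) atTop (𝓝 1)) (e : ℤ) {α : ℤ → ℝ}
    (hα0 : ∀ u, 0 ≤ α u) (hα : Summable α) :
    Tendsto (fun n => ∑' uv : ℤ × ℤ, lagDefect w ℓ M e n uv * (α uv.1 * α uv.2)) atTop (𝓝 0) := by
  have hs : Summable fun uv : ℤ × ℤ => α uv.1 * α uv.2 :=
    hα.mul_of_nonneg hα hα0 hα0
  have := tendsto_tsum_of_dominated_convergence (𝓕 := atTop)
    (f := fun n (uv : ℤ × ℤ) => lagDefect w ℓ M e n uv * (α uv.1 * α uv.2))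
    (g := fun _ => 0) (bound := fun uv : ℤ × ℤ => (2 + 2 * M) * (α uv.1 * α uv.2))
    (hs.mul_left _)
    (fun uv => by simpa using (tendsto_lagDefect hℓ hw_lim M e uv).mul_const (α uv.1 * α uv.2))
    (by
      filter_upwards [eventually_ge_atTop 1] with n hn uv
      have h0 : 0 ≤ α uv.1 * α uv.2 := mul_nonneg (hα0 _) (hα0 _)
      rw [norm_mul, Real.norm_eq_abs, Real.norm_of_nonneg h0]
      gcongr
      exact abs_lagDefect_le hM0 (fun k => hM n k hn) e uv)
  simpa using this

/-- If all weights were `1`, the double sum would factor into the product of the two total sums; the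
defect measures the deviation. For impulse responses the total sums are the coordinates of `A_∞ x`
and `A_∞ y`. -/
lemma abs_sum_lagWeight_sub_tsum_mul_tsum_le {M : ℝ} (hM0 : 0 ≤ M)
    (hM : ∀ k : ℕ, 1 ≤ k → k ≤ ℓ n → |w k n| ≤ M) {lo hi i j : ℤ} (hi1 : lo + ℓ n ≤ i)
    (hi2 : i + ℓ n ≤ hi) (hj1 : lo + ℓ n ≤ j) (hj2 : j + ℓ n ≤ hi) (hn : hi ≤ n)
    {F : Finset ℤ} (hF : ∀ s ∈ Finset.Icc lo hi, ∀ k : ℕ, k ≤ ℓ n → s + (k : ℤ) ∈ F)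
    {α f g : ℤ → ℝ} (hα : Summable α) {x y : ℝ} (hf : ∀ u, |f u| ≤ α u * x)
    (hg : ∀ u, |g u| ≤ α u * y) :
    |∑ s ∈ F, ∑ s' ∈ F, lagWeight w ℓ n (Finset.Icc lo hi) s s' * (f (s - i) * g (s' - j)) -
      (∑' u, f u) * ∑' v, g v| ≤
      (∑' uv : ℤ × ℤ, lagDefect w ℓ M (i - j) n uv * (α uv.1 * α uv.2)) * (x * y) := by
  set T := Finset.Icc lo hi
  have hfs : Summable fun u => ‖f u‖ := Summable.of_nonneg_of_le (fun _ => norm_nonneg _) hf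
    (hα.mul_right x)
  have hgs : Summable fun u => ‖g u‖ := Summable.of_nonneg_of_le (fun _ => norm_nonneg _) hg
    (hα.mul_right y)
  have hfg : Summable fun uv : ℤ × ℤ => f uv.1 * g uv.2 := summable_mul_of_summable_norm hfs hgs
  have hαx : Summable fun u => α u * x := hα.mul_right x
  have hαy : Summable fun u => α u * y := hα.mul_right y
  have hαα : Summable fun uv : ℤ × ℤ => (α uv.1 * x) * (α uv.2 * y) :=
    hαx.mul_of_nonneg hαy (fun u => (abs_nonneg _).trans (hf u))
      (fun u => (abs_nonneg _).trans (hg u))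
  have hzero : ∀ p : ℤ × ℤ, p ∉ F ×ˢ F →
      lagWeight w ℓ n T p.1 p.2 * (f (p.1 - i) * g (p.2 - j)) = 0 := by
    rintro ⟨s, s'⟩ hp
    have hTF : T ⊆ F := fun s hs => by simpa using hF s hs 0 (Nat.zero_le _)
    have hU : ∀ a b : ℤ, ¬ (a ∈ F ∧ b ∈ F) → upperLagWeight w ℓ n T a b = 0 := by
      intro a b hab
      rw [upperLagWeight, if_neg]
      rintro ⟨h1, h2, h3⟩
      refine hab ⟨hTF h1, ?_⟩
      have := hF a h1 (b - a).toNat (by omega)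
      rwa [Int.toNat_of_nonneg (by omega), add_sub_cancel] at this
    simp only [Finset.mem_product] at hp
    rw [lagWeight, hU s s' hp, hU s' s (by tauto), if_neg]
    · simp
    · rintro ⟨hss, h⟩
      simp only at hss h
      exact hp ⟨hTF h, hss ▸ hTF h⟩
  have e1 : ∑ s ∈ F, ∑ s' ∈ F, lagWeight w ℓ n T s s' * (f (s - i) * g (s' - j)) =
      ∑' uv : ℤ × ℤ, lagWeight w ℓ n T (i + uv.1) (j + uv.2) * (f uv.1 * g uv.2) := by
    rw [← Finset.sum_product (s := F) (t := F)
      (f := fun p => lagWeight w ℓ n T p.1 p.2 * (f (p.1 - i) * g (p.2 - j))),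
      ← tsum_eq_sum (L := .unconditional _) (fun p hp => hzero p hp),
      ← ((Equiv.addLeft i).prodCongr (Equiv.addLeft j)).tsum_eq]
    simp
  rw [e1, tsum_mul_tsum_of_summable_norm hfs hgs]
  set ρ : ℤ × ℤ → ℝ := lagDefect w ℓ M (i - j) n
  have hb : ∀ uv : ℤ × ℤ, ‖(lagWeight w ℓ n T (i + uv.1) (j + uv.2) - 1) * (f uv.1 * g uv.2)‖ ≤
      ρ uv * ((α uv.1 * x) * (α uv.2 * y)) := by
    intro uv
    have h1 := abs_lagWeight_sub_one_le hM0 hM hi1 hi2 hj1 hj2 hn uv.1 uv.2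
    rw [norm_mul, norm_mul, Real.norm_eq_abs, Real.norm_eq_abs, Real.norm_eq_abs]
    have h2 := (abs_nonneg _).trans h1
    exact mul_le_mul h1 (mul_le_mul (hf _) (hg _) (abs_nonneg _) ((abs_nonneg _).trans (hf _)))
      (by positivity) h2
  have hbs : Summable fun uv : ℤ × ℤ => ρ uv * ((α uv.1 * x) * (α uv.2 * y)) := by
    refine Summable.of_norm_bounded (hαα.mul_left (2 + 2 * M)) fun uv => ?_
    rw [norm_mul, Real.norm_eq_abs, Real.norm_of_nonneg (mul_nonneg ((abs_nonneg _).trans (hf _))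
      ((abs_nonneg _).trans (hg _)))]
    exact mul_le_mul_of_nonneg_right (abs_lagDefect_le hM0 hM _ uv)
      (mul_nonneg ((abs_nonneg _).trans (hf _)) ((abs_nonneg _).trans (hg _)))
  have hds : Summable fun uv : ℤ × ℤ =>
      (lagWeight w ℓ n T (i + uv.1) (j + uv.2) - 1) * (f uv.1 * g uv.2) :=
    Summable.of_norm_bounded hbs hb
  have e2 : ∑' uv : ℤ × ℤ, lagWeight w ℓ n T (i + uv.1) (j + uv.2) * (f uv.1 * g uv.2) -
      ∑' uv : ℤ × ℤ, f uv.1 * g uv.2 =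
      ∑' uv : ℤ × ℤ, (lagWeight w ℓ n T (i + uv.1) (j + uv.2) - 1) * (f uv.1 * g uv.2) := by
    rw [sub_eq_iff_eq_add, ← hds.tsum_add hfg]
    exact tsum_congr fun uv => by ring
  rw [e2, ← Real.norm_eq_abs, ← tsum_mul_right]
  refine (tsum_of_norm_bounded hbs.hasSum hb).trans (le_of_eq (tsum_congr fun uv => ?_))
  ring

variable {E : Type*} [NormedAddCommGroup E] [CompleteSpace E]

lemma norm_sum_Icc_sub_tsum_le {B : ℤ → E} (hB : Summable fun j => ‖B j‖) {L : ℕ} {lo hi i : ℤ}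
    (hi1 : lo + L ≤ i) (hi2 : i + L ≤ hi) :
    ‖∑ s ∈ Finset.Icc lo hi, B (s - i) - ∑' u, B u‖ ≤
      ∑' u : ℤ, if |u| ≤ L then 0 else ‖B u‖ := by
  have e1 : ∑ s ∈ Finset.Icc lo hi, B (s - i) =
      ∑' u, if i + u ∈ Finset.Icc lo hi then B u else 0 := by
    have e0 : ∑ s ∈ Finset.Icc lo hi, B (s - i) =
        ∑' s, if s ∈ Finset.Icc lo hi then B (s - i) else 0 := by
      rw [tsum_eq_sum (s := Finset.Icc lo hi) fun s hs => if_neg hs]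
      exact Finset.sum_congr rfl fun s hs => (if_pos hs).symm
    rw [e0, ← (Equiv.addLeft i).tsum_eq]
    simp
  have hs1 : Summable fun u => if i + u ∈ Finset.Icc lo hi then B u else 0 := by
    refine Summable.of_norm_bounded hB fun u => ?_
    split_ifs <;> simp
  have hs2 : Summable fun u : ℤ => if |u| ≤ L then 0 else ‖B u‖ := by
    refine Summable.of_norm_bounded hB fun u => ?_
    split_ifs <;> simp
  rw [e1, ← hs1.tsum_sub hB.of_norm]
  refine tsum_of_norm_bounded hs2.hasSum fun u => ?_
  by_cases hu : |u| ≤ L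
  · have : i + u ∈ Finset.Icc lo hi := by
      rw [Finset.mem_Icc]
      constructor <;> grind
    simp [this, hu]
  · rw [if_neg hu]
    split_ifs <;> simp

lemma tendsto_tsum_ite_abs_le {B : ℤ → E} (hB : Summable fun j => ‖B j‖)
    (hℓ : Tendsto ℓ atTop atTop) :
    Tendsto (fun n => ∑' u : ℤ, if |u| ≤ (ℓ n : ℤ) then 0 else ‖B u‖) atTop (𝓝 0) := by
  have := tendsto_tsum_of_dominated_convergence (𝓕 := atTop)
    (f := fun n (u : ℤ) => if |u| ≤ (ℓ n : ℤ) then 0 else ‖B u‖)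
    (g := fun _ => 0) hB
    (fun u => by
      refine tendsto_const_nhds.congr' ?_
      filter_upwards [hℓ.eventually_ge_atTop |u|.toNat] with n hn
      rw [if_pos (by omega)])
    (Eventually.of_forall fun n u => by split_ifs <;> simp)
  simpa using this

end LagForm


/-! ### Conditional bounds for abstract quadratic phases. -/

section PhaseBounds

variable {E : Type*} [NormedAddCommGroup E] [InnerProductSpace ℝ E]

/-- The contribution of the innovation `x` at time `i` to the linear process. -/
def impulse (B : ℤ → E →L[ℝ] E) (i : ℤ) : E →ₗ[ℝ] (ℤ → E) :=
  LinearMap.pi fun s => (B (s - i)).toLinearMap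

lemma impulse_apply (B : ℤ → E →L[ℝ] E) (i : ℤ) (x : E) (s : ℤ) :
    impulse B i x s = B (s - i) x := rfl

variable [FiniteDimensional ℝ E]

lemma exists_inner_eq_linearMap (φ : E →ₗ[ℝ] ℝ) : ∃ L : E, ∀ x, inner ℝ x L = φ x := by
  refine ⟨(InnerProductSpace.toDual ℝ E).symm (LinearMap.toContinuousLinearMap φ), fun x => ?_⟩
  rw [real_inner_comm, InnerProductSpace.toDual_symm_apply]
  rfl

lemma exists_inner_eq_bilinear (β : E →ₗ[ℝ] E →ₗ[ℝ] ℝ) :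
    ∃ K : E →L[ℝ] E, ∀ x y, inner ℝ y (K x) = β x y := by
  set e := stdOrthonormalBasis ℝ E
  set K : E →ₗ[ℝ] E := ∑ k, (LinearMap.toSpanSingleton ℝ E (e k)).comp (β.flip (e k)) with hKdef
  have hK : ∀ x, K x = ∑ k, β x (e k) • e k := fun x => by simp [hKdef]
  refine ⟨LinearMap.toContinuousLinearMap K, fun x y => ?_⟩
  have h : β x y = β x (∑ k, inner ℝ (e k) y • e k) := by rw [e.sum_repr' y]
  rw [h, LinearMap.coe_toContinuousLinearMap', hK]
  simp only [inner_sum, inner_smul_right, map_sum, map_smul, smul_eq_mul]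
  refine Finset.sum_congr rfl fun k _ => ?_
  rw [real_inner_comm]
  ring

lemma measurable_cexp_I_mul {α : Type*} [MeasurableSpace α] {g : α → ℝ} (hg : Measurable g) :
    Measurable fun a => Complex.exp (Complex.I * (g a : ℂ)) :=
  Complex.measurable_exp.comp (measurable_const.mul (Complex.measurable_ofReal.comp hg))

lemma norm_cexp_I_mul (r : ℝ) : ‖Complex.exp (Complex.I * (r : ℂ))‖ = 1 := by
  rw [mul_comm, Complex.norm_exp_ofReal_mul_I]

variable [MeasurableSpace E] [BorelSpace E] {Ω : Type*} [MeasurableSpace Ω] {P : Measure Ω}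
  [IsProbabilityMeasure P] {ε : ℤ → Ω → E} {B : ℤ → E →L[ℝ] E} {Z : ℤ → Ω → E}

lemma measurable_pi_sigmaOn {ι : Type*} {σ : ι → ℤ} {S : Set ℤ} (h : ∀ i, σ i ∈ S) :
    Measurable[sigmaOn (fun j => MeasurableSpace.comap (ε j) inferInstance) S]
      (fun ω i => ε (σ i) ω) :=
  @measurable_pi_lambda _ _ _ (_) _ _ fun i => measurable_sigmaOn (h i)

lemma map_pi_eq_pi_of_iIndepFun {ι : Type*} [Fintype ι] (hε_meas : ∀ i, Measurable (ε i))
    (hind : iIndepFun ε P) (hident : ∀ i, IdentDistrib (ε i) (ε 1) P P) {σ : ι → ℤ}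
    (hσ : Function.Injective σ) :
    P.map (fun ω i => ε (σ i) ω) = Measure.pi fun _ => P.map (ε 1) := by
  have h := (iIndepFun_iff_map_fun_eq_pi_map (fun i => (hε_meas (σ i)).aemeasurable)).1
    (hind.precomp hσ)
  rw [h]
  congr 1
  ext1 i
  exact (hident (σ i)).map_eq

/-- With everything outside the two families frozen at `ρ`, the process is `Lx x + Ly y + ρ`. The
quadratic phase splits into a function of `x`, a function of `y` and a bilinear form. The frozen
part enters only the first two, which decoupling discards, so the bound is deterministic. -/
lemma norm_condExp_exp_phase_le_of_cross_terms (hε_meas : ∀ i, Measurable (ε i))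
    (hind : iIndepFun ε P) (hident : ∀ i, IdentDistrib (ε i) (ε 1) P P)
    (hZ : ∀ i, ∀ᵐ ω ∂P, HasSum (fun j => B j (ε (i - j) ω)) (Z i ω))
    {c : ℝ} (hc : 0 < c) (hc1 : c ≤ 1)
    (hν : ∀ u : E, ‖charFun (P.map (ε 1)) u‖ ≤ 1 - c * min 1 (‖u‖ ^ 2))
    {φ : (ℤ → E) →ₗ[ℝ] ℝ} {q : (ℤ → E) →ₗ[ℝ] (ℤ → E) →ₗ[ℝ] ℝ} (hφ : Measurable φ)
    (hq : Measurable fun p : (ℤ → E) × (ℤ → E) => q p.1 p.2) (r : ℝ)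
    {ι : Type*} [Fintype ι] [Nonempty ι] {σ τ : ι → ℤ} (hσ : Function.Injective σ)
    (hτ : Function.Injective τ) (hστ : ∀ i j, σ i ≠ τ j) {h : ℝ} (hh : 0 < h)
    (hcard : 1 ≤ Fintype.card ι * h ^ 2)
    (hcross : ∀ j, ∃ i, ∃ x y : E, x ≠ 0 ∧ y ≠ 0 ∧ h * (‖x‖ * ‖y‖) ≤
      |q (impulse B (σ i) x) (impulse B (τ j) y) + q (impulse B (τ j) y) (impulse B (σ i) x)|) :
    ∀ᵐ ω ∂P, ‖(P[fun ω => Complex.exp (Complex.I *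
        ((φ (fun s => Z s ω) + q (fun s => Z s ω) (fun s => Z s ω) + r : ℝ) : ℂ)) |
        sigmaOn (fun j => MeasurableSpace.comap (ε j) inferInstance)
          (Set.range σ ∪ Set.range τ)ᶜ]) ω‖ ≤
      1 - (1 - Real.exp (-(c ^ 3 / 16))) * c / 8 := by
  classical
  set ν := P.map (ε 1) with hνdef
  have : IsProbabilityMeasure ν := Measure.isProbabilityMeasure_map (hε_meas 1).aemeasurable
  set I : Finset ℤ := Finset.univ.image σ ∪ Finset.univ.image τ with hI
  have hIset : (I : Set ℤ) = Set.range σ ∪ Set.range τ := by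
    simp [hI]
  set X : Ω → (ι → E) × (ι → E) := fun ω => (fun i => ε (σ i) ω, fun j => ε (τ j) ω) with hX
  set W : Ω → ℤ → E := fun ω => (I : Set ℤ)ᶜ.indicator fun l => ε l ω with hW
  have hXm : Measurable[sigmaOn (fun j => MeasurableSpace.comap (ε j) inferInstance) (I : Set ℤ)]
      X := by
    refine Measurable.prodMk ?_ ?_
    · exact measurable_pi_sigmaOn fun i => by rw [hIset]; simp
    · exact measurable_pi_sigmaOn fun i => by rw [hIset]; simp
  have hXm' : Measurable X := hXm.mono (sigmaOn_comap_le hε_meas _) le_rfl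
  have hWm : Measurable W :=
    (measurable_indicator_sigmaOn _).mono (sigmaOn_comap_le hε_meas _) le_rfl
  have hXW : IndepFun X W P :=
    indepFun_of_measurable_sigmaOn hε_meas hind disjoint_compl_right hXm
      (measurable_indicator_sigmaOn _)
  have hlawX : P.map X = (Measure.pi fun _ => ν).prod (Measure.pi fun _ => ν) := by
    have hdis : Disjoint (Set.range σ) (Set.range τ) := by
      rw [Set.disjoint_left]
      rintro _ ⟨i, rfl⟩ ⟨j, hj⟩
      exact hστ i j hj.symm
    have hi := indepFun_of_measurable_sigmaOn (X := fun ω i => ε (σ i) ω)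
      (Y := fun ω i => ε (τ i) ω) hε_meas hind hdis
      (measurable_pi_sigmaOn Set.mem_range_self) (measurable_pi_sigmaOn Set.mem_range_self)
    rw [hX, (indepFun_iff_map_prod_eq_prod_map_map (by fun_prop) (by fun_prop)).1 hi,
      map_pi_eq_pi_of_iIndepFun hε_meas hind hident hσ,
      map_pi_eq_pi_of_iIndepFun hε_meas hind hident hτ]
  set Lx : (ι → E) →ₗ[ℝ] (ℤ → E) := ∑ i, (impulse B (σ i)).comp (LinearMap.proj i) with hLx
  set Ly : (ι → E) →ₗ[ℝ] (ℤ → E) := ∑ j, (impulse B (τ j)).comp (LinearMap.proj j) with hLy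
  have hLxa : ∀ x, Lx x = ∑ i, impulse B (σ i) (x i) := fun x => by simp [hLx]
  have hLya : ∀ y, Ly y = ∑ j, impulse B (τ j) (y j) := fun y => by simp [hLy]
  have hLm : ∀ ρ : ι → ℤ, Measurable fun x : ι → E => ∑ i, impulse B (ρ i) (x i) := by
    intro ρ
    refine measurable_pi_lambda _ fun s => ?_
    simp only [Finset.sum_apply, impulse_apply]
    exact Finset.measurable_fun_sum _ fun i _ =>
      (B _).continuous.measurable.comp (measurable_pi_apply i)
  have hLxm : Measurable Lx := by
    have : (Lx : (ι → E) → (ℤ → E)) = fun x => ∑ i, impulse B (σ i) (x i) := funext hLxa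
    rw [this]
    exact hLm σ
  have hLym : Measurable Ly := by
    have : (Ly : (ι → E) → (ℤ → E)) = fun x => ∑ i, impulse B (τ i) (x i) := funext hLya
    rw [this]
    exact hLm τ
  set R : (ℤ → E) → ℤ → E := fun y s => linearFilter B y s with hR
  have hRm : Measurable R := measurable_pi_lambda _ fun s => measurable_linearFilter B s
  have hdecomp : ∀ᵐ ω ∂P, (fun s => Z s ω) = Lx (X ω).1 + Ly (X ω).2 + R (W ω) := by
    filter_upwards [ae_all_iff.2 hZ] with ω hω
    ext1 s
    rw [eq_sum_add_linearFilter_indicator_compl (y := fun l => ε l ω) (hω s) I, hLxa, hLya]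
    simp only [Pi.add_apply, Finset.sum_apply, impulse_apply, hR, hW, hX]
    congr 1
    rw [hI, Finset.sum_union, Finset.sum_image hσ.injOn, Finset.sum_image hτ.injOn]
    rw [Finset.disjoint_left]
    simp only [Finset.mem_image, Finset.mem_univ, true_and]
    rintro _ ⟨i, rfl⟩ ⟨j, hj⟩
    exact hστ i j hj.symm
  set z : ((ι → E) × (ι → E)) × (ℤ → E) → ℤ → E := fun p => Lx p.1.1 + Ly p.1.2 + R p.2 with hz
  have hzm : Measurable z :=
    ((hLxm.comp (measurable_fst.comp measurable_fst)).add
      (hLym.comp (measurable_snd.comp measurable_fst))).add (hRm.comp measurable_snd)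
  set f : ((ι → E) × (ι → E)) × (ℤ → E) → ℂ := fun p =>
    Complex.exp (Complex.I * ((φ (z p) + q (z p) (z p) + r : ℝ) : ℂ)) with hf
  have hfm : StronglyMeasurable f := by
    have h1 : Measurable fun p => φ (z p) := hφ.comp hzm
    have h2 : Measurable fun p => q (z p) (z p) := hq.comp (hzm.prodMk hzm)
    exact (measurable_cexp_I_mul ((h1.add h2).add_const r)).stronglyMeasurable
  have hf1 : ∀ p, ‖f p‖ ≤ 1 := fun p => (norm_cexp_I_mul _).le
  have hcond := condExp_comap_eq_integral_of_indepFun hXm' hWm hXW hfm hf1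
  have hcom : MeasurableSpace.comap W inferInstance =
      sigmaOn (fun j => MeasurableSpace.comap (ε j) inferInstance)
        (Set.range σ ∪ Set.range τ)ᶜ := by
    rw [← hIset]
    exact (sigmaOn_comap_eq_comap_indicator _).symm
  rw [hcom] at hcond
  have hcongr : P[fun ω => Complex.exp (Complex.I *
        ((φ (fun s => Z s ω) + q (fun s => Z s ω) (fun s => Z s ω) + r : ℝ) : ℂ)) |
        sigmaOn (fun j => MeasurableSpace.comap (ε j) inferInstance)
          (Set.range σ ∪ Set.range τ)ᶜ] =ᵐ[P] P[fun ω => f (X ω, W ω) |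
        sigmaOn (fun j => MeasurableSpace.comap (ε j) inferInstance)
          (Set.range σ ∪ Set.range τ)ᶜ] := by
    refine condExp_congr_ae (hdecomp.mono fun ω hω => ?_)
    simp only [hf, hz]
    rw [hω]
  have hβ : ∀ j i, ∃ K : E →L[ℝ] E, ∀ x y, inner ℝ y (K x) =
      q (impulse B (σ i) x) (impulse B (τ j) y) + q (impulse B (τ j) y) (impulse B (σ i) x) := by
    intro j i
    obtain ⟨K, hK⟩ := exists_inner_eq_bilinear
      (q.compl₁₂ (impulse B (σ i)) (impulse B (τ j)) +
        q.flip.compl₁₂ (impulse B (σ i)) (impulse B (τ j)))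
    exact ⟨K, fun x y => by rw [hK]; rfl⟩
  choose K hK using hβ
  have hKlow : ∀ j, ∃ i, ∃ u : E, ‖u‖ = 1 ∧ h ≤ ‖(K j i).adjoint u‖ := by
    intro j
    obtain ⟨i, x, y, hx, hy, hxy⟩ := hcross j
    rw [← hK] at hxy
    have hx0 : 0 < ‖x‖ := norm_pos_iff.2 hx
    have hy0 : 0 < ‖y‖ := norm_pos_iff.2 hy
    refine ⟨i, ‖y‖⁻¹ • y, by rw [norm_smul, norm_inv, norm_norm, inv_mul_cancel₀ hy0.ne'], ?_⟩
    rw [← ContinuousLinearMap.adjoint_inner_left] at hxy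
    have h1 := hxy.trans (abs_real_inner_le_norm _ _)
    rw [map_smul, norm_smul, norm_inv, norm_norm, inv_mul_eq_div, le_div_iff₀ hy0]
    refine le_of_mul_le_mul_right ?_ hx0
    linarith
  filter_upwards [hcond, hcongr] with ω h1 h2
  rw [h2, h1, hlawX]
  set ρ := R (W ω)
  -- The constant part of the phase is put into the function of `y`.
  have hexp : ∀ p : (ι → E) × (ι → E), f (p, W ω) = Complex.exp (Complex.I *
      (((φ (Lx p.1) + q (Lx p.1) (Lx p.1) + q (Lx p.1) ρ + q ρ (Lx p.1)) +
        (φ (Ly p.2) + q (Ly p.2) (Ly p.2) + q (Ly p.2) ρ + q ρ (Ly p.2) + (φ ρ + q ρ ρ + r)) +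
        ∑ j, inner ℝ (p.2 j) (∑ i, K j i (p.1 i)) : ℝ) : ℂ)) := by
    intro p
    have hcr : ∑ j, inner ℝ (p.2 j) (∑ i, K j i (p.1 i)) =
        q (Lx p.1) (Ly p.2) + q (Ly p.2) (Lx p.1) := by
      simp only [inner_sum, hK, hLxa, hLya, map_sum, LinearMap.sum_apply, Finset.sum_add_distrib]
      congr 1
      exact Finset.sum_comm
    rw [hcr]
    simp only [hf, hz]
    congr 3
    change φ (Lx p.1 + Ly p.2 + ρ) + q (Lx p.1 + Ly p.2 + ρ) (Lx p.1 + Ly p.2 + ρ) + r = _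
    simp only [map_add, LinearMap.add_apply]
    ring
  change ‖∫ p, f (p, W ω) ∂_‖ ≤ _
  simp only [hexp]
  refine norm_integral_bilinear_phase_le hc hc1 hν K hh hcard hKlow
    (a := fun x => φ (Lx x) + q (Lx x) (Lx x) + q (Lx x) ρ + q ρ (Lx x))
    (b := fun y => φ (Ly y) + q (Ly y) (Ly y) + q (Ly y) ρ + q ρ (Ly y) + (φ ρ + q ρ ρ + r))
    ?_ ?_
  · have m1 : Measurable fun x => φ (Lx x) := hφ.comp hLxm
    have m2 : Measurable fun x => q (Lx x) (Lx x) := hq.comp (hLxm.prodMk hLxm)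
    have m3 : Measurable fun x => q (Lx x) ρ := hq.comp (hLxm.prodMk measurable_const)
    have m4 : Measurable fun x => q ρ (Lx x) := hq.comp (measurable_const.prodMk hLxm)
    exact ((m1.add m2).add m3).add m4
  · have m1 : Measurable fun x => φ (Ly x) := hφ.comp hLym
    have m2 : Measurable fun x => q (Ly x) (Ly x) := hq.comp (hLym.prodMk hLym)
    have m3 : Measurable fun x => q (Ly x) ρ := hq.comp (hLym.prodMk measurable_const)
    have m4 : Measurable fun x => q ρ (Ly x) := hq.comp (measurable_const.prodMk hLym)
    exact (((m1.add m2).add m3).add m4).add_const _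

/-- With only `ε k` free, the phase is a constant plus `⟨x, L⟩ + q(x, x)`. Here `L` is the
deterministic `L₀` perturbed by at most `b`, so `‖L‖ ≥ 1` and the linear part has characteristic
function at most `1 - c`. Dropping `q(x, x)` costs at most `δ E‖ε‖²`. -/
lemma norm_condExp_exp_phase_le_of_linear_term (hε_meas : ∀ i, Measurable (ε i))
    (hind : iIndepFun ε P) (hident : ∀ i, IdentDistrib (ε i) (ε 1) P P) (hsq : MemLp (ε 1) 2 P)
    (hZ : ∀ i, ∀ᵐ ω ∂P, HasSum (fun j => B j (ε (i - j) ω)) (Z i ω))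
    {c : ℝ}
    (hν : ∀ u : E, ‖charFun (P.map (ε 1)) u‖ ≤ 1 - c * min 1 (‖u‖ ^ 2))
    {φ : (ℤ → E) →ₗ[ℝ] ℝ} {q : (ℤ → E) →ₗ[ℝ] (ℤ → E) →ₗ[ℝ] ℝ} (hφ : Measurable φ)
    (hq : Measurable fun p : (ℤ → E) × (ℤ → E) => q p.1 p.2) (r : ℝ) (k : ℤ) {δ b : ℝ}
    (hb0 : 0 ≤ b) (hQ : ∀ x, |q (impulse B k x) (impulse B k x)| ≤ δ * ‖x‖ ^ 2) {L₀ : E}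
    (hL₀ : ∀ x, φ (impulse B k x) = inner ℝ x L₀) (hb : 1 + b ≤ ‖L₀‖) :
    ∀ᵐ ω ∂P, (∀ x, |q (impulse B k x) (linearFilter B (({k} : Set ℤ)ᶜ.indicator fun l => ε l ω)) +
        q (linearFilter B (({k} : Set ℤ)ᶜ.indicator fun l => ε l ω)) (impulse B k x)| ≤ b * ‖x‖) →
      ‖(P[fun ω => Complex.exp (Complex.I *
        ((φ (fun s => Z s ω) + q (fun s => Z s ω) (fun s => Z s ω) + r : ℝ) : ℂ)) |
        sigmaOn (fun j => MeasurableSpace.comap (ε j) inferInstance) ({k} : Set ℤ)ᶜ]) ω‖ ≤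
      1 - c + δ * ∫ ω, ‖ε 1 ω‖ ^ 2 ∂P := by
  set ν := P.map (ε 1) with hνdef
  have : IsProbabilityMeasure ν := Measure.isProbabilityMeasure_map (hε_meas 1).aemeasurable
  set W : Ω → ℤ → E := fun ω => ({k} : Set ℤ)ᶜ.indicator fun l => ε l ω with hW
  have hXm : Measurable[sigmaOn (fun j => MeasurableSpace.comap (ε j) inferInstance) {k}]
      (ε k) := measurable_sigmaOn rfl
  have hWm : Measurable W :=
    (measurable_indicator_sigmaOn _).mono (sigmaOn_comap_le hε_meas _) le_rfl
  have hXW : IndepFun (ε k) W P :=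
    indepFun_of_measurable_sigmaOn hε_meas hind disjoint_compl_right hXm
      (measurable_indicator_sigmaOn _)
  have hlawX : P.map (ε k) = ν := (hident k).map_eq
  have hIm : Measurable (impulse B k) := measurable_pi_lambda _ fun s =>
    (B (s - k)).continuous.measurable
  set R : (ℤ → E) → ℤ → E := fun y => linearFilter B y with hR
  have hRm : Measurable R := measurable_pi_lambda _ fun s => measurable_linearFilter B s
  have hdecomp : ∀ᵐ ω ∂P, (fun s => Z s ω) = impulse B k (ε k ω) + R (W ω) := by
    filter_upwards [ae_all_iff.2 hZ] with ω hω
    ext1 s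
    have := eq_sum_add_linearFilter_indicator_compl (y := fun l => ε l ω) (hω s) {k}
    rw [Finset.sum_singleton, Finset.coe_singleton] at this
    exact this
  set z : E × (ℤ → E) → ℤ → E := fun p => impulse B k p.1 + R p.2 with hz
  have hzm : Measurable z := (hIm.comp measurable_fst).add (hRm.comp measurable_snd)
  set f : E × (ℤ → E) → ℂ := fun p =>
    Complex.exp (Complex.I * ((φ (z p) + q (z p) (z p) + r : ℝ) : ℂ)) with hf
  have hfm : StronglyMeasurable f := by
    have h1 : Measurable fun p => φ (z p) := hφ.comp hzm
    have h2 : Measurable fun p => q (z p) (z p) := hq.comp (hzm.prodMk hzm)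
    exact (measurable_cexp_I_mul ((h1.add h2).add_const r)).stronglyMeasurable
  have hf1 : ∀ p, ‖f p‖ ≤ 1 := fun p => (norm_cexp_I_mul _).le
  have hcond := condExp_comap_eq_integral_of_indepFun (hε_meas k) hWm hXW hfm hf1
  have hcom : MeasurableSpace.comap W inferInstance =
      sigmaOn (fun j => MeasurableSpace.comap (ε j) inferInstance) ({k} : Set ℤ)ᶜ :=
    (sigmaOn_comap_eq_comap_indicator _).symm
  rw [hcom] at hcond
  have hcongr : P[fun ω => Complex.exp (Complex.I *
        ((φ (fun s => Z s ω) + q (fun s => Z s ω) (fun s => Z s ω) + r : ℝ) : ℂ)) |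
        sigmaOn (fun j => MeasurableSpace.comap (ε j) inferInstance) ({k} : Set ℤ)ᶜ] =ᵐ[P]
      P[fun ω => f (ε k ω, W ω) |
        sigmaOn (fun j => MeasurableSpace.comap (ε j) inferInstance) ({k} : Set ℤ)ᶜ] := by
    refine condExp_congr_ae (hdecomp.mono fun ω hω => ?_)
    simp only [hf, hz]
    rw [hω]
  have hν2 : Integrable (fun x : E => ‖x‖ ^ 2) ν := by
    rw [hνdef, integrable_map_measure (by fun_prop) (hε_meas 1).aemeasurable]
    exact hsq.integrable_norm_pow two_ne_zero
  have hν2' : ∫ x, ‖x‖ ^ 2 ∂ν = ∫ ω, ‖ε 1 ω‖ ^ 2 ∂P :=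
    integral_map (hε_meas 1).aemeasurable (by fun_prop)
  filter_upwards [hcond, hcongr] with ω h1 h2 hgood
  rw [h2, h1, hlawX, ← hν2']
  set ρ := R (W ω)
  obtain ⟨L, hL⟩ := exists_inner_eq_linearMap
    (φ.comp (impulse B k) + (q.flip ρ).comp (impulse B k) + (q ρ).comp (impulse B k))
  have hLx : ∀ x, inner ℝ x L = φ (impulse B k x) + (q (impulse B k x) ρ + q ρ (impulse B k x)) :=
    fun x => by
      rw [hL]
      simp only [LinearMap.add_apply, LinearMap.comp_apply, LinearMap.flip_apply]
      ring
  have hLnorm : 1 ≤ ‖L‖ := by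
    -- The bound on the random cross terms is tested on the vector `L - L₀` itself.
    have h3 : ‖L - L₀‖ ≤ b := by
      rcases eq_or_ne (L - L₀) 0 with h0 | h0
      · rw [h0, norm_zero]
        exact hb0
      have h4 := hgood (L - L₀)
      have h5 : inner ℝ (L - L₀) (L - L₀) =
          q (impulse B k (L - L₀)) ρ + q ρ (impulse B k (L - L₀)) := by
        rw [inner_sub_right, hLx, hL₀]
        ring
      rw [← h5, real_inner_self_eq_norm_sq, abs_of_nonneg (by positivity), sq] at h4
      exact le_of_mul_le_mul_right h4 (norm_pos_iff.2 h0)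
    have h4 := norm_sub_norm_le L₀ L
    rw [norm_sub_rev] at h4
    linarith
  have hexp : ∀ x : E, f (x, W ω) = Complex.exp (Complex.I * ((φ ρ + q ρ ρ + r : ℝ) : ℂ)) *
      Complex.exp ((inner ℝ x L : ℝ) * Complex.I) *
      Complex.exp (Complex.I * ((q (impulse B k x) (impulse B k x) : ℝ) : ℂ)) := by
    intro x
    rw [← Complex.exp_add, ← Complex.exp_add]
    simp only [hf, hz]
    congr 1
    rw [mul_comm (_ : ℂ) Complex.I, ← mul_add, ← mul_add]
    congr 1
    change ((φ (impulse B k x + ρ) + q (impulse B k x + ρ) (impulse B k x + ρ) + r : ℝ) : ℂ) = _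
    rw [hLx, ← Complex.ofReal_add, ← Complex.ofReal_add]
    congr 1
    simp only [map_add, LinearMap.add_apply]
    ring
  set g : E → ℂ := fun x => Complex.exp (Complex.I * ((φ ρ + q ρ ρ + r : ℝ) : ℂ)) *
      Complex.exp ((inner ℝ x L : ℝ) * Complex.I) with hg
  have hgn : ∀ x, ‖g x‖ = 1 := fun x => by
    simp only [hg, norm_mul, norm_cexp_I_mul, Complex.norm_exp_ofReal_mul_I, one_mul]
  have hgi : Integrable g ν := by
    refine Integrable.of_bound (C := 1) (Continuous.aestronglyMeasurable (by fun_prop))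
      (Eventually.of_forall fun x => (hgn x).le)
  have hfi : Integrable (fun x => f (x, W ω)) ν := by
    refine Integrable.of_bound (C := 1) ?_ (Eventually.of_forall fun x => hf1 _)
    exact (hfm.comp_measurable (measurable_id.prodMk measurable_const)).aestronglyMeasurable
  have hgint : ‖∫ x, g x ∂ν‖ ≤ 1 - c := by
    rw [hg, integral_const_mul, norm_mul, norm_cexp_I_mul, one_mul]
    have := hν L
    rwa [min_eq_left (one_le_pow₀ hLnorm), mul_one, charFun_apply] at this
  have hdiff : ‖∫ x, f (x, W ω) ∂ν - ∫ x, g x ∂ν‖ ≤ δ * ∫ x, ‖x‖ ^ 2 ∂ν := by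
    rw [← integral_sub hfi hgi, ← integral_const_mul]
    refine norm_integral_le_of_norm_le (hν2.const_mul δ) (Eventually.of_forall fun x => ?_)
    have : f (x, W ω) - g x =
        g x * (Complex.exp (Complex.I * ((q (impulse B k x) (impulse B k x) : ℝ) : ℂ)) - 1) := by
      rw [hexp, hg]
      ring
    rw [this, norm_mul, hgn, one_mul]
    exact Real.norm_exp_I_mul_ofReal_sub_one_le.trans (hQ x)
  change ‖∫ x, f (x, W ω) ∂ν‖ ≤ _
  have := norm_sub_norm_le (∫ x, f (x, W ω) ∂ν) (∫ x, g x ∂ν)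
  linarith

end PhaseBounds


/-! ### The phase of a sum of blocks, and the size of its quadratic part. -/

section Phase

variable {d : ℕ} {w : ℕ → ℕ → ℝ} {ℓ : ℕ → ℕ} {n : ℕ}

/-- The part of the phase that is linear in the process. -/
def linPhase (ℓ : ℕ → ℕ) (n : ℕ) (T : Finset ℤ) (t₁ : EuclideanSpace ℝ (Fin d)) :
    (ℤ → EuclideanSpace ℝ (Fin d)) →ₗ[ℝ] ℝ :=
  ∑ s ∈ T, (Real.sqrt (ℓ n))⁻¹ • ((innerSL ℝ t₁).toLinearMap.comp (LinearMap.proj s))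

lemma linPhase_apply (T : Finset ℤ) (t₁ : EuclideanSpace ℝ (Fin d))
    (z : ℤ → EuclideanSpace ℝ (Fin d)) :
    linPhase ℓ n T t₁ z = ∑ s ∈ T, (Real.sqrt (ℓ n))⁻¹ * inner ℝ t₁ (z s) := by
  simp [linPhase]

lemma measurable_linPhase (T : Finset ℤ) (t₁ : EuclideanSpace ℝ (Fin d)) :
    Measurable (linPhase ℓ n T t₁) := by
  have : (linPhase ℓ n T t₁ : (ℤ → EuclideanSpace ℝ (Fin d)) → ℝ) =
      fun z => ∑ s ∈ T, (Real.sqrt (ℓ n))⁻¹ * inner ℝ t₁ (z s) := funext (linPhase_apply T t₁)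
  rw [this]
  refine Finset.measurable_fun_sum _ fun s _ => Measurable.const_mul ?_ _
  exact Measurable.inner measurable_const (measurable_pi_apply s)

lemma measurable_lagForm (T F : Finset ℤ) (t : UpperIdx d → ℝ) :
    Measurable fun p : (ℤ → EuclideanSpace ℝ (Fin d)) × (ℤ → EuclideanSpace ℝ (Fin d)) =>
      lagForm w ℓ n T F t p.1 p.2 := by
  have hc : ∀ (i : Fin d) (s : ℤ), Measurable fun z : ℤ → EuclideanSpace ℝ (Fin d) => z s i :=
    fun i s => (by fun_prop : Measurable fun v : EuclideanSpace ℝ (Fin d) => v i).comp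
      (measurable_pi_apply s)
  simp only [lagForm_apply]
  refine Measurable.const_mul (Finset.measurable_fun_sum _ fun pq _ => Measurable.const_mul
    (Finset.measurable_fun_sum _ fun s _ => Finset.measurable_fun_sum _ fun s' _ =>
      Measurable.const_mul ?_ _) _) _
  exact ((hc _ _).comp measurable_fst).mul ((hc _ _).comp measurable_snd)

lemma sum_Icc_blocks {L : ℤ} (hL : 0 ≤ L) (a : ℤ) (N : ℕ) (f : ℤ → ℝ) :
    ∑ j ∈ Finset.Icc a (a + N), ∑ i ∈ Finset.Icc ((j - 1) * L + 1) (j * L), f i =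
      ∑ i ∈ Finset.Icc ((a - 1) * L + 1) ((a + N) * L), f i := by
  induction N with
  | zero => simp
  | succ N ih =>
    have h1 : Finset.Icc a (a + (N + 1 : ℕ)) = insert (a + N + 1) (Finset.Icc a (a + N)) := by
      ext x
      simp only [Finset.mem_Icc, Finset.mem_insert]
      push_cast
      omega
    have h2 : Finset.Icc ((a - 1) * L + 1) ((a + (N + 1 : ℕ)) * L) =
        Finset.Icc ((a + N + 1 - 1) * L + 1) ((a + N + 1) * L) ∪
          Finset.Icc ((a - 1) * L + 1) ((a + N) * L) := by
      have e1 : (a + (N + 1 : ℕ)) * L = (a + N) * L + L := by push_cast; ring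
      have e2 : (a + N + 1) * L = (a + N) * L + L := by ring
      have e3 : (a + N + 1 - 1) * L = (a + N) * L := by ring
      have e4 : (a - 1) * L ≤ (a + N) * L := by
        apply mul_le_mul_of_nonneg_right _ hL
        omega
      rw [e1, e2, e3]
      ext x
      simp only [Finset.mem_Icc, Finset.mem_union]
      omega
    rw [h1, Finset.sum_insert (by simp), ih, h2, Finset.sum_union]
    rw [Finset.disjoint_left]
    intro x hx hx'
    simp only [Finset.mem_Icc] at hx hx'
    have e3 : (a + N + 1 - 1) * L = (a + N) * L := by ring
    omega

/-- Consecutive complete blocks merge into one interval of times, and the centerings are collected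
in the constant `r`. -/
lemma inner_sum_blockVar_eq {Ω : Type*} [MeasurableSpace Ω] (P : Measure Ω)
    (Z : ℤ → Ω → EuclideanSpace ℝ (Fin d)) {a : ℤ} {N : ℕ} {T F : Finset ℤ}
    (hT : T = Finset.Icc ((a - 1) * (ℓ n : ℤ) + 1) ((a + N) * (ℓ n : ℤ)))
    (hn : (a + N) * (ℓ n : ℤ) ≤ n)
    (hF : ∀ s ∈ T, ∀ k : ℕ, k ≤ ℓ n → s + (k : ℤ) ∈ F) (t : BlockSpace d) :
    ∃ r : ℝ, ∀ ω, inner ℝ t (∑ j ∈ Finset.Icc a (a + N), blockVar P Z w ℓ n j ω) =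
      linPhase ℓ n T (WithLp.toLp 2 fun p => t (Sum.inl p)) (fun s => Z s ω) +
      lagForm w ℓ n T F (fun pq => t (Sum.inr pq)) (fun s => Z s ω) (fun s => Z s ω) + r := by
  have hblock : ∀ f : ℤ → ℝ, ∑ j ∈ Finset.Icc a (a + N), ∑ i ∈ blockIdx ℓ n j, f i =
      ∑ i ∈ T, f i := by
    intro f
    rw [hT, ← sum_Icc_blocks (by positivity)]
    refine Finset.sum_congr rfl fun j hj => ?_
    rw [blockIdx, min_eq_left]
    refine le_trans ?_ hn
    exact mul_le_mul_of_nonneg_right (Finset.mem_Icc.1 hj).2 (by positivity)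
  refine ⟨-∑ pq : UpperIdx d, t (Sum.inr pq) * ((ℓ n : ℝ)⁻¹ *
    ∑ s ∈ T, ∫ ω', lagProduct Z w ℓ n s pq ω' ∂P), fun ω => ?_⟩
  rw [lagForm_self_eq_sum_lagProduct hF, linPhase_apply, PiLp.inner_apply, Fintype.sum_sum_type]
  have e1 : ∀ p : Fin d, (∑ j ∈ Finset.Icc a (a + N), blockVar P Z w ℓ n j ω) (Sum.inl p) =
      (Real.sqrt (ℓ n))⁻¹ * ∑ s ∈ T, Z s ω p := by
    intro p
    rw [← hblock, Finset.mul_sum]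
    simp [blockVar, WithLp.ofLp_sum, Finset.sum_apply]
  have e2 : ∀ pq : UpperIdx d,
      (∑ j ∈ Finset.Icc a (a + N), blockVar P Z w ℓ n j ω) (Sum.inr pq) =
      (ℓ n : ℝ)⁻¹ * ∑ s ∈ T, centeredLagProduct P Z w ℓ n s pq ω := by
    intro p
    rw [← hblock, Finset.mul_sum]
    simp [blockVar, WithLp.ofLp_sum, Finset.sum_apply]
  simp only [e1, e2]
  rw [add_assoc]
  congr 1
  · rw [← Finset.mul_sum]
    simp only [PiLp.inner_apply, RCLike.inner_apply, conj_trivial]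
    rw [Finset.sum_comm, Finset.mul_sum]
    refine Finset.sum_congr rfl fun p _ => ?_
    rw [← Finset.sum_mul]
    ring
  · rw [← sub_eq_add_neg, ← Finset.sum_sub_distrib]
    refine Finset.sum_congr rfl fun pq _ => ?_
    simp only [centeredLagProduct, Finset.sum_sub_distrib, RCLike.inner_apply, conj_trivial]
    ring

lemma norm_blockSpace_le (t : BlockSpace d) :
    ‖t‖ ≤ ‖(WithLp.toLp 2 fun p => t (Sum.inl p) : EuclideanSpace ℝ (Fin d))‖ +
      ∑ pq : UpperIdx d, |t (Sum.inr pq)| := by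
  have h1 : ‖t‖ ^ 2 = ‖(WithLp.toLp 2 fun p => t (Sum.inl p) : EuclideanSpace ℝ (Fin d))‖ ^ 2 +
      ∑ pq : UpperIdx d, |t (Sum.inr pq)| ^ 2 := by
    rw [EuclideanSpace.norm_sq_eq, EuclideanSpace.norm_sq_eq, Fintype.sum_sum_type]
    simp
  have h2 : ∑ pq : UpperIdx d, |t (Sum.inr pq)| ^ 2 ≤ (∑ pq : UpperIdx d, |t (Sum.inr pq)|) ^ 2 :=
    Finset.sum_sq_le_sq_sum_of_nonneg fun _ _ => abs_nonneg _
  have h3 : 0 ≤ ∑ pq : UpperIdx d, |t (Sum.inr pq)| := Finset.sum_nonneg fun _ _ => abs_nonneg _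
  refine le_of_sq_le_sq ?_ (by positivity)
  nlinarith [norm_nonneg (WithLp.toLp 2 fun p => t (Sum.inl p) : EuclideanSpace ℝ (Fin d))]

variable {B : ℤ → EuclideanSpace ℝ (Fin d) →L[ℝ] EuclideanSpace ℝ (Fin d)}

lemma hasSum_apply_coord (hB : Summable fun j => ‖B j‖) (x : EuclideanSpace ℝ (Fin d))
    (p : Fin d) : HasSum (fun u => B u x p) ((∑' u, B u) x p) := by
  have h1 : HasSum B (∑' u, B u) := hB.of_norm.hasSum
  have h2 := h1.mapL (ContinuousLinearMap.apply ℝ (EuclideanSpace ℝ (Fin d)) x)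
  exact h2.mapL (EuclideanSpace.proj p)

lemma abs_lagForm_impulse_sub_le (hB : Summable fun j => ‖B j‖) {M : ℝ} (hM0 : 0 ≤ M)
    (hM : ∀ k : ℕ, 1 ≤ k → k ≤ ℓ n → |w k n| ≤ M) {lo hi i j : ℤ} (hi1 : lo + ℓ n ≤ i)
    (hi2 : i + ℓ n ≤ hi) (hj1 : lo + ℓ n ≤ j) (hj2 : j + ℓ n ≤ hi) (hn : hi ≤ n)
    {F : Finset ℤ} (hF : ∀ s ∈ Finset.Icc lo hi, ∀ k : ℕ, k ≤ ℓ n → s + (k : ℤ) ∈ F)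
    (t : UpperIdx d → ℝ) (x y : EuclideanSpace ℝ (Fin d)) :
    |lagForm w ℓ n (Finset.Icc lo hi) F t (impulse B i x) (impulse B j y) -
      (ℓ n : ℝ)⁻¹ * ∑ pq, t pq * ((∑' u, B u) x pq.1.1 * (∑' u, B u) y pq.1.2)| ≤
      (ℓ n : ℝ)⁻¹ * ((∑ pq, |t pq|) * ((∑' uv : ℤ × ℤ,
        lagDefect w ℓ M (i - j) n uv * (‖B uv.1‖ * ‖B uv.2‖)) * (‖x‖ * ‖y‖))) := by
  rw [lagForm_apply, ← mul_sub, abs_mul, abs_of_nonneg (by positivity : (0 : ℝ) ≤ (ℓ n : ℝ)⁻¹),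
    ← Finset.sum_sub_distrib, Finset.sum_mul]
  gcongr
  refine (Finset.abs_sum_le_sum_abs _ _).trans (Finset.sum_le_sum fun pq _ => ?_)
  rw [← mul_sub, abs_mul]
  gcongr
  have hb : ∀ (x : EuclideanSpace ℝ (Fin d)) p u, |B u x p| ≤ ‖B u‖ * ‖x‖ := fun x p u =>
    (by simpa using PiLp.norm_apply_le (B u x) p : |B u x p| ≤ ‖B u x‖).trans ((B u).le_opNorm x)
  have := abs_sum_lagWeight_sub_tsum_mul_tsum_le (w := w) hM0 hM hi1 hi2 hj1 hj2 hn hF hB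
    (hb x pq.1.1) (hb y pq.1.2)
  rw [(hasSum_apply_coord hB x pq.1.1).tsum_eq, (hasSum_apply_coord hB y pq.1.2).tsum_eq] at this
  exact this

/-- Some coordinate satisfies `|t pq| ≥ τ / N`. The impulses `U e_p` and `U e_q`, which `A_∞` maps
to unit vectors, isolate it up to the lag defect, and the defect takes at most half of the size. -/
lemma exists_lagForm_impulse_ge (hB : Summable fun j => ‖B j‖)
    {U : EuclideanSpace ℝ (Fin d) →L[ℝ] EuclideanSpace ℝ (Fin d)}
    (hU : ∀ x, (∑' u, B u) (U x) = x) {a : ℝ} (ha : ‖U‖ ≤ a) {M : ℝ} (hM0 : 0 ≤ M)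
    (hM : ∀ k : ℕ, 1 ≤ k → k ≤ ℓ n → |w k n| ≤ M) {lo hi i j : ℤ} (hi1 : lo + ℓ n ≤ i)
    (hi2 : i + ℓ n ≤ hi) (hj1 : lo + ℓ n ≤ j) (hj2 : j + ℓ n ≤ hi) (hn : hi ≤ n)
    {F : Finset ℤ} (hF : ∀ s ∈ Finset.Icc lo hi, ∀ k : ℕ, k ≤ ℓ n → s + (k : ℤ) ∈ F)
    (t : UpperIdx d → ℝ) (ht : 0 < ∑ pq, |t pq|)
    (hdef : 2 * (Fintype.card (UpperIdx d) + 1) * a ^ 2 *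
      (∑' uv : ℤ × ℤ, lagDefect w ℓ M (i - j) n uv * (‖B uv.1‖ * ‖B uv.2‖) +
       ∑' uv : ℤ × ℤ, lagDefect w ℓ M (j - i) n uv * (‖B uv.1‖ * ‖B uv.2‖)) ≤ 1) :
    ∃ x y : EuclideanSpace ℝ (Fin d), x ≠ 0 ∧ y ≠ 0 ∧ ‖x‖ ≤ a ∧ ‖y‖ ≤ a ∧
      (ℓ n : ℝ)⁻¹ * ((∑ pq, |t pq|) / (2 * (Fintype.card (UpperIdx d) + 1))) ≤
      |lagForm w ℓ n (Finset.Icc lo hi) F t (impulse B i x) (impulse B j y) +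
        lagForm w ℓ n (Finset.Icc lo hi) F t (impulse B j y) (impulse B i x)| := by
  set N : ℝ := Fintype.card (UpperIdx d) + 1 with hN
  have hN0 : 0 < N := by positivity
  set τ := ∑ pq, |t pq|
  obtain ⟨pq, hpq⟩ : ∃ pq : UpperIdx d, τ / N ≤ |t pq| := by
    by_contra! hcon
    have h1 : τ ≤ ∑ _pq : UpperIdx d, τ / N := Finset.sum_le_sum fun pq _ => (hcon pq).le
    rw [Finset.sum_const, Finset.card_univ, nsmul_eq_mul, mul_div_assoc', le_div_iff₀ hN0] at h1
    nlinarith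
  have hne : ∀ p : Fin d, U (EuclideanSpace.single p 1) ≠ 0 := by
    intro p h0
    have h1 := hU (EuclideanSpace.single p 1)
    rw [h0, map_zero] at h1
    have := congrArg (fun v : EuclideanSpace ℝ (Fin d) => v p) h1
    simp at this
  have hnorm : ∀ p : Fin d, ‖U (EuclideanSpace.single p 1)‖ ≤ a := by
    intro p
    refine (U.le_opNorm _).trans ?_
    simpa using ha
  set x := U (EuclideanSpace.single pq.1.1 1) with hx
  set y := U (EuclideanSpace.single pq.1.2 1) with hy
  refine ⟨x, y, hne _, hne _, hnorm _, hnorm _, ?_⟩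
  have h1 := abs_lagForm_impulse_sub_le (w := w) hB hM0 hM hi1 hi2 hj1 hj2 hn hF t x y
  have h2 := abs_lagForm_impulse_sub_le (w := w) hB hM0 hM hj1 hj2 hi1 hi2 hn hF t y x
  have hl0 : (0 : ℝ) ≤ (ℓ n : ℝ)⁻¹ := by positivity
  rw [hx, hy, hU, hU, ← hx, ← hy] at h1 h2
  have s1 : ∑ pq' : UpperIdx d, t pq' * ((EuclideanSpace.single pq.1.1 (1 : ℝ)) pq'.1.1 *
      (EuclideanSpace.single pq.1.2 (1 : ℝ)) pq'.1.2) = t pq := by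
    rw [Finset.sum_eq_single pq]
    · simp
    · intro b _ hb
      by_cases h3 : b.1.1 = pq.1.1
      · have h4 : b.1.2 ≠ pq.1.2 := fun h4 => hb (Subtype.ext (Prod.ext h3 h4))
        simp [h4]
      · simp [h3]
    · simp
  -- Exchanging the impulses gives `t pq` again if `p = q`, and `0` if `p < q`, because `(q, p)` is
  -- then not an index. So `θ ≥ 0`, and the two orders cannot cancel.
  have s2 : ∃ θ : ℝ, 0 ≤ θ ∧
      ∑ pq' : UpperIdx d, t pq' * ((EuclideanSpace.single pq.1.2 (1 : ℝ)) pq'.1.1 *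
      (EuclideanSpace.single pq.1.1 (1 : ℝ)) pq'.1.2) = θ * t pq := by
    by_cases heq : pq.1.1 = pq.1.2
    · refine ⟨1, zero_le_one, ?_⟩
      rw [one_mul, ← s1, heq]
    · refine ⟨0, le_rfl, ?_⟩
      rw [zero_mul]
      refine Finset.sum_eq_zero fun b _ => ?_
      by_cases h3 : b.1.1 = pq.1.2
      · have h4 : b.1.2 ≠ pq.1.1 := fun h4 => heq (le_antisymm pq.2 (by
          rw [← h3, ← h4]
          exact b.2))
        simp [h4]
      · simp [h3]
  obtain ⟨θ, hθ, s2⟩ := s2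
  rw [s1] at h1
  rw [s2] at h2
  set D1 := ∑' uv : ℤ × ℤ, lagDefect w ℓ M (i - j) n uv * (‖B uv.1‖ * ‖B uv.2‖)
  set D2 := ∑' uv : ℤ × ℤ, lagDefect w ℓ M (j - i) n uv * (‖B uv.1‖ * ‖B uv.2‖)
  set q1 := lagForm w ℓ n (Finset.Icc lo hi) F t (impulse B i x) (impulse B j y)
  set q2 := lagForm w ℓ n (Finset.Icc lo hi) F t (impulse B j y) (impulse B i x)
  have hD : ∀ e, 0 ≤ ∑' uv : ℤ × ℤ, lagDefect w ℓ M e n uv * (‖B uv.1‖ * ‖B uv.2‖) := fun e =>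
    tsum_nonneg fun uv => mul_nonneg (by
      unfold lagDefect
      split_ifs <;> positivity) (by positivity)
  have hD1 : 0 ≤ D1 := hD _
  have hD2 : 0 ≤ D2 := hD _
  have ha0 : 0 ≤ a := (norm_nonneg _).trans ha
  have hxy : ‖x‖ * ‖y‖ ≤ a ^ 2 := by
    rw [sq]
    exact mul_le_mul (hnorm _) (hnorm _) (norm_nonneg _) ha0
  have hdef' : a ^ 2 * (D1 + D2) ≤ 1 / (2 * N) := by
    rw [le_div_iff₀ (by positivity)]
    linarith
  have h3 : |q1 + q2 - (ℓ n : ℝ)⁻¹ * ((1 + θ) * t pq)| ≤ (ℓ n : ℝ)⁻¹ * (τ * (1 / (2 * N))) := by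
    have e : q1 + q2 - (ℓ n : ℝ)⁻¹ * ((1 + θ) * t pq) =
        (q1 - (ℓ n : ℝ)⁻¹ * t pq) + (q2 - (ℓ n : ℝ)⁻¹ * (θ * t pq)) := by ring
    rw [e]
    refine (abs_add_le _ _).trans ((add_le_add h1 h2).trans ?_)
    rw [← mul_add, ← mul_add, mul_comm ‖y‖, ← add_mul]
    gcongr
    calc (D1 + D2) * (‖x‖ * ‖y‖) ≤ (D1 + D2) * a ^ 2 := by gcongr
      _ ≤ _ := by linarith
  have h4 : (ℓ n : ℝ)⁻¹ * (τ / N) ≤ |(ℓ n : ℝ)⁻¹ * ((1 + θ) * t pq)| := by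
    rw [abs_mul, abs_mul, abs_of_nonneg hl0, abs_of_nonneg (by linarith : 0 ≤ 1 + θ)]
    gcongr
    nlinarith [abs_nonneg (t pq)]
  have h5 := abs_sub_abs_le_abs_sub ((ℓ n : ℝ)⁻¹ * ((1 + θ) * t pq)) (q1 + q2)
  rw [abs_sub_comm] at h5
  have h6 : (ℓ n : ℝ)⁻¹ * (τ / N) = (ℓ n : ℝ)⁻¹ * (τ / (2 * N)) + (ℓ n : ℝ)⁻¹ * (τ * (1 / (2 * N))) := by
    field_simp
    ring
  linarith

end Phase


/-! ### The random linear coefficient produced by the frozen innovations. -/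

section Remainder

variable {Ω : Type*} [MeasurableSpace Ω] {P : Measure Ω} [IsProbabilityMeasure P]

lemma half_le_measureReal_le {g : Ω → ℝ} (hg : Measurable g) {C D : ℝ} (hD : 0 < D)
    (hCD : 2 * C ≤ D) (h : ∫⁻ ω, ENNReal.ofReal (g ω) ∂P ≤ ENNReal.ofReal C) :
    1 / 2 ≤ P.real {ω | g ω ≤ D} := by
  have hm : MeasurableSet {ω | g ω ≤ D} := measurableSet_le hg measurable_const
  have h1 : ENNReal.ofReal D * P {ω | g ω ≤ D}ᶜ ≤ ENNReal.ofReal (D / 2) := by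
    calc ENNReal.ofReal D * P {ω | g ω ≤ D}ᶜ
        ≤ ENNReal.ofReal D * P {ω | ENNReal.ofReal D ≤ ENNReal.ofReal (g ω)} := by
          gcongr
          intro ω hω
          simp only [Set.mem_compl_iff, Set.mem_ofPred_eq, not_le] at hω ⊢
          exact ENNReal.ofReal_le_ofReal hω.le
      _ ≤ ∫⁻ ω, ENNReal.ofReal (g ω) ∂P := mul_meas_ge_le_lintegral hg.ennreal_ofReal _
      _ ≤ _ := h.trans (ENNReal.ofReal_le_ofReal (by linarith))
  have h2 := ENNReal.toReal_mono ENNReal.ofReal_ne_top h1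
  rw [ENNReal.toReal_mul, ENNReal.toReal_ofReal hD.le, ENNReal.toReal_ofReal (by linarith)] at h2
  change D * P.real _ ≤ _ at h2
  rw [probReal_compl_eq_one_sub hm] at h2
  by_contra! hlt
  nlinarith

variable {w : ℕ → ℕ → ℝ} {ℓ : ℕ → ℕ} {n : ℕ}

lemma lagWeight_eq_zero {T : Finset ℤ} {s s' : ℤ} (h : s' ∉ Finset.Icc (s - ℓ n) (s + ℓ n)) :
    lagWeight w ℓ n T s s' = 0 := by
  rw [Finset.mem_Icc] at h
  rw [lagWeight, upperLagWeight, upperLagWeight, if_neg (by omega), if_neg (by omega),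
    if_neg (by omega)]
  simp

lemma sum_sq_lagWeight_le {M : ℝ} (hM0 : 0 ≤ M) (hM : ∀ k : ℕ, 1 ≤ k → k ≤ ℓ n → |w k n| ≤ M)
    (T F : Finset ℤ) (s : ℤ) :
    ∑ s' ∈ F, lagWeight w ℓ n T s s' ^ 2 ≤ (2 * ℓ n + 1) * (1 + 2 * M) ^ 2 := by
  classical
  calc ∑ s' ∈ F, lagWeight w ℓ n T s s' ^ 2
      = ∑ s' ∈ F with s' ∈ Finset.Icc (s - ℓ n) (s + ℓ n), lagWeight w ℓ n T s s' ^ 2 := by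
        rw [Finset.sum_filter]
        refine Finset.sum_congr rfl fun s' _ => ?_
        split_ifs with h
        · rfl
        · rw [lagWeight_eq_zero h]
          simp
    _ ≤ ∑ s' ∈ F with s' ∈ Finset.Icc (s - ℓ n) (s + ℓ n), (1 + 2 * M) ^ 2 := by
        refine Finset.sum_le_sum fun s' _ => ?_
        have := abs_lagWeight_le (w := w) hM0 hM T s s'
        rw [← sq_abs]
        gcongr
    _ ≤ _ := by
        rw [Finset.sum_const, nsmul_eq_mul]
        gcongr
        have h1 : (F.filter fun s' => s' ∈ Finset.Icc (s - (ℓ n : ℤ)) (s + ℓ n)).card ≤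
            (Finset.Icc (s - (ℓ n : ℤ)) (s + ℓ n)).card :=
          Finset.card_le_card fun x hx => (Finset.mem_filter.1 hx).2
        rw [Int.card_Icc] at h1
        have h2 : (s + (ℓ n : ℤ) + 1 - (s - ℓ n)).toNat = 2 * ℓ n + 1 := by omega
        rw [h2] at h1
        exact_mod_cast h1

lemma sum_norm_shift_le_tsum {V : Type*} [NormedAddCommGroup V] {B : ℤ → V}
    (hB : Summable fun j => ‖B j‖) (F : Finset ℤ) (k : ℤ) :
    ∑ s ∈ F, ‖B (s - k)‖ ≤ ∑' j, ‖B j‖ := by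
  rw [← (Equiv.subRight k).tsum_eq fun j => ‖B j‖]
  exact ((Equiv.subRight k).summable_iff.2 hB).sum_le_tsum _ fun _ _ => norm_nonneg _

variable {E : Type*} [NormedAddCommGroup E] [InnerProductSpace ℝ E] [FiniteDimensional ℝ E]
  [MeasurableSpace E] [BorelSpace E] {ε : ℤ → Ω → E} {B : ℤ → E →L[ℝ] E} {Z : ℤ → Ω → E}

/-- The frozen remainder is `Z` minus the response to `ε k`. Each row of weights has at most `2ℓ +
1` nonzero entries, so orthogonality bounds the part from `Z` by `O(√ℓ)`; the response contributes
`O(1)`. -/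
lemma lintegral_enorm_sum_lagWeight_remainder_le (hε_meas : ∀ i, Measurable (ε i))
    (hind : iIndepFun ε P) (hident : ∀ i, IdentDistrib (ε i) (ε 1) P P) (hsq : MemLp (ε 1) 2 P)
    (hmean : ∫ ω, ε 1 ω ∂P = 0) (hB : Summable fun j => ‖B j‖)
    (hZ : ∀ i, ∀ᵐ ω ∂P, HasSum (fun j => B j (ε (i - j) ω)) (Z i ω))
    {M : ℝ} (hM0 : 0 ≤ M) (hM : ∀ k : ℕ, 1 ≤ k → k ≤ ℓ n → |w k n| ≤ M) (hn : 1 ≤ ℓ n)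
    (T F : Finset ℤ) (k s : ℤ) :
    ∫⁻ ω, ‖∑ s' ∈ F, lagWeight w ℓ n T s s' •
        linearFilter B (({k} : Set ℤ)ᶜ.indicator fun l => ε l ω) s'‖ₑ ∂P ≤
      ENNReal.ofReal (3 * (∑' j, ‖B j‖) * (1 + 2 * M) * √(∫ ω, ‖ε 1 ω‖ ^ 2 ∂P) * √(ℓ n)) := by
  set a := ∑' j, ‖B j‖ with ha
  have ha0 : 0 ≤ a := tsum_nonneg fun _ => norm_nonneg _
  set V := ∫ ω, ‖ε 1 ω‖ ^ 2 ∂P with hV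
  set c : ℤ → ℝ := fun s' => lagWeight w ℓ n T s s' with hc
  have hW0 : 0 ≤ 1 + 2 * M := by positivity
  have hR : ∀ᵐ ω ∂P, ‖∑ s' ∈ F, c s' •
      linearFilter B (({k} : Set ℤ)ᶜ.indicator fun l => ε l ω) s'‖ₑ ≤
      ‖∑ s' ∈ F, c s' • Z s' ω‖ₑ + ENNReal.ofReal ((1 + 2 * M) * a) * ‖ε k ω‖ₑ := by
    filter_upwards [ae_all_iff.2 hZ] with ω hω
    have e1 : ∀ s', linearFilter B (({k} : Set ℤ)ᶜ.indicator fun l => ε l ω) s' =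
        Z s' ω - B (s' - k) (ε k ω) := by
      intro s'
      have := eq_sum_add_linearFilter_indicator_compl (y := fun l => ε l ω) (hω s') {k}
      rw [Finset.sum_singleton, Finset.coe_singleton] at this
      rw [this]
      abel
    simp only [e1, smul_sub, Finset.sum_sub_distrib]
    refine enorm_sub_le.trans ?_
    gcongr
    rw [← ofReal_norm (ε k ω), ← ENNReal.ofReal_mul (by positivity), ← ofReal_norm]
    refine ENNReal.ofReal_le_ofReal ?_
    calc ‖∑ s' ∈ F, c s' • B (s' - k) (ε k ω)‖
        ≤ ∑ s' ∈ F, (1 + 2 * M) * (‖B (s' - k)‖ * ‖ε k ω‖) := by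
          refine norm_sum_le_of_le _ fun s' _ => ?_
          rw [norm_smul]
          gcongr
          · exact abs_lagWeight_le (w := w) hM0 hM T s s'
          · exact (B _).le_opNorm _
      _ = (1 + 2 * M) * (∑ s' ∈ F, ‖B (s' - k)‖) * ‖ε k ω‖ := by
          rw [← Finset.mul_sum, ← Finset.sum_mul, mul_assoc]
      _ ≤ _ := by
          gcongr
          exact sum_norm_shift_le_tsum hB F k
  have hεk : ∫⁻ ω, ‖ε k ω‖ₑ ∂P ≤ ENNReal.ofReal √V := by
    have h1 := ((hident k).comp (u := fun x : E => ‖x‖ₑ) (by fun_prop)).lintegral_eq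
    simp only [Function.comp_apply] at h1
    rw [h1, ← ofReal_integral_norm_eq_lintegral_enorm (hsq.integrable one_le_two)]
    exact ENNReal.ofReal_le_ofReal (Real.le_sqrt_of_sq_le (sq_integral_le_integral_sq hsq.norm))
  have hZb := lintegral_enorm_sum_smul_linearProcess_le hε_meas hind hident hsq hmean hB hZ F c
  have hV0 : 0 ≤ V := integral_nonneg fun _ => by positivity
  have hl1 : (1 : ℝ) ≤ ℓ n := by exact_mod_cast hn
  have hsl1 : 1 ≤ √(ℓ n : ℝ) := Real.one_le_sqrt.2 hl1
  have hsqrt : √(V * ∑ s' ∈ F, c s' ^ 2) ≤ 2 * (1 + 2 * M) * √V * √(ℓ n) := by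
    have e : 2 * (1 + 2 * M) * √V * √(ℓ n) = √(V * (4 * ℓ n * (1 + 2 * M) ^ 2)) := by
      rw [Real.sqrt_mul hV0, Real.sqrt_mul (by positivity), Real.sqrt_mul (by norm_num),
        Real.sqrt_sq hW0, show (4 : ℝ) = 2 ^ 2 by norm_num, Real.sqrt_sq (by norm_num)]
      ring
    rw [e]
    refine Real.sqrt_le_sqrt ?_
    gcongr
    refine (sum_sq_lagWeight_le hM0 hM T F s).trans ?_
    gcongr
    linarith
  calc _ ≤ ∫⁻ ω, (‖∑ s' ∈ F, c s' • Z s' ω‖ₑ +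
        ENNReal.ofReal ((1 + 2 * M) * a) * ‖ε k ω‖ₑ) ∂P := lintegral_mono_ae hR
    _ = ∫⁻ ω, ‖∑ s' ∈ F, c s' • Z s' ω‖ₑ ∂P +
        ENNReal.ofReal ((1 + 2 * M) * a) * ∫⁻ ω, ‖ε k ω‖ₑ ∂P := by
        rw [lintegral_add_right _ ((hε_meas k).enorm.const_mul _),
          lintegral_const_mul _ (hε_meas k).enorm]
    _ ≤ ENNReal.ofReal (a * √(V * ∑ s' ∈ F, c s' ^ 2)) +
        ENNReal.ofReal ((1 + 2 * M) * a) * ENNReal.ofReal √V := by gcongr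
    _ = ENNReal.ofReal (a * √(V * ∑ s' ∈ F, c s' ^ 2) + (1 + 2 * M) * a * √V) := by
        rw [← ENNReal.ofReal_mul (by positivity), ← ENNReal.ofReal_add (by positivity)
          (by positivity)]
    _ ≤ _ := by
        refine ENNReal.ofReal_le_ofReal ?_
        have h1 : a * √(V * ∑ s' ∈ F, c s' ^ 2) ≤ a * (2 * (1 + 2 * M) * √V * √(ℓ n)) := by gcongr
        have h2 : (1 + 2 * M) * a * √V * 1 ≤ (1 + 2 * M) * a * √V * √(ℓ n) := by gcongr
        linarith

/-- The size of the random coefficient with which the innovation at time `k` enters the lag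
products. -/
def remainderSize (w : ℕ → ℕ → ℝ) (ℓ : ℕ → ℕ) (n : ℕ) (T F : Finset ℤ) (B : ℤ → E →L[ℝ] E)
    (ε : ℤ → Ω → E) (k : ℤ) (ω : Ω) : ℝ :=
  ∑ s ∈ F, ‖B (s - k)‖ * ‖∑ s' ∈ F, lagWeight w ℓ n T s s' •
    linearFilter B (({k} : Set ℤ)ᶜ.indicator fun l => ε l ω) s'‖

lemma measurable_remainderSize (hε_meas : ∀ i, Measurable (ε i)) (T F : Finset ℤ) (k : ℤ) :
    Measurable (remainderSize w ℓ n T F B ε k) := by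
  have hW : Measurable fun ω => ({k} : Set ℤ)ᶜ.indicator fun l => ε l ω :=
    (measurable_indicator_sigmaOn _).mono (sigmaOn_comap_le hε_meas _) le_rfl
  refine Finset.measurable_fun_sum _ fun s _ => Measurable.const_mul (Measurable.norm ?_) _
  exact Finset.measurable_fun_sum _ fun s' _ =>
    ((measurable_linearFilter B s').comp hW).const_smul _

/-- Markov's inequality at twice the mean bound turns the factor `3` into `6`; the summand `+ 1`
keeps the threshold positive. -/
lemma half_le_measureReal_remainderSize_le (hε_meas : ∀ i, Measurable (ε i))
    (hind : iIndepFun ε P) (hident : ∀ i, IdentDistrib (ε i) (ε 1) P P) (hsq : MemLp (ε 1) 2 P)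
    (hmean : ∫ ω, ε 1 ω ∂P = 0) (hB : Summable fun j => ‖B j‖)
    (hZ : ∀ i, ∀ᵐ ω ∂P, HasSum (fun j => B j (ε (i - j) ω)) (Z i ω))
    {M : ℝ} (hM0 : 0 ≤ M) (hM : ∀ k : ℕ, 1 ≤ k → k ≤ ℓ n → |w k n| ≤ M) (hn : 1 ≤ ℓ n)
    (T F : Finset ℤ) (k : ℤ) :
    1 / 2 ≤ P.real {ω | remainderSize w ℓ n T F B ε k ω ≤
      (6 * (∑' j, ‖B j‖) ^ 2 * (1 + 2 * M) * √(∫ ω, ‖ε 1 ω‖ ^ 2 ∂P) + 1) * √(ℓ n)} := by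
  set a := ∑' j, ‖B j‖ with ha
  have ha0 : 0 ≤ a := tsum_nonneg fun _ => norm_nonneg _
  set V := ∫ ω, ‖ε 1 ω‖ ^ 2 ∂P with hV
  have hl1 : (1 : ℝ) ≤ ℓ n := by exact_mod_cast hn
  have hsl1 : 1 ≤ √(ℓ n : ℝ) := Real.one_le_sqrt.2 hl1
  have hW : Measurable fun ω => ({k} : Set ℤ)ᶜ.indicator fun l => ε l ω :=
    (measurable_indicator_sigmaOn _).mono (sigmaOn_comap_le hε_meas _) le_rfl
  have hRm : ∀ s, Measurable fun ω => ∑ s' ∈ F, lagWeight w ℓ n T s s' •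
      linearFilter B (({k} : Set ℤ)ᶜ.indicator fun l => ε l ω) s' := fun s =>
    Finset.measurable_fun_sum _ fun s' _ => ((measurable_linearFilter B s').comp hW).const_smul _
  refine half_le_measureReal_le (measurable_remainderSize hε_meas T F k)
    (C := a * (3 * a * (1 + 2 * M) * √V * √(ℓ n))) (by positivity) ?_ ?_
  · have : 0 ≤ √(ℓ n : ℝ) := by positivity
    nlinarith
  have e : ∀ ω, ENNReal.ofReal (remainderSize w ℓ n T F B ε k ω) =
      ∑ s ∈ F, ENNReal.ofReal ‖B (s - k)‖ * ‖∑ s' ∈ F, lagWeight w ℓ n T s s' •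
        linearFilter B (({k} : Set ℤ)ᶜ.indicator fun l => ε l ω) s'‖ₑ := by
    intro ω
    rw [remainderSize, ENNReal.ofReal_sum_of_nonneg fun s _ => by positivity]
    refine Finset.sum_congr rfl fun s _ => ?_
    rw [ENNReal.ofReal_mul (norm_nonneg _), ofReal_norm (∑ s' ∈ F, _)]
  simp only [e]
  rw [lintegral_finsetSum _ fun s _ => (hRm s).enorm.const_mul _]
  calc _ ≤ ∑ s ∈ F, ENNReal.ofReal ‖B (s - k)‖ *
        ENNReal.ofReal (3 * a * (1 + 2 * M) * √V * √(ℓ n)) := by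
        refine Finset.sum_le_sum fun s _ => ?_
        rw [lintegral_const_mul _ (hRm s).enorm]
        gcongr
        exact lintegral_enorm_sum_lagWeight_remainder_le hε_meas hind hident hsq hmean hB hZ hM0
          hM hn T F k s
    _ = ENNReal.ofReal ((∑ s ∈ F, ‖B (s - k)‖) * (3 * a * (1 + 2 * M) * √V * √(ℓ n))) := by
        rw [← Finset.sum_mul, ← ENNReal.ofReal_sum_of_nonneg fun s _ => norm_nonneg _,
          ← ENNReal.ofReal_mul (Finset.sum_nonneg fun _ _ => norm_nonneg _)]
    _ ≤ _ := by
        refine ENNReal.ofReal_le_ofReal ?_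
        gcongr
        exact sum_norm_shift_le_tsum hB F k

end Remainder


/-! ### The two regimes: large quadratic and large linear part. -/

section Cramer

variable {Ω : Type*} [MeasurableSpace Ω] {P : Measure Ω} [IsProbabilityMeasure P] {d : ℕ}
  {w : ℕ → ℕ → ℝ} {ℓ : ℕ → ℕ} {n : ℕ} {ε Z : ℤ → Ω → EuclideanSpace ℝ (Fin d)}
  {B : ℤ → EuclideanSpace ℝ (Fin d) →L[ℝ] EuclideanSpace ℝ (Fin d)}

lemma sum_norm_impulse_mul_le (F : Finset ℤ) (k : ℤ) (x : EuclideanSpace ℝ (Fin d)) {g : ℤ → ℝ}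
    (hg : ∀ s, 0 ≤ g s) :
    ∑ s ∈ F, ‖impulse B k x s‖ * g s ≤ ‖x‖ * ∑ s ∈ F, ‖B (s - k)‖ * g s := by
  rw [Finset.mul_sum]
  refine Finset.sum_le_sum fun s _ => ?_
  rw [impulse_apply, ← mul_assoc, mul_comm ‖x‖]
  exact mul_le_mul_of_nonneg_right ((B _).le_opNorm _) (hg s)

lemma abs_lagForm_impulse_self_le (hB : Summable fun j => ‖B j‖) {M : ℝ} (hM0 : 0 ≤ M)
    (hM : ∀ k : ℕ, 1 ≤ k → k ≤ ℓ n → |w k n| ≤ M) (T F : Finset ℤ) (k : ℤ) (t : UpperIdx d → ℝ)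
    (x : EuclideanSpace ℝ (Fin d)) :
    |lagForm w ℓ n T F t (impulse B k x) (impulse B k x)| ≤
      (ℓ n : ℝ)⁻¹ * (∑ pq, |t pq|) * (1 + 2 * M) * (∑' j, ‖B j‖) ^ 2 * ‖x‖ ^ 2 := by
  have hN0 : 0 ≤ ∑' j, ‖B j‖ := tsum_nonneg fun _ => norm_nonneg _
  have hτ0 : 0 ≤ ∑ pq, |t pq| := Finset.sum_nonneg fun _ _ => abs_nonneg _
  have hVL : ∀ s : ℤ, ‖∑ s' ∈ F, lagWeight w ℓ n T s s' • impulse B k x s'‖ ≤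
      (1 + 2 * M) * ((∑' j, ‖B j‖) * ‖x‖) := by
    intro s
    calc _ ≤ ∑ s' ∈ F, ‖lagWeight w ℓ n T s s' • impulse B k x s'‖ := norm_sum_le _ _
      _ ≤ ∑ s' ∈ F, (1 + 2 * M) * (‖B (s' - k)‖ * ‖x‖) := by
        refine Finset.sum_le_sum fun s' _ => ?_
        rw [norm_smul, Real.norm_eq_abs, impulse_apply]
        exact mul_le_mul (abs_lagWeight_le hM0 hM _ _ _) ((B _).le_opNorm _) (norm_nonneg _)
          (by positivity)
      _ = (1 + 2 * M) * ((∑ s' ∈ F, ‖B (s' - k)‖) * ‖x‖) := by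
        rw [Finset.sum_mul, Finset.mul_sum]
      _ ≤ _ := by
        gcongr
        exact sum_norm_shift_le_tsum hB F k
  have hsum : ∑ s ∈ F, ‖impulse B k x s‖ *
      ‖∑ s' ∈ F, lagWeight w ℓ n T s s' • impulse B k x s'‖ ≤
      ‖x‖ * ((∑' j, ‖B j‖) * ((1 + 2 * M) * ((∑' j, ‖B j‖) * ‖x‖))) := by
    refine (sum_norm_impulse_mul_le F k x fun _ => norm_nonneg _).trans ?_
    refine mul_le_mul_of_nonneg_left ?_ (norm_nonneg _)
    calc _ ≤ ∑ s ∈ F, ‖B (s - k)‖ * ((1 + 2 * M) * ((∑' j, ‖B j‖) * ‖x‖)) :=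
          Finset.sum_le_sum fun s _ => mul_le_mul_of_nonneg_left (hVL s) (norm_nonneg _)
      _ = (∑ s ∈ F, ‖B (s - k)‖) * ((1 + 2 * M) * ((∑' j, ‖B j‖) * ‖x‖)) := by
          rw [Finset.sum_mul]
      _ ≤ _ := mul_le_mul_of_nonneg_right (sum_norm_shift_le_tsum hB F k) (by positivity)
  calc _ ≤ _ := abs_lagForm_le T F t _ _
    _ ≤ (ℓ n : ℝ)⁻¹ * (∑ pq, |t pq|) *
        (‖x‖ * ((∑' j, ‖B j‖) * ((1 + 2 * M) * ((∑' j, ‖B j‖) * ‖x‖)))) :=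
      mul_le_mul_of_nonneg_left hsum (by positivity)
    _ = _ := by ring

lemma remainderSize_nonneg (T F : Finset ℤ) (k : ℤ) (ω : Ω) :
    0 ≤ remainderSize w ℓ n T F B ε k ω :=
  Finset.sum_nonneg fun _ _ => by positivity

lemma abs_lagForm_impulse_cross_le (T F : Finset ℤ) (k : ℤ) (t : UpperIdx d → ℝ)
    (x : EuclideanSpace ℝ (Fin d)) {ω : Ω} :
    |lagForm w ℓ n T F t (impulse B k x)
        (linearFilter B (({k} : Set ℤ)ᶜ.indicator fun l => ε l ω)) +
      lagForm w ℓ n T F t (linearFilter B (({k} : Set ℤ)ᶜ.indicator fun l => ε l ω))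
        (impulse B k x)| ≤
      2 * ((ℓ n : ℝ)⁻¹ * ∑ pq, |t pq|) * remainderSize w ℓ n T F B ε k ω * ‖x‖ := by
  have hτ0 : 0 ≤ ∑ pq, |t pq| := Finset.sum_nonneg fun _ _ => abs_nonneg _
  set y := linearFilter B (({k} : Set ℤ)ᶜ.indicator fun l => ε l ω) with hy
  have h3 : (ℓ n : ℝ)⁻¹ * (∑ pq, |t pq|) * ∑ s ∈ F, ‖impulse B k x s‖ *
      ‖∑ s' ∈ F, lagWeight w ℓ n T s s' • y s'‖ ≤
      (ℓ n : ℝ)⁻¹ * (∑ pq, |t pq|) * (‖x‖ * remainderSize w ℓ n T F B ε k ω) :=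
    mul_le_mul_of_nonneg_left (sum_norm_impulse_mul_le F k x fun _ => norm_nonneg _)
      (by positivity)
  have h4 := abs_lagForm_le (w := w) (ℓ := ℓ) (n := n) T F t (impulse B k x) y
  have h5 := abs_lagForm_swap_le (w := w) (ℓ := ℓ) (n := n) T F t (impulse B k x) y
  refine (abs_add_le _ _).trans ?_
  linarith

/-- `⟨U y, R* y⟩ = ⟨R U y, y⟩ = ‖y‖² + ⟨(R - A) U y, y⟩`, and the last term is at most `‖y‖² / 2` in
modulus. So the adjoint of a partial sum of the coefficients inherits the invertibility of `A_∞`. -/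
lemma norm_le_mul_norm_adjoint {E : Type*} [NormedAddCommGroup E] [InnerProductSpace ℝ E]
    [CompleteSpace E] {R A U : E →L[ℝ] E} (hU : ∀ x, A (U x) = x) {a : ℝ} (ha0 : 0 < a)
    (ha : ‖U‖ ≤ a) (hR : ‖R - A‖ * (2 * a) ≤ 1) (y : E) :
    ‖y‖ ≤ 2 * a * ‖ContinuousLinearMap.adjoint R y‖ := by
  have h1 : ‖y‖ ^ 2 = inner ℝ (U y) (ContinuousLinearMap.adjoint R y) -
      inner ℝ ((R - A) (U y)) y := by
    rw [ContinuousLinearMap.adjoint_inner_right, ← inner_sub_left,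
      sub_apply, hU, sub_sub_cancel, real_inner_self_eq_norm_sq]
  have hUt : ‖U y‖ ≤ a * ‖y‖ := (U.le_opNorm _).trans (by gcongr)
  have h2 : inner ℝ (U y) (ContinuousLinearMap.adjoint R y) ≤
      a * ‖y‖ * ‖ContinuousLinearMap.adjoint R y‖ :=
    (real_inner_le_norm _ _).trans (by gcongr)
  have h3 : -inner ℝ ((R - A) (U y)) y ≤ ‖y‖ ^ 2 / 2 := by
    rw [← inner_neg_left]
    refine (real_inner_le_norm _ _).trans ?_
    rw [norm_neg]
    calc _ ≤ ‖R - A‖ * (a * ‖y‖) * ‖y‖ := by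
          gcongr
          exact ((R - A).le_opNorm _).trans (by gcongr)
      _ = (‖R - A‖ * (2 * a)) * (‖y‖ ^ 2 / 2) := by ring
      _ ≤ 1 * (‖y‖ ^ 2 / 2) := by gcongr
      _ = _ := one_mul _
  rcases (norm_nonneg y).eq_or_lt with h0 | h0
  · rw [← h0]; positivity
  · refine le_of_mul_le_mul_left ?_ h0
    nlinarith

/-- Two interleaved families of `⌊ℓ/2⌋` innovations are left free. Only the adjacent pair of index
`j` is needed for the lower bound, so the lag defect is required at gaps `1` and `-1` alone. It
gives cross terms of size at least `h ‖x‖ ‖y‖` with `h = 2 / √ℓ`. -/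
lemma norm_condExp_exp_phase_le_of_quadratic_large (hε_meas : ∀ i, Measurable (ε i))
    (hind : iIndepFun ε P) (hident : ∀ i, IdentDistrib (ε i) (ε 1) P P)
    (hB : Summable fun j => ‖B j‖)
    (hZ : ∀ i, ∀ᵐ ω ∂P, HasSum (fun j => B j (ε (i - j) ω)) (Z i ω))
    {c : ℝ} (hc : 0 < c) (hc1 : c ≤ 1)
    (hν : ∀ u, ‖charFun (P.map (ε 1)) u‖ ≤ 1 - c * min 1 (‖u‖ ^ 2))
    {U : EuclideanSpace ℝ (Fin d) →L[ℝ] EuclideanSpace ℝ (Fin d)}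
    (hU : ∀ x, (∑' u, B u) (U x) = x) {a : ℝ} (ha0 : 0 < a) (ha : ‖U‖ ≤ a)
    {M : ℝ} (hM0 : 0 ≤ M) (hM : ∀ k : ℕ, 1 ≤ k → k ≤ ℓ n → |w k n| ≤ M) (hℓ2 : 2 ≤ ℓ n)
    {lo hi k : ℤ} (hk1 : lo + ℓ n ≤ k) (hk2 : k + 2 * ℓ n ≤ hi + 1) (hn : hi ≤ n)
    {F : Finset ℤ} (hF : ∀ s ∈ Finset.Icc lo hi, ∀ k : ℕ, k ≤ ℓ n → s + (k : ℤ) ∈ F)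
    (hdef : 2 * (Fintype.card (UpperIdx d) + 1) * a ^ 2 *
      (∑' uv : ℤ × ℤ, lagDefect w ℓ M 1 n uv * (‖B uv.1‖ * ‖B uv.2‖) +
       ∑' uv : ℤ × ℤ, lagDefect w ℓ M (-1) n uv * (‖B uv.1‖ * ‖B uv.2‖)) ≤ 1)
    (t₁ : EuclideanSpace ℝ (Fin d)) (t : UpperIdx d → ℝ)
    (ht : 4 * (Fintype.card (UpperIdx d) + 1) * a ^ 2 * √(ℓ n) ≤ ∑ pq, |t pq|) (r : ℝ) :
    ∃ S ⊆ Set.Ico k (k + ℓ n), ∀ᵐ ω ∂P, ‖(P[fun ω => Complex.exp (Complex.I *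
        ((linPhase ℓ n (Finset.Icc lo hi) t₁ (fun s => Z s ω) +
          lagForm w ℓ n (Finset.Icc lo hi) F t (fun s => Z s ω) (fun s => Z s ω) + r : ℝ) : ℂ)) |
        sigmaOn (fun j => MeasurableSpace.comap (ε j) inferInstance) Sᶜ]) ω‖ ≤
      1 - (1 - Real.exp (-(c ^ 3 / 16))) * c / 8 := by
  have hℓ0 : (2 : ℝ) ≤ ℓ n := by exact_mod_cast hℓ2
  have hs0 : 0 < √(ℓ n : ℝ) := Real.sqrt_pos.2 (by linarith)
  have hss : √(ℓ n : ℝ) * √(ℓ n : ℝ) = ℓ n := Real.mul_self_sqrt (by linarith)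
  have hinv : (ℓ n : ℝ)⁻¹ = (√(ℓ n : ℝ))⁻¹ * (√(ℓ n : ℝ))⁻¹ := by rw [← mul_inv, hss]
  have hτ0 : 0 < ∑ pq, |t pq| := lt_of_lt_of_le (by positivity) ht
  have : Nonempty (Fin (ℓ n / 2)) := ⟨⟨0, by omega⟩⟩
  let σ : Fin (ℓ n / 2) → ℤ := fun i => k + 1 + 2 * (i : ℕ)
  let τ : Fin (ℓ n / 2) → ℤ := fun i => k + 2 * (i : ℕ)
  refine ⟨Set.range σ ∪ Set.range τ, ?_, ?_⟩
  · rintro _ (⟨i, rfl⟩ | ⟨i, rfl⟩)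
    · have := i.2
      simp only [σ, Set.mem_Ico]
      omega
    · have := i.2
      simp only [τ, Set.mem_Ico]
      omega
  refine norm_condExp_exp_phase_le_of_cross_terms hε_meas hind hident hZ hc hc1 hν
    (measurable_linPhase _ _) (measurable_lagForm _ _ _) r (σ := σ) (τ := τ) ?_ ?_ ?_
    (h := 2 / √(ℓ n)) (by positivity) ?_ ?_
  · intro i j h
    simp only [σ] at h
    exact Fin.ext (by omega)
  · intro i j h
    simp only [τ] at h
    exact Fin.ext (by omega)
  · intro i j h
    simp only [σ, τ] at h
    omega
  -- `4 ⌊ℓ/2⌋ ≥ 2 (ℓ - 1) ≥ ℓ`, as `ℓ ≥ 2`.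
  · rw [Fintype.card_fin, div_pow, Real.sq_sqrt (by linarith), ← mul_div_assoc,
      le_div_iff₀ (by linarith)]
    have : ℓ n ≤ 2 * (ℓ n / 2) + 1 := by omega
    have : (ℓ n : ℝ) ≤ 2 * ((ℓ n / 2 : ℕ) : ℝ) + 1 := by exact_mod_cast this
    linarith
  · intro j
    refine ⟨j, ?_⟩
    have hj := j.2
    have e1 : σ j - τ j = 1 := by simp only [σ, τ]; ring
    have e2 : τ j - σ j = -1 := by simp only [σ, τ]; ring
    obtain ⟨x, y, hx, hy, hxa, hya, h⟩ := exists_lagForm_impulse_ge (w := w) (n := n) hB hU ha hM0 hM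
      (lo := lo) (hi := hi) (i := σ j) (j := τ j) (by simp only [σ]; omega) (by simp only [σ]; omega)
      (by simp only [τ]; omega) (by simp only [τ]; omega) hn hF t hτ0 (by rw [e1, e2]; exact hdef)
    refine ⟨x, y, hx, hy, le_trans ?_ h⟩
    have h1 : ‖x‖ * ‖y‖ ≤ a ^ 2 := by
      rw [sq]; exact mul_le_mul hxa hya (norm_nonneg _) ha0.le
    calc 2 / √(ℓ n : ℝ) * (‖x‖ * ‖y‖) ≤ 2 / √(ℓ n : ℝ) * a ^ 2 := by gcongr
      _ = (ℓ n : ℝ)⁻¹ * (4 * (Fintype.card (UpperIdx d) + 1) * a ^ 2 * √(ℓ n) /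
          (2 * (Fintype.card (UpperIdx d) + 1))) := by
        rw [hinv]; field_simp; ring
      _ ≤ _ := by gcongr

set_option maxHeartbeats 400000 in
-- On the event that the remainder is at most `K √ℓ`, the random cross coefficient is at most `2 (c₁
-- / √ℓ) K √ℓ = 2 c₁ K`. The lower bound on `‖t₁‖` makes the deterministic coefficient exceed this
-- by `1`. Off the event the trivial bound `1` is used.
lemma norm_condExp_exp_phase_le_of_linear_large (hε_meas : ∀ i, Measurable (ε i))
    (hind : iIndepFun ε P) (hident : ∀ i, IdentDistrib (ε i) (ε 1) P P) (hsq : MemLp (ε 1) 2 P)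
    (hB : Summable fun j => ‖B j‖)
    (hZ : ∀ i, ∀ᵐ ω ∂P, HasSum (fun j => B j (ε (i - j) ω)) (Z i ω))
    {c : ℝ}
    (hν : ∀ u, ‖charFun (P.map (ε 1)) u‖ ≤ 1 - c * min 1 (‖u‖ ^ 2))
    {U : EuclideanSpace ℝ (Fin d) →L[ℝ] EuclideanSpace ℝ (Fin d)}
    (hU : ∀ x, (∑' u, B u) (U x) = x) {a : ℝ} (ha0 : 0 < a) (ha : ‖U‖ ≤ a)
    {M : ℝ} (hM0 : 0 ≤ M) (hM : ∀ k : ℕ, 1 ≤ k → k ≤ ℓ n → |w k n| ≤ M) (hℓ1 : 1 ≤ ℓ n)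
    {lo hi k : ℤ} (hk1 : lo + ℓ n ≤ k) (hk2 : k + ℓ n ≤ hi)
    (F : Finset ℤ) {c₁ K : ℝ} (hK : 0 ≤ K)
    (herr : 2 * a * (∑' u : ℤ, if |u| ≤ (ℓ n : ℤ) then 0 else ‖B u‖) ≤ 1)
    (hsmall : (√(ℓ n))⁻¹ * (c₁ * (1 + 2 * M) * (∑' j, ‖B j‖) ^ 2 * ∫ ω, ‖ε 1 ω‖ ^ 2 ∂P) ≤ c / 2)
    (t₁ : EuclideanSpace ℝ (Fin d)) (t : UpperIdx d → ℝ)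
    (ht : ∑ pq, |t pq| ≤ c₁ * √(ℓ n)) (ht₁ : 2 * a * (1 + 2 * c₁ * K) * √(ℓ n) ≤ ‖t₁‖) (r : ℝ) :
    ∀ᵐ ω ∂P, ‖(P[fun ω => Complex.exp (Complex.I *
        ((linPhase ℓ n (Finset.Icc lo hi) t₁ (fun s => Z s ω) +
          lagForm w ℓ n (Finset.Icc lo hi) F t (fun s => Z s ω) (fun s => Z s ω) + r : ℝ) : ℂ)) |
        sigmaOn (fun j => MeasurableSpace.comap (ε j) inferInstance) ({k} : Set ℤ)ᶜ]) ω‖ ≤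
      1 - c / 2 * {ω | remainderSize w ℓ n (Finset.Icc lo hi) F B ε k ω ≤
        K * √(ℓ n)}.indicator (fun _ => (1 : ℝ)) ω := by
  have hℓ0 : (1 : ℝ) ≤ ℓ n := by exact_mod_cast hℓ1
  have hs0 : 0 < √(ℓ n : ℝ) := Real.sqrt_pos.2 (by linarith)
  have hss : √(ℓ n : ℝ) * √(ℓ n : ℝ) = ℓ n := Real.mul_self_sqrt (by linarith)
  have hinv : (ℓ n : ℝ)⁻¹ = (√(ℓ n : ℝ))⁻¹ * (√(ℓ n : ℝ))⁻¹ := by rw [← mul_inv, hss]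
  have hτ0 : 0 ≤ ∑ pq, |t pq| := Finset.sum_nonneg fun _ _ => abs_nonneg _
  have hc₁ : 0 ≤ c₁ := by
    by_contra! h
    nlinarith
  have hβ : (ℓ n : ℝ)⁻¹ * ∑ pq, |t pq| ≤ (√(ℓ n))⁻¹ * c₁ := by
    calc _ ≤ (ℓ n : ℝ)⁻¹ * (c₁ * √(ℓ n)) := by gcongr
      _ = _ := by rw [hinv]; field_simp
  set T := Finset.Icc lo hi with hT
  have hQ : ∀ x, |lagForm w ℓ n T F t (impulse B k x) (impulse B k x)| ≤
      ((√(ℓ n))⁻¹ * c₁ * (1 + 2 * M) * (∑' j, ‖B j‖) ^ 2) * ‖x‖ ^ 2 := fun x =>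
    (abs_lagForm_impulse_self_le hB hM0 hM T F k t x).trans (by gcongr)
  set R : EuclideanSpace ℝ (Fin d) →L[ℝ] EuclideanSpace ℝ (Fin d) := ∑ s ∈ T, B (s - k) with hR
  have hRerr : ‖R - ∑' u, B u‖ * (2 * a) ≤ 1 := by
    have := norm_sum_Icc_sub_tsum_le hB (L := ℓ n) hk1 hk2
    nlinarith
  have hL₀ : ∀ x, linPhase ℓ n T t₁ (impulse B k x) =
      inner ℝ x ((√(ℓ n))⁻¹ • (ContinuousLinearMap.adjoint R t₁)) := by
    intro x
    rw [linPhase_apply, ← Finset.mul_sum, inner_smul_right,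
      ContinuousLinearMap.adjoint_inner_right, real_inner_comm, hR,
      sum_apply, inner_sum]
    rfl
  have hlow : ‖t₁‖ ≤ 2 * a * ‖ContinuousLinearMap.adjoint R t₁‖ :=
    norm_le_mul_norm_adjoint hU ha0 ha hRerr t₁
  have hb : 1 + 2 * c₁ * K ≤ ‖(√(ℓ n))⁻¹ • (ContinuousLinearMap.adjoint R t₁)‖ := by
    rw [norm_smul, norm_inv, Real.norm_of_nonneg hs0.le, inv_mul_eq_div, le_div_iff₀ hs0]
    refine le_of_mul_le_mul_left (a := 2 * a) ?_ (by positivity)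
    calc _ = 2 * a * (1 + 2 * c₁ * K) * √(ℓ n) := by ring
      _ ≤ _ := ht₁.trans hlow
  have hmain := norm_condExp_exp_phase_le_of_linear_term hε_meas hind hident hsq hZ hν
    (measurable_linPhase (ℓ := ℓ) (n := n) T t₁) (measurable_lagForm (w := w) (ℓ := ℓ) (n := n) T F t)
    r k (by positivity) hQ hL₀ hb
  have hone : ∀ᵐ ω ∂P, ‖(P[fun ω => Complex.exp (Complex.I *
        ((linPhase ℓ n T t₁ (fun s => Z s ω) +
          lagForm w ℓ n T F t (fun s => Z s ω) (fun s => Z s ω) + r : ℝ) : ℂ)) |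
        sigmaOn (fun j => MeasurableSpace.comap (ε j) inferInstance) ({k} : Set ℤ)ᶜ]) ω‖ ≤ 1 := by
    refine ae_bdd_norm_condExp_of_ae_bdd_norm (R := 1) ?_
    exact ae_of_all _ fun ω => (norm_cexp_I_mul _).le
  filter_upwards [hmain, hone] with ω h1 h2
  by_cases hg : remainderSize w ℓ n T F B ε k ω ≤ K * √(ℓ n)
  · rw [Set.indicator_of_mem (by exact hg), mul_one]
    refine (h1 fun x => ?_).trans ?_
    · refine (abs_lagForm_impulse_cross_le T F k t x).trans ?_
      calc 2 * ((ℓ n : ℝ)⁻¹ * ∑ pq, |t pq|) * remainderSize w ℓ n T F B ε k ω * ‖x‖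
          ≤ 2 * ((√(ℓ n))⁻¹ * c₁) * (K * √(ℓ n)) * ‖x‖ :=
            mul_le_mul_of_nonneg_right (mul_le_mul (mul_le_mul_of_nonneg_left hβ zero_le_two) hg
              (remainderSize_nonneg _ _ _ _) (by positivity)) (norm_nonneg _)
        _ = 2 * c₁ * K * ‖x‖ := by field_simp
    · have : (√(ℓ n))⁻¹ * c₁ * (1 + 2 * M) * (∑' j, ‖B j‖) ^ 2 * ∫ ω, ‖ε 1 ω‖ ^ 2 ∂P ≤ c / 2 := by
        refine le_trans (le_of_eq ?_) hsmall
        ring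
      linarith
  · rw [Set.indicator_of_notMem (by exact hg), mul_zero, sub_zero]
    exact h2

end Cramer

/-! ### The Cramér bound for a sum of blocks, uniformly in the frequency. -/

section Cramer

variable {Ω : Type*} [MeasurableSpace Ω] {P : Measure Ω} [IsProbabilityMeasure P] {d : ℕ}
  {w : ℕ → ℕ → ℝ} {ℓ : ℕ → ℕ} {ε Z : ℤ → Ω → EuclideanSpace ℝ (Fin d)}
  {B : ℤ → EuclideanSpace ℝ (Fin d) →L[ℝ] EuclideanSpace ℝ (Fin d)}

/-- Both regimes are dominated by `1 - κ 1_good` before averaging, where the event `good` does not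
involve `t`. Its conditional expectation dominates every frequency at once and has mean at most `1 -
κ / 2`. -/
lemma expSup_norm_condExp_exp_block_le {n : ℕ} (hε_meas : ∀ i, Measurable (ε i))
    (hind : iIndepFun ε P) (hident : ∀ i, IdentDistrib (ε i) (ε 1) P P) (hsq : MemLp (ε 1) 2 P)
    (hmean : ∫ ω, ε 1 ω ∂P = 0) (hB : Summable fun j => ‖B j‖)
    (hZ : ∀ i, ∀ᵐ ω ∂P, HasSum (fun j => B j (ε (i - j) ω)) (Z i ω))
    {c : ℝ} (hc : 0 < c) (hc1 : c ≤ 1)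
    (hν : ∀ u, ‖charFun (P.map (ε 1)) u‖ ≤ 1 - c * min 1 (‖u‖ ^ 2))
    {U : EuclideanSpace ℝ (Fin d) →L[ℝ] EuclideanSpace ℝ (Fin d)}
    (hU : ∀ x, (∑' u, B u) (U x) = x) {a : ℝ} (ha0 : 0 < a) (ha : ‖U‖ ≤ a)
    {M : ℝ} (hM0 : 0 ≤ M) (hM : ∀ k : ℕ, 1 ≤ k → k ≤ ℓ n → |w k n| ≤ M) (hℓ2 : 2 ≤ ℓ n)
    {c₁ K : ℝ} (hK : K = 6 * (∑' j, ‖B j‖) ^ 2 * (1 + 2 * M) * √(∫ ω, ‖ε 1 ω‖ ^ 2 ∂P) + 1)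
    (hc₁ : c₁ = 4 * (Fintype.card (UpperIdx d) + 1) * a ^ 2)
    (hdef : 2 * (Fintype.card (UpperIdx d) + 1) * a ^ 2 *
      (∑' uv : ℤ × ℤ, lagDefect w ℓ M 1 n uv * (‖B uv.1‖ * ‖B uv.2‖) +
       ∑' uv : ℤ × ℤ, lagDefect w ℓ M (-1) n uv * (‖B uv.1‖ * ‖B uv.2‖)) ≤ 1)
    (herr : 2 * a * (∑' u : ℤ, if |u| ≤ (ℓ n : ℤ) then 0 else ‖B u‖) ≤ 1)
    (hsmall : (√(ℓ n))⁻¹ * (c₁ * (1 + 2 * M) * (∑' j, ‖B j‖) ^ 2 * ∫ ω, ‖ε 1 ω‖ ^ 2 ∂P) ≤ c / 2)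
    {m : ℕ} (hm : 2 ≤ m) {j₀ : ℤ} (hj₀ : j₀ ∈ centralBlocks ℓ n m) {S : Set (BlockSpace d)}
    (hS : ∀ t ∈ S, (c₁ + 2 * a * (1 + 2 * c₁ * K)) * √(ℓ n) ≤ ‖t‖) :
    expSup P (fun t : S => fun ω =>
        ‖(P[fun ω' => Complex.exp (Complex.I *
            ((inner ℝ (t : BlockSpace d)
              (∑ j ∈ Finset.Icc (j₀ - (m : ℤ)) (j₀ + (m : ℤ)), blockVar P Z w ℓ n j ω') : ℝ) : ℂ))
          | outerSigma (fun j => MeasurableSpace.comap (ε j) inferInstance) ℓ n m j₀]) ω‖) ≤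
      ENNReal.ofReal (1 - (1 - Real.exp (-(c ^ 3 / 16))) * c / 16) := by
  set D : ℤ → MeasurableSpace Ω := fun j => MeasurableSpace.comap (ε j) inferInstance with hD
  set κ : ℝ := (1 - Real.exp (-(c ^ 3 / 16))) * c / 8 with hκ
  have hexp : 0 < 1 - Real.exp (-(c ^ 3 / 16)) := by
    have : Real.exp (-(c ^ 3 / 16)) < 1 := by
      rw [Real.exp_lt_one_iff]; have := pow_pos hc 3; linarith
    linarith
  have hexp1 : 1 - Real.exp (-(c ^ 3 / 16)) < 1 := by
    have := Real.exp_pos (-(c ^ 3 / 16)); linarith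
  have hκ0 : 0 < κ := by positivity
  have hκc : κ ≤ c / 2 := by
    have : (1 - Real.exp (-(c ^ 3 / 16))) * c ≤ 1 * c := by gcongr
    linarith
  have hK0 : 0 ≤ K := by rw [hK]; positivity
  -- The first time of block `j₀ + 1`. For `m ≥ 2` at least `ℓ` times of the merged interval remain
  -- on either side of the free innovations.
  set k : ℤ := j₀ * ℓ n + 1 with hk
  set lo : ℤ := (j₀ - m - 1) * ℓ n + 1 with hlo
  set hi : ℤ := (j₀ - m + (2 * m : ℕ)) * ℓ n with hhi
  have hℓ0 : 0 < ℓ n := by omega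
  have hmℓ : 2 * (ℓ n : ℤ) ≤ m * ℓ n := by exact_mod_cast Nat.mul_le_mul_right _ hm
  have hk1 : lo + ℓ n ≤ k := by
    have : k = lo + (m * ℓ n + ℓ n) := by rw [hk, hlo]; ring
    omega
  have hk2 : k + 2 * ℓ n ≤ hi + 1 := by
    have : hi + 1 = k + m * ℓ n := by rw [hk, hhi]; push_cast; ring
    omega
  -- `j₀ + m < ⌈n/ℓ⌉` gives `(j₀ + m) ℓ < n`, so none of the blocks is cut short at `n`.
  have hhin : hi ≤ n := by
    have h1 : j₀ - m + (2 * m : ℕ) < ⌈numBlocks ℓ n⌉ := by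
      have := hj₀.2
      rw [numBlocksCeil] at this
      push_cast
      omega
    have h2 := Int.lt_ceil.1 h1
    rw [numBlocks, lt_div_iff₀ (by exact_mod_cast hℓ0)] at h2
    exact_mod_cast h2.le
  set F := Finset.Icc lo (hi + ℓ n) with hFdef
  have hF : ∀ s ∈ Finset.Icc lo hi, ∀ k : ℕ, k ≤ ℓ n → s + (k : ℤ) ∈ F := by
    intro s hs k hk
    rw [Finset.mem_Icc] at hs
    rw [hFdef, Finset.mem_Icc]
    omega
  set good : Set Ω := {ω | remainderSize w ℓ n (Finset.Icc lo hi) F B ε k ω ≤ K * √(ℓ n)}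
    with hgood
  have hgm : MeasurableSet good := measurableSet_le
    (measurable_remainderSize hε_meas _ _ _) measurable_const
  have hgP : 1 / 2 ≤ P.real good := by
    rw [hgood, hK]
    exact half_le_measureReal_remainderSize_le hε_meas hind hident hsq hmean hB hZ hM0 hM hℓ0
      (Finset.Icc lo hi) F k
  have hIi : Integrable (good.indicator fun _ => (1 : ℝ)) P :=
    (integrable_const 1).indicator hgm
  have hIle : ∀ ω, good.indicator (fun _ => (1 : ℝ)) ω ≤ 1 := fun ω =>
    Set.indicator_le_self' (fun _ _ => zero_le_one) ω
  set g : Ω → ℝ := fun ω => 1 - κ * good.indicator (fun _ => (1 : ℝ)) ω with hg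
  have hgi : Integrable g P := (integrable_const 1).sub (hIi.const_mul κ)
  have hgκ : ∀ ω, 1 - κ ≤ g ω := fun ω => by
    have := mul_le_mul_of_nonneg_left (hIle ω) hκ0.le
    simp only [hg]; linarith
  have hOle : outerSigma D ℓ n m j₀ ≤ ‹MeasurableSpace Ω› := sigmaOn_comap_le hε_meas _
  have hint : ∫ ω, (P[g | outerSigma D ℓ n m j₀]) ω ∂P ≤
      1 - (1 - Real.exp (-(c ^ 3 / 16))) * c / 16 := by
    rw [integral_condExp hOle, hg, integral_sub (integrable_const 1) (hIi.const_mul κ),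
      integral_const_mul, integral_indicator_const _ hgm]
    simp only [integral_const, probReal_univ, smul_eq_mul, mul_one]
    have := mul_le_mul_of_nonneg_left hgP hκ0.le
    linarith
  refine (expSup_le_integral (g := P[g | outerSigma D ℓ n m j₀]) ?_ integrable_condExp ?_ ?_).trans
    (ENNReal.ofReal_le_ofReal hint)
  · exact (stronglyMeasurable_condExp.measurable).mono hOle le_rfl
  · refine condExp_nonneg (ae_of_all _ fun ω => ?_)
    have := hgκ ω
    simp only [Pi.zero_apply]
    have : κ ≤ 1 := by linarith
    linarith
  rintro ⟨t, htS⟩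
  obtain ⟨r, hr⟩ := inner_sum_blockVar_eq (w := w) (ℓ := ℓ) (n := n) P Z (a := j₀ - m)
    (N := 2 * m) (T := Finset.Icc lo hi) rfl hhin hF t
  have e : j₀ + (m : ℤ) = j₀ - m + (2 * m : ℕ) := by push_cast; ring
  simp only [e, hr]
  set t₁ : EuclideanSpace ℝ (Fin d) := WithLp.toLp 2 fun p => t (Sum.inl p) with ht₁
  -- The block `[k, k + ℓ)` lies in the window excluded from the outer sigma-field whatever `m` is,
  -- so freezing all times off `S` conditions on at least as much.
  have hwin : ∀ S ⊆ Set.Ico k (k + ℓ n), outerSigma D ℓ n m j₀ ≤ sigmaOn D Sᶜ := by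
    intro S hS
    refine sigmaOn_mono (Set.compl_subset_compl.2 fun x hx => ?_)
    have h := hS hx
    have h0 : (0 : ℤ) ≤ (m / 2 : ℕ) * ℓ n := by positivity
    have h1 : (j₀ - (m / 2 : ℕ)) * (ℓ n : ℤ) + 1 = k - (m / 2 : ℕ) * ℓ n := by rw [hk]; ring
    have h2 : (j₀ + (m / 2 : ℕ) + 1) * (ℓ n : ℤ) = k - 1 + (m / 2 : ℕ) * ℓ n + ℓ n := by
      rw [hk]; ring
    rw [Set.mem_Icc, h1, h2]
    rw [Set.mem_Ico] at h
    constructor <;> linarith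
  rcases le_total (c₁ * √(ℓ n)) (∑ pq, |t (Sum.inr pq)|) with hlarge | hlarge
  · obtain ⟨S, hSk, hSb⟩ := norm_condExp_exp_phase_le_of_quadratic_large hε_meas hind hident hB hZ
      hc hc1 hν hU ha0 ha hM0 hM hℓ2 hk1 hk2 hhin hF hdef t₁ (fun pq => t (Sum.inr pq))
      (by rw [← hc₁]; exact hlarge) r
    refine norm_condExp_le_condExp_of_norm_condExp_le (hwin S hSk) (sigmaOn_comap_le hε_meas _)
      hgi ?_
    filter_upwards [hSb] with ω hω
    exact hω.trans (hgκ ω)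
  · refine norm_condExp_le_condExp_of_norm_condExp_le
      (hwin {k} (by simpa using hℓ0)) (sigmaOn_comap_le hε_meas _) hgi ?_
    -- The part of the threshold on `‖t‖` that `∑ |t₂| ≤ c₁ √ℓ` cannot account for is left to `t₁`.
    have hnorm : 2 * a * (1 + 2 * c₁ * K) * √(ℓ n) ≤ ‖t₁‖ := by
      have h1 := hS t htS
      have h2 := norm_blockSpace_le t
      rw [← ht₁] at h2
      linarith
    filter_upwards [norm_condExp_exp_phase_le_of_linear_large hε_meas hind hident hsq hB hZ hν hU
      ha0 ha hM0 hM hℓ0 hk1 (hi := hi) (by omega) F hK0 herr hsmall t₁ (fun pq => t (Sum.inr pq)) hlarge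
      hnorm r] with ω hω
    refine hω.trans ?_
    have h0 : 0 ≤ good.indicator (fun _ => (1 : ℝ)) ω :=
      Set.indicator_nonneg (fun _ _ => zero_le_one) ω
    have := mul_le_mul_of_nonneg_right hκc h0
    simp only [hg]
    linarith

lemma exists_eventually_expSup_norm_condExp_exp_block_le (hε_meas : ∀ i, Measurable (ε i))
    (hind : iIndepFun ε P) (hident : ∀ i, IdentDistrib (ε i) (ε 1) P P) (hsq : MemLp (ε 1) 2 P)
    (hmean : ∫ ω, ε 1 ω ∂P = 0)
    (hac : (volume : Measure (EuclideanSpace ℝ (Fin d))).withDensity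
      ((P.map (ε 1)).rnDeriv volume) ≠ 0)
    (hB : Summable fun j => ‖B j‖)
    (hZ : ∀ i, ∀ᵐ ω ∂P, HasSum (fun j => B j (ε (i - j) ω)) (Z i ω))
    {U : EuclideanSpace ℝ (Fin d) →L[ℝ] EuclideanSpace ℝ (Fin d)}
    (hU : ∀ x, (∑' u, B u) (U x) = x)
    (hℓ : Tendsto ℓ atTop atTop) {M : ℝ} (hM0 : 0 ≤ M)
    (hM : ∀ n k : ℕ, 1 ≤ n → 1 ≤ k → k ≤ ℓ n → |w k n| ≤ M)
    (hw_lim : ∀ k : ℕ, 1 ≤ k → Tendsto (fun n => w k n) atTop (𝓝 1)) :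
    ∃ c₀ κ : ℝ, 0 < c₀ ∧ 0 < κ ∧ ∀ᶠ n in atTop, 1 ≤ ℓ n ∧
      ∀ m : ℕ, 2 ≤ m → ∀ j₀ ∈ centralBlocks ℓ n m, ∀ S : Set (BlockSpace d),
        (∀ t ∈ S, c₀ * √(ℓ n) ≤ ‖t‖) →
        expSup P (fun t : S => fun ω =>
          ‖(P[fun ω' => Complex.exp (Complex.I *
            ((inner ℝ (t : BlockSpace d)
              (∑ j ∈ Finset.Icc (j₀ - (m : ℤ)) (j₀ + (m : ℤ)), blockVar P Z w ℓ n j ω') : ℝ) : ℂ))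
            | outerSigma (fun j => MeasurableSpace.comap (ε j) inferInstance) ℓ n m j₀]) ω‖) ≤
        ENNReal.ofReal (1 - κ) := by
  have := Measure.isProbabilityMeasure_map (μ := P) (hε_meas 1).aemeasurable
  obtain ⟨c, hc, hc1, hν⟩ := exists_norm_charFun_le_one_sub_min (P.map (ε 1)) hac
  have ha0 : 0 < ‖U‖ + 1 := by positivity
  have ha : ‖U‖ ≤ ‖U‖ + 1 := by linarith
  obtain ⟨c₁, hc₁⟩ : ∃ c₁ : ℝ, c₁ = 4 * (Fintype.card (UpperIdx d) + 1) * (‖U‖ + 1) ^ 2 := ⟨_, rfl⟩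
  obtain ⟨K, hK⟩ : ∃ K : ℝ, K = 6 * (∑' j, ‖B j‖) ^ 2 * (1 + 2 * M) *
    √(∫ ω, ‖ε 1 ω‖ ^ 2 ∂P) + 1 := ⟨_, rfl⟩
  have hc₁0 : 0 < c₁ := by rw [hc₁]; positivity
  have hK0 : 0 < K := by rw [hK]; positivity
  refine ⟨c₁ + 2 * (‖U‖ + 1) * (1 + 2 * c₁ * K), (1 - Real.exp (-(c ^ 3 / 16))) * c / 16,
    by positivity, ?_, ?_⟩
  · have : Real.exp (-(c ^ 3 / 16)) < 1 := by
      rw [Real.exp_lt_one_iff]; have := pow_pos hc 3; linarith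
    have : 0 < 1 - Real.exp (-(c ^ 3 / 16)) := by linarith
    positivity
  have hα0 : ∀ u : ℤ, 0 ≤ ‖B u‖ := fun _ => norm_nonneg _
  have hdef := ((tendsto_tsum_lagDefect hM0 hM hℓ hw_lim 1 hα0 hB).add
    (tendsto_tsum_lagDefect hM0 hM hℓ hw_lim (-1) hα0 hB)).const_mul
    (2 * (Fintype.card (UpperIdx d) + 1) * (‖U‖ + 1) ^ 2)
  have herr := (tendsto_tsum_ite_abs_le hB hℓ).const_mul (2 * (‖U‖ + 1))
  have hsqrt : Tendsto (fun n => (√(ℓ n : ℝ))⁻¹) atTop (𝓝 0) :=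
    tendsto_inv_atTop_zero.comp
      (Real.tendsto_sqrt_atTop.comp (tendsto_natCast_atTop_atTop.comp hℓ))
  have hsmall := hsqrt.mul_const
    (c₁ * (1 + 2 * M) * (∑' j, ‖B j‖) ^ 2 * ∫ ω, ‖ε 1 ω‖ ^ 2 ∂P)
  rw [add_zero, mul_zero] at hdef
  rw [mul_zero] at herr
  rw [zero_mul] at hsmall
  filter_upwards [eventually_ge_atTop 1, hℓ.eventually_ge_atTop 2,
    hdef.eventually_le_const zero_lt_one, herr.eventually_le_const zero_lt_one,
    hsmall.eventually_le_const (half_pos hc)] with n h1 h2 h3 h4 h5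
  exact ⟨by omega, fun m hm j₀ hj₀ S hS => expSup_norm_condExp_exp_block_le hε_meas hind hident hsq
    hmean hB hZ hc hc1 hν hU ha0 ha hM0 (fun k => hM n k h1) h2 hK hc₁ h3 h4 h5 hm hj₀ hS⟩

end Cramer

/-! ### Decay and invertibility of the coefficient matrices. -/

section Coefficients

lemma exists_norm_le_mul_exp_of_isBigO {V : Type*} [SeminormedAddCommGroup V] {B : ℤ → V} {κ : ℝ}
    (h : (fun i => ‖B i‖) =O[cofinite] fun i : ℤ => Real.exp (-(κ * |(i : ℝ)|))) :
    ∃ K, ∀ j, ‖B j‖ ≤ K * Real.exp (-(κ * |(j : ℝ)|)) := by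
  obtain ⟨K, -, hK⟩ := Asymptotics.bound_of_isBigO_cofinite h
  refine ⟨K, fun j => ?_⟩
  have := hK (x := j) (Real.exp_ne_zero _)
  rwa [Real.norm_of_nonneg (norm_nonneg _), Real.norm_of_nonneg (Real.exp_pos _).le] at this

lemma exists_rightInverse_tsum_toEuclideanCLM {d : ℕ} {A : ℤ → Matrix (Fin d) (Fin d) ℝ}
    (hA : Summable fun j => Matrix.toEuclideanCLM (𝕜 := ℝ) (A j)) (hinv : IsUnit (∑' i, A i)) :
    ∃ U : EuclideanSpace ℝ (Fin d) →L[ℝ] EuclideanSpace ℝ (Fin d),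
      ∀ x, (∑' j, Matrix.toEuclideanCLM (𝕜 := ℝ) (A j)) (U x) = x := by
  let e := Matrix.toEuclideanCLM (n := Fin d) (𝕜 := ℝ)
  let f : (EuclideanSpace ℝ (Fin d) →L[ℝ] EuclideanSpace ℝ (Fin d)) →ₗ[ℝ]
      Matrix (Fin d) (Fin d) ℝ := e.symm.toAlgEquiv.toLinearMap
  have hf : Continuous f := f.continuous_of_finiteDimensional
  have h1 : HasSum A (f (∑' j, e (A j))) := by
    have := hA.hasSum.map f hf
    have h2 : (f ∘ fun j => e (A j)) = A := by
      funext j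
      exact e.symm_apply_apply (A j)
    rwa [h2] at this
  have h3 : ∑' j, e (A j) = e (∑' i, A i) := by
    rw [h1.tsum_eq]
    exact (e.apply_symm_apply _).symm
  obtain ⟨V, hV⟩ := hinv.exists_right_inv
  refine ⟨e V, fun x => ?_⟩
  have h4 : e (∑' i, A i) * e V = 1 := by rw [← map_mul, hV, map_one]
  change (∑' j, e (A j)) (e V x) = x
  rw [h3, ← mul_apply_eq_comp, h4, one_apply_eq_self]

end Coefficients

/-! ### Growth conditions on `d_n`. -/

section BlockLengths

variable {ℓ : ℕ → ℕ}

lemma isBigO_max_one_mul_sqrt (hℓ : Tendsto ℓ atTop atTop) {C : ℝ} (hC : 0 ≤ C) :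
    (fun n => max 1 (C * √(ℓ n))) =O[atTop] fun n => (ℓ n : ℝ) := by
  refine Asymptotics.IsBigO.of_bound (1 + C) ?_
  filter_upwards [hℓ.eventually_ge_atTop 1] with n hn
  have h1 : (1 : ℝ) ≤ ℓ n := by exact_mod_cast hn
  have h2 : √(ℓ n : ℝ) ≤ ℓ n := Real.sqrt_le_self_iff.2 (Or.inr h1)
  rw [Real.norm_of_nonneg (by positivity), Real.norm_of_nonneg (by positivity)]
  refine max_le (by nlinarith) ?_
  nlinarith

/-- The claim amounts to `ℓ = O((n/ℓ)^(1-κ))`, that is, `ℓ^(2-κ) = O(n^(1-κ))`. This follows from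
`(1/2 - κ₁)(2 - κ) ≤ 1 - κ`, which holds for `κ ≤ κ₁`. -/
lemma isBigO_sq_max_one_mul_sqrt (hℓ : Tendsto ℓ atTop atTop) {κ κ₁ : ℝ} (hκ : 0 < κ)
    (hκκ₁ : κ ≤ κ₁) (hκ₁ : κ₁ < 1)
    (h : ∀ n : ℕ, κ₁⁻¹ ≤ (n : ℝ) → (ℓ n : ℝ) < κ₁⁻¹ * (n : ℝ) ^ (1 / 2 - κ₁)) {C : ℝ} (hC : 0 ≤ C) :
    (fun n => max 1 (C * √(ℓ n)) ^ 2) =O[atTop] fun n => numBlocks ℓ n ^ (1 - κ) := by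
  have hκ₁0 : 0 < κ₁ := hκ.trans_le hκκ₁
  refine Asymptotics.IsBigO.of_bound ((1 + C) ^ 2 * κ₁⁻¹ ^ (2 - κ)) ?_
  filter_upwards [hℓ.eventually_ge_atTop 1, eventually_ge_atTop 1,
    tendsto_natCast_atTop_atTop.eventually_ge_atTop κ₁⁻¹] with n hn hn1 hnκ
  have h1 : (1 : ℝ) ≤ ℓ n := by exact_mod_cast hn
  have h1n : (1 : ℝ) ≤ n := by exact_mod_cast hn1
  have h2 : (1 : ℝ) ≤ √(ℓ n : ℝ) := Real.one_le_sqrt.2 h1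
  have h3 : max 1 (C * √(ℓ n)) ≤ (1 + C) * √(ℓ n) := max_le (by nlinarith) (by nlinarith)
  have hb : 0 ≤ numBlocks ℓ n := by rw [numBlocks]; positivity
  rw [Real.norm_of_nonneg (by positivity), Real.norm_of_nonneg (by positivity)]
  have h4 : max 1 (C * √(ℓ n)) ^ 2 ≤ (1 + C) ^ 2 * ℓ n := by
    calc _ ≤ ((1 + C) * √(ℓ n)) ^ 2 := by gcongr
      _ = _ := by rw [mul_pow, Real.sq_sqrt (by positivity)]
  have h5 : (ℓ n : ℝ) ^ (2 - κ) ≤ κ₁⁻¹ ^ (2 - κ) * (n : ℝ) ^ (1 - κ) := by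
    calc (ℓ n : ℝ) ^ (2 - κ) ≤ (κ₁⁻¹ * (n : ℝ) ^ (1 / 2 - κ₁)) ^ (2 - κ) :=
          Real.rpow_le_rpow (by positivity) (h n hnκ).le (by linarith)
      _ = κ₁⁻¹ ^ (2 - κ) * (n : ℝ) ^ ((1 / 2 - κ₁) * (2 - κ)) := by
          rw [Real.mul_rpow (by positivity) (by positivity), ← Real.rpow_mul (by positivity)]
      _ ≤ _ := by
          gcongr
          nlinarith
  have h6 : (ℓ n : ℝ) ≤ κ₁⁻¹ ^ (2 - κ) * numBlocks ℓ n ^ (1 - κ) := by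
    rw [numBlocks, Real.div_rpow (by positivity) (by positivity), ← mul_div_assoc,
      le_div_iff₀ (by positivity)]
    refine le_trans (le_of_eq ?_) h5
    rw [show 2 - κ = 1 + (1 - κ) by ring, Real.rpow_add (by linarith), Real.rpow_one]
  calc _ ≤ (1 + C) ^ 2 * ℓ n := h4
    _ ≤ (1 + C) ^ 2 * (κ₁⁻¹ ^ (2 - κ) * numBlocks ℓ n ^ (1 - κ)) := by gcongr
    _ = _ := by ring

end BlockLengths

end LinearProcessEE

end

/-! ### The main theorem. -/

theorem proposition2p1 {Ω : Type*} [MeasurableSpace Ω] (P : Measure Ω) [IsProbabilityMeasure P]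
    {d : ℕ}
    -- the block lengths, the weights `w k n = w_{kn}` and the order `s` of the expansion
    (ℓ : ℕ → ℕ) (hℓ : Tendsto ℓ atTop atTop)
    (hℓn : Tendsto (fun n => (ℓ n : ℝ) / (n : ℝ)) atTop (𝓝 0))
    (w : ℕ → ℕ → ℝ) (hw_bdd : ∃ M : ℝ, ∀ n k : ℕ, 1 ≤ n → 1 ≤ k → k ≤ ℓ n → |w k n| ≤ M)
    (hw_lim : ∀ k : ℕ, 1 ≤ k → Tendsto (fun n => w k n) atTop (𝓝 1))
    (s : ℕ) (hs : 3 ≤ s)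
    -- the innovations
    (ε : ℤ → Ω → EuclideanSpace ℝ (Fin d)) (hε_meas : ∀ i, Measurable (ε i))
    (hε_indep : iIndepFun ε P) (hε_ident : ∀ i, IdentDistrib (ε i) (ε 1) P P)
    (hε_sq : MemLp (ε 1) 2 P) (hε_mean : ∫ ω, ε 1 ω ∂P = 0)
    (hε_ac : (volume : Measure (EuclideanSpace ℝ (Fin d))).withDensity
      ((P.map (ε 1)).rnDeriv volume) ≠ 0)
    -- the coefficients
    (A : ℤ → Matrix (Fin d) (Fin d) ℝ)
    (hA_decay : ∃ κ ∈ Set.Ioo (0 : ℝ) 1,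
      (fun i => ‖Matrix.toEuclideanCLM (𝕜 := ℝ) (A i)‖) =O[cofinite]
        fun i : ℤ => Real.exp (-(κ * |(i : ℝ)|)))
    (hA_inv : IsUnit (∑' i, A i))
    -- the linear process `X i = μ + ∑ j, A j (ε (i - j))`
    (μ : EuclideanSpace ℝ (Fin d)) (X : ℤ → Ω → EuclideanSpace ℝ (Fin d))
    (hX : ∀ i, ∀ᵐ ω ∂P,
      HasSum (fun j : ℤ => Matrix.toEuclideanCLM (𝕜 := ℝ) (A j) (ε (i - j) ω)) (X i ω - μ)) :
    -- the auxiliary sigma-fields are `D j = σ(ε j)`, and the process is centered at `μ`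
    let D : ℤ → MeasurableSpace Ω := fun j => MeasurableSpace.comap (ε j) inferInstance
    let Z : ℤ → Ω → EuclideanSpace ℝ (Fin d) := fun i ω => X i ω - μ
    LinearProcessEE.ApproxCondition P D Z ∧
    LinearProcessEE.MixingCondition P D ∧
    LinearProcessEE.MarkovCondition P D ∧
    -- the Cramér condition, for block lengths in the admissible range
    ((∃ κ ∈ Set.Ioo (0 : ℝ) 1, ∀ n : ℕ, κ⁻¹ ≤ (n : ℝ) →
        (ℓ n : ℝ) < κ⁻¹ * (n : ℝ) ^ (1 / 2 - κ)) →
      LinearProcessEE.CramerCondition P D Z w ℓ s) ∧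
    -- the Cramér inequality with `d_n = C ℓ_n`, for all block lengths
    (∃ κ₀ ∈ Set.Ioo (0 : ℝ) 1, ∀ κ ∈ Set.Ioc (0 : ℝ) κ₀, ∃ C : ℝ, 1 ≤ C ∧
      LinearProcessEE.CramerInequality P D Z w ℓ s κ (fun n => C * (ℓ n : ℝ))) := by
  intro D Z
  obtain ⟨κA, hκA, hO⟩ := hA_decay
  obtain ⟨K, hK⟩ := LinearProcessEE.exists_norm_le_mul_exp_of_isBigO hO
  have hB : Summable fun j => ‖Matrix.toEuclideanCLM (𝕜 := ℝ) (A j)‖ :=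
    Summable.of_nonneg_of_le (fun _ => norm_nonneg _) hK
      ((LinearProcessEE.summable_exp_neg_mul_abs_int hκA.1).mul_left K)
  obtain ⟨U, hU⟩ := LinearProcessEE.exists_rightInverse_tsum_toEuclideanCLM hB.of_norm hA_inv
  obtain ⟨M, hM⟩ := hw_bdd
  obtain ⟨c₀, κm, hc₀, hκm, hev⟩ :=
    LinearProcessEE.exists_eventually_expSup_norm_condExp_exp_block_le (Z := Z) hε_meas hε_indep
      hε_ident hε_sq hε_mean hε_ac hB hX hU hℓ (le_max_right M 0)
      (fun n k h1 h2 h3 => (hM n k h1 h2 h3).trans (le_max_left M 0)) hw_lim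
  obtain ⟨n₀, hn₀⟩ := eventually_atTop.1 hev
  -- The three bounds give, for `κ ≤ κ₀`: the final `1 - κm ≤ 1 - κ`, then `m ≥ 2` from `m > κ⁻¹`,
  -- and `n ≥ n₀` from `n ≥ κ⁻¹`.
  obtain ⟨κ₀, hκ₀, hκ₀m, hκ₀2, hκ₀n⟩ :
      ∃ κ₀ : ℝ, 0 < κ₀ ∧ κ₀ ≤ κm ∧ κ₀ ≤ 1 / 2 ∧ κ₀ ≤ 1 / ((n₀ : ℝ) + 1) :=
    ⟨min κm (min (1 / 2) (1 / ((n₀ : ℝ) + 1))), by positivity, min_le_left _ _,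
      (min_le_right _ _).trans (min_le_left _ _), (min_le_right _ _).trans (min_le_right _ _)⟩
  have hcramer : ∀ κ : ℝ, 0 < κ → κ ≤ κ₀ → ∀ dn : ℕ → ℝ,
      (∀ n, 1 ≤ ℓ n → c₀ * √(ℓ n) ≤ κ * dn n) →
      LinearProcessEE.CramerInequality P D Z w ℓ s κ dn := by
    intro κ hκ hκκ₀ dn hdn n m hn hm _ j₀ hj₀
    have h1 : (n₀ : ℝ) + 1 ≤ κ⁻¹ := by
      rw [← one_div, le_one_div (by positivity) hκ]
      exact hκκ₀.trans hκ₀n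
    have h2 : (2 : ℝ) ≤ κ⁻¹ := by
      rw [← one_div, le_one_div (by positivity) hκ]
      exact hκκ₀.trans hκ₀2
    have hn' : n₀ ≤ n := by
      have : (n₀ : ℝ) ≤ n := by linarith
      exact_mod_cast this
    have hm' : 2 ≤ m := by
      have : (2 : ℝ) ≤ m := by linarith
      exact_mod_cast this
    obtain ⟨hℓ1, hle⟩ := hn₀ n hn'
    refine (hle m hm' j₀ hj₀ _ fun t ht => (hdn n hℓ1).trans ht.1).trans
      (ENNReal.ofReal_le_ofReal ?_)
    linarith
  refine ⟨LinearProcessEE.approxCondition_of_exp_decay hε_meas hε_ident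
      (hε_sq.integrable one_le_two) hκA.1 hK hX,
    LinearProcessEE.mixingCondition_of_iIndepFun hε_meas hε_indep,
    LinearProcessEE.markovCondition_of_iIndepFun hε_meas hε_indep, ?_, κ₀, ⟨hκ₀, by linarith⟩, ?_⟩
  · rintro ⟨κ₁, hκ₁, h⟩
    have hκ : 0 < min κ₀ κ₁ := lt_min hκ₀ hκ₁.1
    have hC : 0 ≤ c₀ / min κ₀ κ₁ := by positivity
    -- `d_n` is of order `√ℓ`; dividing `c₀` by `κ` compensates the factor `κ` in the lower
    -- frequency bound `κ d_n ≤ ‖t‖`.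
    refine ⟨min κ₀ κ₁, ⟨hκ, (min_le_right _ _).trans_lt hκ₁.2⟩,
      fun n => max 1 (c₀ / min κ₀ κ₁ * √(ℓ n)), fun n => le_max_left _ _,
      LinearProcessEE.isBigO_max_one_mul_sqrt hℓ hC,
      LinearProcessEE.isBigO_sq_max_one_mul_sqrt hℓ hκ (min_le_right _ _) hκ₁.2 h hC,
      hcramer _ hκ (min_le_left _ _) _ fun n _ => ?_⟩
    calc c₀ * √(ℓ n) = min κ₀ κ₁ * (c₀ / min κ₀ κ₁ * √(ℓ n)) := by field_simp
      _ ≤ _ := by gcongr; exact le_max_right _ _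
  · intro κ hκ
    refine ⟨max 1 (c₀ / κ), le_max_left _ _, hcramer κ hκ.1 hκ.2 _ fun n hn => ?_⟩
    have h1 : (1 : ℝ) ≤ ℓ n := by exact_mod_cast hn
    have h2 : √(ℓ n : ℝ) ≤ ℓ n := Real.sqrt_le_self_iff.2 (Or.inr h1)
    have hκ0 := hκ.1
    calc c₀ * √(ℓ n) ≤ c₀ * ℓ n := by gcongr
      _ = κ * (c₀ / κ * ℓ n) := by field_simp
      _ ≤ _ := by gcongr; exact le_max_right _ _
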